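/- Let $d\ge 1$, $\Omega=[0,1)^d$, $\widetilde\Omega=[-\pi,\pi)^d$, $D_j=-i\partial_j$, $\mathbf D=(D_1,\dots,D_d)^t$. **Coefficients.** Let $a\in L_1(\mathbb R^d)$ with $\operatorname{mes}\{a\neq 0\}>0$, $a(\mathbf x)\ge 0$ and $a(-\mathbf x)=a(\mathbf x)$. Let $\mu$ be measurable on $\mathbb R^d\times\mathbb R^d$ with $0<\mu_-\le\mu(\mathbf x,\mathbf y)\le\mu_+<\infty$, $\mu(\mathbf x,\mathbf y)=\mu(\mathbf y,\mathbf x)$ and $\mu(\mathbf x+\mathbf m,\mathbf y+\mathbf n)=\mu(\mathbf x,\mathbf y)$ for $\mathbf m,\mathbf n\in\mathbb Z^d$. Put $M_k(a)=\int_{\mathbb R^d}|\mathbf x|^ka(\mathbf x)\,d\mathbf x$ and assume $M_4(a)<\infty$. **Fiber operator.** In $L_2(\Omega)$ (complex-valued functions) let $$\mathbb A(\boldsymbol\xi)u(\mathbf x)=p(\mathbf x)u(\mathbf x)-\int_\Omega\widetilde a(\boldsymbol\xi,\mathbf x-\mathbf y)\mu(\mathbf x,\mathbf y)u(\mathbf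 y)\,d\mathbf y,$$ where $p(\mathbf x)=\int_{\mathbb R^d}a(\mathbf x-\mathbf y)\mu(\mathbf x,\mathbf y)\,d\mathbf y$ and $\widetilde a(\boldsymbol\xi,\mathbf z)=\sum_{\mathbf n\in\mathbb Z^d}a(\mathbf z+\mathbf n)e^{-i\langle\boldsymbol\xi,\mathbf z+\mathbf n\rangle}$. **Effective fiber operator.** Let $v_1,\dots,v_d$ be the real $\mathbb Z^d$-periodic functions of class $L_2(\Omega)$ that solve $$\int_{\mathbb R^d}a(\mathbf x-\mathbf y)\mu(\mathbf x,\mathbf y)(v_j(\mathbf x)-v_j(\mathbf y))\,d\mathbf y=\int_{\mathbb R^d}a(\mathbf x-\mathbf y)\mu(\mathbf x,\mathbf y)(x_j-y_j)\,d\mathbf y\ \text{ for a.e. }\mathbf x\in\Omega,\qquad\int_\Omega v_j\,d\mathbf x=0;$$ such functions exist. Let $g^0$ be the matrix with entries $\tfrac12g_{kl}$, where $$g_{kl}=\int_\Omega d\mathbf x\int_{\mathbb R^d}d\mathbf y\,\bigl((x_k-y_k)(x_l-y_l)-v_k(\mathbf x)(x_l-y_l)-v_l(\mathbf x)(x_k-y_k)\bigr)a(\mathbf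 x-\mathbf y)\mu(\mathbf x,\mathbf y),$$ and let $\mathbb A^0(\boldsymbol\xi)=(\mathbf D+\boldsymbol\xi)^*g^0(\mathbf D+\boldsymbol\xi)$ in $L_2(\Omega)$, with domain the set of all $u\in L_2(\Omega)$ whose $\mathbb Z^d$-periodic extension belongs to $H^2_{\rm loc}(\mathbb R^d)$; the derivatives are those of the periodic extension. **Quantities controlling the constant.** Let $\widehat A(\mathbf y)=\int_{\mathbb R^d}(1-\cos\langle\mathbf z,\mathbf y\rangle)a(\mathbf z)\,d\mathbf z$, $\mathcal C_r(a)=\inf_{|\mathbf y|\ge r}\widehat A(\mathbf y)$, $\mathcal M(a)=\min_{|\boldsymbol\theta|=1}\int_{\mathbb R^d}a(\mathbf z)\langle\mathbf z,\boldsymbol\theta\rangle^2d\mathbf z$ and $r(a)=\frac{3\mathcal M(a)}{2M_3(a)}$. Let $\widetilde a(\mathbf z)=\sum_{\mathbf n\in\mathbb Z^d}a(\mathbf z+\mathbf n)$, $\widetilde a_1=\min\{\widetilde a,1\}$, $$\widetilde{\mathcal C}=\inf_{|\mathbf y|\ge2\pi}\int_\Omega\widetilde a_1(\mathbf z)(1-\cos\langle\mathbf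 z,\mathbf y\rangle)\,d\mathbf z,\qquad F(t)=\sup\Bigl\{\int_{\mathcal O}\widetilde a\,d\mathbf z:\ \mathcal O\subset[-2,2]^d\text{ measurable},\ \operatorname{mes}\mathcal O\le t\Bigr\}.$$ There exists a number $t_0>0$ with $\dfrac{\mu_+F(t_0)}{\mu_-\|\widetilde a_1\|_{L_1(\Omega)}}\le\dfrac12$; for such a $t_0$ put $$\mathfrak C=\max\left\{\frac1{(t_0\,\mu_-\,\widetilde{\mathcal C})^2},\ \left(\frac{\mu_+}{\mu_-}+\Bigl(\frac{2}{\mu_-\|\widetilde a_1\|_{L_1(\Omega)}}+\frac{\mu_+^2}{\mu_-^2}\Bigr)^{1/2}\right)^2\right\}.$$ **Theorem.** For all $\boldsymbol\xi\in\widetilde\Omega$ and $\varepsilon>0$ the resolvents $(\mathbb A(\boldsymbol\xi)+\varepsilon^2I)^{-1}$, $(\mathbb A^0(\boldsymbol\xi)+\varepsilon^2I)^{-1}$ and the operator $$K(\boldsymbol\xi,\varepsilon)=-i\sum_{j=1}^d[v_j](D_j+\xi_j)(\mathbb A^0(\boldsymbol\xi)+\varepsilon^2I)^{-1}+i\sum_{j=1}^d(\mathbb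 A^0(\boldsymbol\xi)+\varepsilon^2I)^{-1}(D_j+\xi_j)[v_j]$$ exist as bounded operators in $L_2(\Omega)$, and $$\bigl\|(\mathbb A(\boldsymbol\xi)+\varepsilon^2I)^{-1}-(\mathbb A^0(\boldsymbol\xi)+\varepsilon^2I)^{-1}-K(\boldsymbol\xi,\varepsilon)\bigr\|_{L_2(\Omega)\to L_2(\Omega)}\le \mathrm C_2(a,\mu).$$ Here $[v_j]$ is multiplication by $v_j$ (a bounded operator), and $(\mathbb A^0(\boldsymbol\xi)+\varepsilon^2I)^{-1}(D_j+\xi_j)$ denotes the continuous extension to $L_2(\Omega)$ of this operator from the dense set of functions $u\in L_2(\Omega)$ such that the weak derivative $\partial_ju$ of the periodic extension is the periodic extension of a function in $L_2(\Omega)$. The constant $\mathrm C_2(a,\mu)$ depends only on $d$, $\mu_-$, $\mu_+$, $M_1(a)$, $M_2(a)$, $M_3(a)$, $M_4(a)$, $\mathcal M(a)$, $\mathcal C_\pi(a)$, $\mathcal C_{r(a)}(a)$ and $\mathfrak C$; that is, it is the value of a function of these numbers which does not otherwise depend on $a$, $\mu$, $t_0$, $\boldsymbol\xi$, $\varepsilon$.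 -/

import Mathlib

open MeasureTheory
open scoped ContDiff

noncomputable section

namespace NonlocalHom

/-- `ℝ^d` with its Euclidean norm and inner product. -/
abbrev E (d : ℕ) : Type := EuclideanSpace ℝ (Fin d)

variable {d : ℕ}

/-- The lattice vector of `ℤ^d` in `ℝ^d` with integer coordinates `n`. -/
def lat (n : Fin d → ℤ) : E d := WithLp.toLp 2 (fun j => (n j : ℝ))

/-- The unit cell `Ω = [0,1)^d`. -/
def cell (d : ℕ) : Set (E d) := {x | ∀ j, x j ∈ Set.Ico (0 : ℝ) 1}

/-- The Brillouin zone `[-π,π)^d`, the cell of the dual lattice. -/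
def dualCell (d : ℕ) : Set (E d) := {ξ | ∀ j, ξ j ∈ Set.Ico (-Real.pi) Real.pi}

/-- Lebesgue measure on `Ω`. -/
abbrev cellMeasure (d : ℕ) : Measure (E d) := volume.restrict (cell d)

/-- The complex Hilbert space `L₂(Ω)`. -/
abbrev L2 (d : ℕ) : Type := Lp ℂ 2 (cellMeasure d)

/-- The standing conditions on the coefficients `a` and `μ`. -/
structure Coefficients (a : E d → ℝ) (μ : E d → E d → ℝ) (μm μp : ℝ) : Prop where
  integrable : Integrable a
  nontrivial : 0 < volume {x | a x ≠ 0}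
  nonneg : ∀ x, 0 ≤ a x
  even : ∀ x, a (-x) = a x
  measurable : AEStronglyMeasurable (Function.uncurry μ) (volume : Measure (E d × E d))
  lower_pos : 0 < μm
  lower : ∀ x y, μm ≤ μ x y
  upper : ∀ x y, μ x y ≤ μp
  symm : ∀ x y, μ x y = μ y x
  periodic : ∀ x y (m n : Fin d → ℤ), μ (x + lat m) (y + lat n) = μ x y

/-! ### Quantities on which the constant depends -/

/-- The moment `M_k(a)`. -/
def moment (a : E d → ℝ) (k : ℕ) : ℝ := ∫ x, ‖x‖ ^ k * a x

/-- The symbol `Â(y) = ∫ (1 - cos⟨z,y⟩) a(z) dz`. -/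
def symbol (a : E d → ℝ) (y : E d) : ℝ := ∫ z, (1 - Real.cos (inner ℝ z y)) * a z

/-- `𝒞_r(a)`, the infimum of `Â` over `|y| ≥ r`. -/
def symbolInf (a : E d → ℝ) (r : ℝ) : ℝ := sInf (symbol a '' {y | r ≤ ‖y‖})

/-- `ℳ(a)`, the minimum over the unit sphere of `θ ↦ ∫ a(z) ⟨z,θ⟩² dz`. -/
def secondMin (a : E d → ℝ) : ℝ :=
  sInf ((fun θ : E d => ∫ z, a z * (inner ℝ z θ) ^ 2) '' {θ | ‖θ‖ = 1})

/-- `r(a) = 3 ℳ(a) / (2 M₃(a))`. -/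
def radius (a : E d → ℝ) : ℝ := 3 * secondMin a / (2 * moment a 3)

/-- The periodization `ã(z) = ∑ₙ a(z+n)`. -/
def periodization (a : E d → ℝ) (z : E d) : ℝ := ∑' n : Fin d → ℤ, a (z + lat n)

/-- The truncation `ã₁ = min(ã, 1)`. -/
def truncation (a : E d → ℝ) (z : E d) : ℝ := min (periodization a z) 1

/-- `‖ã₁‖_{L₁(Ω)}` (the function `ã₁` is nonnegative when `a` is). -/
def truncMass (a : E d → ℝ) : ℝ := ∫ z in cell d, truncation a z

/-- The infimum over `|y| ≥ 2π` of `∫_Ω ã₁(z) (1 - cos⟨z,y⟩) dz`. -/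
def truncSymbolInf (a : E d → ℝ) : ℝ :=
  sInf ((fun y : E d => ∫ z in cell d, truncation a z * (1 - Real.cos (inner ℝ z y))) ''
    {y | 2 * Real.pi ≤ ‖y‖})

/-- The modulus of absolute continuity
`F_ã(t) = sup {∫_O ã : O ⊆ [-2,2]^d, mes O ≤ t}`. -/
def modulus (a : E d → ℝ) (t : ℝ) : ℝ :=
  sSup {s | ∃ O : Set (E d), MeasurableSet O ∧ (∀ z ∈ O, ∀ j, z j ∈ Set.Icc (-2 : ℝ) 2) ∧
    volume O ≤ ENNReal.ofReal t ∧ s = ∫ z in O, periodization a z}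

/-- The requirement on the auxiliary number `t₀`. -/
def IsThreshold (a : E d → ℝ) (μm μp t₀ : ℝ) : Prop :=
  0 < t₀ ∧ μp * modulus a t₀ / (μm * truncMass a) ≤ 1 / 2

/-- The constant `ℭ(ã,μ)`, formed with the number `t₀`. -/
def boundConst (a : E d → ℝ) (μm μp t₀ : ℝ) : ℝ :=
  max (1 / (t₀ * μm * truncSymbolInf a) ^ 2)
    ((μp / μm + Real.sqrt (2 / (μm * truncMass a) + μp ^ 2 / μm ^ 2)) ^ 2)

/-! ### The fiber operator `𝔸(ξ)` -/

/-- The potential `p(x) = ∫ a(x-y) μ(x,y) dy`. -/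
def potential (a : E d → ℝ) (μ : E d → E d → ℝ) (x : E d) : ℝ := ∫ y, a (x - y) * μ x y

/-- `ã(ξ,z) = ∑ₙ a(z+n) exp(-i⟨ξ,z+n⟩)`. -/
def blochKernel (a : E d → ℝ) (ξ z : E d) : ℂ :=
  ∑' n : Fin d → ℤ, (a (z + lat n) : ℂ) *
    Complex.exp (-Complex.I * ((inner ℝ ξ (z + lat n) : ℝ) : ℂ))

/-- `𝔸(ξ)u(x) = p(x)u(x) - ∫_Ω ã(ξ,x-y) μ(x,y) u(y) dy`. -/
def fiberFun (a : E d → ℝ) (μ : E d → E d → ℝ) (ξ : E d) (u : E d → ℂ) (x : E d) : ℂ :=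
  (potential a μ x : ℂ) * u x
    - ∫ y in cell d, blochKernel a ξ (x - y) * (μ x y : ℂ) * u y

/-- The graph of `𝔸(ξ)` in `L₂(Ω)`: `𝔸(ξ)u = h`. -/
def FiberGraph (a : E d → ℝ) (μ : E d → E d → ℝ) (ξ : E d) (u h : L2 d) : Prop :=
  (h : E d → ℂ) =ᵐ[cellMeasure d] fiberFun a μ ξ u

/-- For an operator `A` in `L₂(Ω)` given by its graph, the bounded operator `R` is the inverse of
`A + ε²I`: one has `R f = u` exactly when `u ∈ Dom A` and `A u + ε² u = f`. -/
def IsResolvent (A : L2 d → L2 d → Prop) (ε : ℝ) (R : L2 d →L[ℂ] L2 d) : Prop :=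
  ∀ f u, R f = u ↔ A u (f - ((ε ^ 2 : ℝ) : ℂ) • u)

/-! ### The auxiliary problems and the effective matrix -/

/-- `v₁, …, v_d` are real `ℤ^d`-periodic functions of class `L₂(Ω)` with mean zero over the cell
that solve the auxiliary problems. -/
structure IsCellSolution (a : E d → ℝ) (μ : E d → E d → ℝ) (v : Fin d → E d → ℝ) : Prop where
  memLp : ∀ j, MemLp (v j) 2 (cellMeasure d)
  periodic : ∀ j x (n : Fin d → ℤ), v j (x + lat n) = v j x
  equation : ∀ j, ∀ᵐ x ∂(cellMeasure d),
    ∫ y, a (x - y) * μ x y * (v j x - v j y) = ∫ y, a (x - y) * μ x y * (x j - y j)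
  mean_zero : ∀ j, ∫ x in cell d, v j x = 0

/-- The effective matrix `g⁰`, with entries `g_{kl} / 2`. -/
def effMatrix (a : E d → ℝ) (μ : E d → E d → ℝ) (v : Fin d → E d → ℝ) :
    Matrix (Fin d) (Fin d) ℝ := fun k l =>
  (1 / 2) * ∫ x in cell d, ∫ y,
    ((x k - y k) * (x l - y l) - v k x * (x l - y l) - v l x * (x k - y k))
      * a (x - y) * μ x y

/-! ### Periodic weak derivatives and the effective fiber operator `𝔸⁰(ξ)` -/

/-- The `ℤ^d`-periodic extension to `ℝ^d` of a function on `Ω`. -/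
def perExt (u : E d → ℂ) (x : E d) : ℂ := u (WithLp.toLp 2 (fun j => Int.fract (x j)))

/-- The periodic extension of `u` has the periodic extension of `g` as its weak derivative
`∂_j` in `ℝ^d`. -/
def HasWeakDeriv (j : Fin d) (u g : L2 d) : Prop :=
  ∀ φ : E d → ℂ, ContDiff ℝ ∞ φ → HasCompactSupport φ →
    ∫ x, perExt u x * fderiv ℝ φ x (EuclideanSpace.single j 1) = -∫ x, perExt g x * φ x

/-- `w = (D_j + ξ_j) u` with `D_j = -i ∂_j`. -/
def ShiftedD (ξ : E d) (j : Fin d) (u w : L2 d) : Prop :=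
  ∃ g : L2 d, HasWeakDeriv j u g ∧ w = (-Complex.I) • g + (ξ j : ℂ) • u

/-- The graph of `𝔸⁰(ξ) = (D + ξ)* g (D + ξ)`, whose domain consists of the functions in `L₂(Ω)`
whose periodic extension is of class `H²_loc(ℝ^d)`: here `w l = (D_l + ξ_l)u` and
`z k l = (D_k + ξ_k)(D_l + ξ_l)u`. -/
def EffGraph (g : Matrix (Fin d) (Fin d) ℝ) (ξ : E d) (u h : L2 d) : Prop :=
  ∃ (w : Fin d → L2 d) (z : Fin d → Fin d → L2 d),
    (∀ l, ShiftedD ξ l u (w l)) ∧ (∀ k l, ShiftedD ξ k (w l) (z k l)) ∧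
    h = ∑ k, ∑ l, (g k l : ℂ) • z k l

/-- With `R₀ = (𝔸⁰(ξ) + ε²I)⁻¹`, the bounded operator `K` is the corrector
`-i ∑ⱼ [vⱼ] (D_j+ξ_j) R₀ + i ∑ⱼ R₀ (D_j+ξ_j) [vⱼ]`. Here `V j` is multiplication by `vⱼ`,
`T j = (D_j+ξ_j) R₀`, and `S j` is the bounded operator `R₀ (D_j+ξ_j)` in `L₂(Ω)`, i.e. the
continuous extension of that operator from its dense domain, the functions with weak derivative
`∂_j` in `L₂(Ω)`. (The extension is needed since `vⱼ` is merely bounded.) -/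
def IsCorrector (v : Fin d → E d → ℝ) (ξ : E d) (R₀ K : L2 d →L[ℂ] L2 d) : Prop :=
  ∃ V T S : Fin d → (L2 d →L[ℂ] L2 d),
    (∀ j u, (V j u : E d → ℂ) =ᵐ[cellMeasure d] fun x => (v j x : ℂ) * u x) ∧
    (∀ j f, ShiftedD ξ j (R₀ f) (T j f)) ∧
    (∀ j h w, ShiftedD ξ j h w → S j h = R₀ w) ∧
    K = (-Complex.I) • ∑ j, (V j).comp (T j) + Complex.I • ∑ j, (S j).comp (V j)

end NonlocalHom

end

open NonlocalHom

/-! ### The lattice, the unit cell and unfolding of integrals -/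

namespace NonlocalHom

variable {d : ℕ}

/-! As `ξ` and `ε` tend to zero, both resolvents become unbounded only near the constant functions.
Put `ρ = (⟨g⁰ξ,ξ⟩ + ε²)⁻¹`, `θ = -i ∑ ξⱼvⱼ` and `ψ = 1 + θ`. The claim follows once `(𝔸(ξ) + ε²)⁻¹`
and `(𝔸⁰(ξ) + ε²)⁻¹ + K` are each shown to differ from the same rank one operator `ρ⟨ψ,·⟩ψ` by a
bounded operator, uniformly in `ξ` and `ε`.

For `𝔸(ξ)`: with `z = x - y`, its quadratic form is half the squared norm of the twisted difference
`u(x) - exp(-i⟨ξ,z⟩) u(x-z)` in the measure `a(z) μ(x,x-z) dx dz` on `Ω × ℝ^d`. This measure is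
invariant under interchanging `x` and `y` (`Coefficients.measurePreserving_flip`). Bounding `μ`
below by `μ₋` and passing to Fourier coefficients bounds the form below by `μ₋ ∑ Â(ξ+2πn)|uₙ|²`
(`Coefficients.coercive`). Hence the form is at least `c|ξ|²‖u‖²` everywhere and at least
`μ₋𝒞_π‖u‖²` on the complement of the constants. The auxiliary equations cancel the first order term
of `𝔸(ξ)ψ`, so that `‖𝔸(ξ)ψ‖ = O(|ξ|²)`, while `⟨𝔸(ξ)ψ,ψ⟩ = ⟨g⁰ξ,ξ⟩ + O(|ξ|⁴)` because the cubic
terms are absent (`norm_corrected_diff_sq`). The abstract `norm_resolvent_sub_rankOne_le` turns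
these four facts into the rank one approximation.

For `𝔸⁰(ξ)` all operators are Fourier multipliers, and only the zero mode is not bounded uniformly
(`norm_effective_add_corrector_sub_le`). On it the resolvent is `ρ⟨1,·⟩1`, and the two halves of `K`
supply the cross terms `ρ⟨1,·⟩θ` and `ρ⟨θ,·⟩1`. The remaining term `ρ⟨θ,·⟩θ` is bounded, since `‖θ‖²
= O(|ξ|²)` and `ρ|ξ|² ≤ 1/c`. Positivity of `g⁰` is inherited from `𝔸(ξ)` by letting `ξ` tend to
zero along a ray in the expansion of `⟨𝔸(ξ)ψ,ψ⟩`.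

The constant has the asserted dependence because `sup|vⱼ|` is controlled by the listed quantities
(`Coefficients.ae_abs_le_of_solvesAux`). The spectral gap bounds `vⱼ` in `L₂`, so `|vⱼ|` exceeds a
suitable level `r` only on a set of measure at most `t₀`. By the choice of `t₀` that set carries at
most half of the lower bound for the mass of the kernel, and testing the equation with the part of
`vⱼ` above a higher level shows that this part vanishes. -/

/-- The representative in `Ω` of a point modulo `ℤ^d`. -/
noncomputable def wrap (x : E d) : E d := WithLp.toLp 2 (fun j => Int.fract (x j))

@[simp] theorem wrap_apply (x : E d) (j : Fin d) : wrap x j = Int.fract (x j) := rfl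

@[simp] theorem lat_apply (n : Fin d → ℤ) (j : Fin d) : lat n j = n j := rfl

theorem wrap_mem_cell (x : E d) : wrap x ∈ cell d := fun _ =>
  ⟨Int.fract_nonneg _, Int.fract_lt_one _⟩

theorem wrap_eq_self {x : E d} (hx : x ∈ cell d) : wrap x = x := by
  ext j
  exact Int.fract_eq_self.2 (hx j)

@[simp] theorem wrap_add_lat (x : E d) (n : Fin d → ℤ) : wrap (x + lat n) = wrap x := by
  ext j
  simp

theorem wrap_eq_add_lat (x : E d) : wrap x = x + lat (fun j => -⌊x j⌋) := by
  ext j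
  simp [Int.fract, sub_eq_add_neg]

theorem wrap_wrap_sub (x z : E d) : wrap (wrap x - z) = wrap (x - z) := by
  rw [wrap_eq_add_lat x, add_sub_right_comm, wrap_add_lat]

theorem perExt_eq (u : E d → ℂ) (x : E d) : perExt u x = u (wrap x) := rfl

theorem measurable_wrap : Measurable (wrap : E d → E d) := by
  unfold wrap
  refine (WithLp.measurable_toLp 2 (Fin d → ℝ)).comp ?_
  exact measurable_pi_lambda _ fun j => measurable_fract.comp (by fun_prop)

theorem measurableSet_cell : MeasurableSet (cell d) := by
  have : cell d = ⋂ j, (fun x : E d => x j) ⁻¹' Set.Ico 0 1 := by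
    ext x; simp [cell]
  rw [this]
  exact MeasurableSet.iInter fun j => (by fun_prop : Measurable fun x : E d => x j) measurableSet_Ico

theorem volume_cell : volume (cell d) = 1 := by
  have h := (EuclideanSpace.volume_preserving_symm_measurableEquiv_toLp (Fin d)).symm
  have h2 : cell d = (MeasurableEquiv.toLp 2 (Fin d → ℝ)).symm ⁻¹'
      (Set.univ.pi fun _ => Set.Ico 0 1) := by
    ext x; simp [cell]
  rw [h2, (EuclideanSpace.volume_preserving_symm_measurableEquiv_toLp (Fin d)).measure_preimage_equiv]
  simp [Real.volume_pi_Ico]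

instance : IsProbabilityMeasure (cellMeasure d) := ⟨by simp [volume_cell]⟩

/-- The lattice embedding as a homomorphism. -/
def latHom (d : ℕ) : (Fin d → ℤ) →+ E d where
  toFun := lat
  map_zero' := by ext j; simp
  map_add' m n := by ext j; simp

theorem latHom_apply (n : Fin d → ℤ) : latHom d n = lat n := rfl

theorem lat_injective : Function.Injective (lat : (Fin d → ℤ) → E d) := fun m n h => by
  ext j
  have := congrArg (fun x : E d => x j) h
  simpa using this

theorem lat_neg (n : Fin d → ℤ) : lat (-n) = -lat n := (latHom d).map_neg n
theorem lat_add (m n : Fin d → ℤ) : lat (m + n) = lat m + lat n := (latHom d).map_add m n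

instance : Countable (latHom d).range := by
  exact (Set.countable_range (latHom d)).to_subtype

theorem isAddFundamentalDomain_cell :
    IsAddFundamentalDomain (latHom d).range (cell d) (volume : Measure (E d)) := by
  refine IsAddFundamentalDomain.mk' measurableSet_cell.nullMeasurableSet fun x => ?_
  refine ⟨⟨latHom d (fun j => -⌊x j⌋), ⟨_, rfl⟩⟩, ?_, ?_⟩
  · show latHom d _ + x ∈ cell d
    rw [add_comm, latHom_apply, ← wrap_eq_add_lat]
    exact wrap_mem_cell x
  · rintro ⟨_, n, rfl⟩ h
    have h' : lat n + x ∈ cell d := h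
    have h2 := wrap_eq_self h'
    rw [add_comm, wrap_add_lat, wrap_eq_add_lat x, add_left_cancel_iff] at h2
    exact Subtype.ext h2.symm

/-- The lattice translations are indexed by `ℤ^d`. -/
noncomputable def latEquiv (d : ℕ) : (Fin d → ℤ) ≃ (latHom d).range :=
  Equiv.ofInjective (latHom d) lat_injective

theorem lintegral_eq_cell_tsum (f : E d → ENNReal) :
    ∫⁻ x, f x = ∑' n : Fin d → ℤ, ∫⁻ x in cell d, f (x + lat n) := by
  rw [isAddFundamentalDomain_cell.lintegral_eq_tsum'' f, ← (latEquiv d).tsum_eq]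
  refine tsum_congr fun n => lintegral_congr fun x => ?_
  rw [add_comm x]
  rfl

theorem integral_eq_cell_tsum {G : Type*} [NormedAddCommGroup G] [NormedSpace ℝ G] {f : E d → G}
    (hf : Integrable f) :
    ∫ x, f x = ∑' n : Fin d → ℤ, ∫ x in cell d, f (x + lat n) := by
  rw [isAddFundamentalDomain_cell.integral_eq_tsum'' f hf, ← (latEquiv d).tsum_eq]
  refine tsum_congr fun n => integral_congr_ae (.of_forall fun x => ?_)
  exact congrArg f (add_comm (lat n) x)

/-- The cell and its translate by `z` are both fundamental domains of the lattice, and a lattice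
invariant set has the same measure in each. On the translate the map is an honest translation. -/
theorem measurePreserving_wrap_sub (z : E d) :
    MeasurePreserving (fun x => wrap (x - z)) (cellMeasure d) (cellMeasure d) := by
  have hm : Measurable fun x : E d => wrap (x - z) := measurable_wrap.comp (by fun_prop)
  refine ⟨hm, ?_⟩
  ext S hS
  rw [Measure.map_apply hm hS, Measure.restrict_apply (hm hS), Measure.restrict_apply hS]
  have ht : IsAddFundamentalDomain (latHom d).range ((fun x => x - z) ⁻¹' cell d)
      (volume : Measure (E d)) := by
    refine isAddFundamentalDomain_cell.preimage_of_equiv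
      (measurePreserving_sub_right volume z).quasiMeasurePreserving (e := id)
      Function.bijective_id ?_
    intro g x
    show (g : E d) + x - z = g + (x - z)
    abel
  have hinv : ∀ g : (latHom d).range, (fun x => g +ᵥ x) ⁻¹' ((fun x : E d => wrap (x - z)) ⁻¹' S) =
      (fun x : E d => wrap (x - z)) ⁻¹' S := by
    rintro ⟨_, n, rfl⟩
    ext x
    show wrap (lat n + x - z) ∈ S ↔ _
    rw [add_comm, add_sub_right_comm, wrap_add_lat]
    rfl
  rw [isAddFundamentalDomain_cell.measure_set_eq ht (hm hS) hinv]
  have : (fun x : E d => wrap (x - z)) ⁻¹' S ∩ (fun x => x - z) ⁻¹' cell d =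
      (fun x => x - z) ⁻¹' (S ∩ cell d) := by
    ext x
    simp only [Set.mem_inter_iff, Set.mem_preimage]
    constructor
    · rintro ⟨h1, h2⟩
      rw [wrap_eq_self h2] at h1
      exact ⟨h1, h2⟩
    · rintro ⟨h1, h2⟩
      rw [wrap_eq_self h2]
      exact ⟨h1, h2⟩
  rw [this, (measurePreserving_sub_right volume z).measure_preimage
    (hS.inter measurableSet_cell).nullMeasurableSet]

end NonlocalHom

/-! ### The Fourier basis of `L₂(Ω)` -/

namespace NonlocalHom

variable {d : ℕ}

open Complex in
/-- The exponential `exp(2πi⟨n,x⟩)`. -/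
noncomputable def expo (n : Fin d → ℤ) (x : E d) : ℂ :=
  exp ((2 * Real.pi * ∑ j, (n j : ℝ) * x j : ℝ) * I)

theorem norm_expo (n : Fin d → ℤ) (x : E d) : ‖expo n x‖ = 1 := by
  rw [expo, Complex.norm_exp_ofReal_mul_I]

theorem continuous_expo (n : Fin d → ℤ) : Continuous (expo n) := by
  unfold expo
  fun_prop

theorem measurable_expo (n : Fin d → ℤ) : Measurable (expo n) := (continuous_expo n).measurable

theorem expo_add (n : Fin d → ℤ) (x y : E d) : expo n (x + y) = expo n x * expo n y := by
  simp only [expo, ← Complex.exp_add, ← add_mul, ← Complex.ofReal_add, ← mul_add,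
    ← Finset.sum_add_distrib, PiLp.add_apply]

theorem expo_add_index (m n : Fin d → ℤ) (x : E d) : expo (m + n) x = expo m x * expo n x := by
  simp only [expo, ← Complex.exp_add, ← add_mul, ← Complex.ofReal_add, ← mul_add,
    ← Finset.sum_add_distrib, Pi.add_apply, Int.cast_add]

@[simp] theorem expo_zero_index (x : E d) : expo 0 x = 1 := by simp [expo]

theorem expo_lat (n m : Fin d → ℤ) : expo n (lat m) = 1 := by
  rw [expo, Complex.exp_eq_one_iff]
  refine ⟨∑ j, n j * m j, ?_⟩
  push_cast
  simp
  ring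

theorem expo_add_lat (n m : Fin d → ℤ) (x : E d) : expo n (x + lat m) = expo n x := by
  rw [expo_add, expo_lat, mul_one]

theorem expo_wrap (n : Fin d → ℤ) (x : E d) : expo n (wrap x) = expo n x := by
  rw [wrap_eq_add_lat, expo_add_lat]

theorem conj_expo (n : Fin d → ℤ) (x : E d) : (starRingEnd ℂ) (expo n x) = expo (-n) x := by
  simp only [expo, ← Complex.exp_conj, map_mul, Complex.conj_ofReal, Complex.conj_I]
  simp

theorem memLp_expo (n : Fin d → ℤ) : MemLp (expo n) 2 (cellMeasure d) :=
  MemLp.of_bound (measurable_expo n).aestronglyMeasurable 1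
    (.of_forall fun x => (norm_expo n x).le)

/-- The exponential as an element of `L₂(Ω)`. -/
noncomputable def expoLp (n : Fin d → ℤ) : L2 d := (memLp_expo n).toLp _

theorem coeFn_expoLp (n : Fin d → ℤ) : (expoLp n : E d → ℂ) =ᵐ[cellMeasure d] expo n :=
  MemLp.coeFn_toLp _

theorem inner_eq_integral (u w : L2 d) :
    inner ℂ u w = ∫ x in cell d, (starRingEnd ℂ) (u x) * w x := by
  rw [L2.inner_def]
  refine integral_congr_ae (.of_forall fun x => ?_)
  simp [mul_comm]

/-- Translation modulo the lattice by half a period in a coordinate with `n j ≠ 0` preserves the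
integral and changes the sign of the exponential. -/
theorem integral_expo {n : Fin d → ℤ} (hn : n ≠ 0) : ∫ x in cell d, expo n x = 0 := by
  obtain ⟨j, hj⟩ := Function.ne_iff.1 hn
  have hj' : (n j : ℝ) ≠ 0 := by exact_mod_cast hj
  set z : E d := EuclideanSpace.single j (1 / (2 * n j) : ℝ)
  have hz : expo n (-z) = -1 := by
    have : ∑ i, (n i : ℝ) * (-z) i = -(1 / 2) := by
      rw [Finset.sum_eq_single j]
      · simp [z]
        field_simp
      · intro i _ hi
        simp [z, hi]
      · simp
    rw [expo, this]
    have : ((2 * Real.pi * -(1 / 2) : ℝ) * Complex.I : ℂ) = -(Real.pi * Complex.I) := by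
      push_cast; ring
    rw [this, Complex.exp_neg, Complex.exp_pi_mul_I]
    norm_num
  have h := (measurePreserving_wrap_sub z).map_eq
  have h2 : ∫ x in cell d, expo n x = ∫ x in cell d, expo n (wrap (x - z)) := by
    conv_lhs => rw [show volume.restrict (cell d) = cellMeasure d from rfl, ← h]
    rw [integral_map (measurePreserving_wrap_sub z).measurable.aemeasurable
      (measurable_expo n).aestronglyMeasurable]
  simp only [expo_wrap, sub_eq_add_neg, expo_add, hz] at h2
  simp only [mul_neg, mul_one, integral_neg] at h2
  exact self_eq_neg.1 h2

theorem orthonormal_expoLp : Orthonormal ℂ (expoLp : (Fin d → ℤ) → L2 d) := by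
  rw [orthonormal_iff_ite]
  intro m n
  rw [inner_eq_integral]
  have : ∫ x in cell d, (starRingEnd ℂ) (expoLp m x) * expoLp n x =
      ∫ x in cell d, expo (-m + n) x := by
    refine integral_congr_ae ?_
    filter_upwards [coeFn_expoLp m, coeFn_expoLp n] with x h1 h2
    rw [h1, h2, conj_expo, expo_add_index]
  rw [this]
  split_ifs with h
  · simp [h]
  · exact integral_expo fun h0 => h (by rwa [neg_add_eq_zero] at h0)

/-- The projection of `ℝ^d` to the torus. -/
def toTorus (x : E d) : UnitAddTorus (Fin d) := fun j => (x j : UnitAddCircle)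

theorem continuous_toTorus : Continuous (toTorus : E d → _) := by
  unfold toTorus
  exact continuous_pi fun j => (AddCircle.continuous_mk' 1).comp (by fun_prop)

/-- The section of `toTorus` with values in `Ω`. -/
noncomputable def ofTorus (t : UnitAddTorus (Fin d)) : E d :=
  WithLp.toLp 2 fun j => (AddCircle.equivIco 1 0 (t j) : ℝ)

theorem measurable_ofTorus : Measurable (ofTorus : _ → E d) := by
  unfold ofTorus
  refine (WithLp.measurable_toLp 2 (Fin d → ℝ)).comp ?_
  exact measurable_pi_lambda _ fun j => measurable_subtype_coe.comp
    ((AddCircle.measurableEquivIco 1 0).measurable.comp (measurable_pi_apply j))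

theorem ofTorus_toTorus (x : E d) : ofTorus (toTorus x) = wrap x := by
  ext j
  simp [ofTorus, toTorus, AddCircle.coe_equivIco_mk_apply]

theorem mFourier_toTorus (n : Fin d → ℤ) (x : E d) :
    UnitAddTorus.mFourier n (toTorus x) = expo n x := by
  simp only [UnitAddTorus.mFourier, ContinuousMap.coe_mk, toTorus, fourier_coe_apply, expo,
    ← Complex.exp_sum]
  congr 1
  push_cast
  rw [Finset.mul_sum, Finset.sum_mul]
  refine Finset.sum_congr rfl fun j _ => ?_
  simp
  ring

/-- Completeness is transported from the torus: trigonometric polynomials are uniformly dense in the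
continuous functions, and these are dense in `L₂` of any finite measure there. It is enough to use
the image `τ` of the cell measure, without identifying it with Haar measure. -/
theorem eq_zero_of_inner_expoLp_eq_zero {u : L2 d} (hu : ∀ n, inner ℂ (expoLp n) u = 0) : u = 0 := by
  set τ : Measure (UnitAddTorus (Fin d)) := (cellMeasure d).map toTorus with hτ
  have hq : MeasurePreserving toTorus (cellMeasure d) τ :=
    ⟨continuous_toTorus.measurable, rfl⟩
  have : IsProbabilityMeasure τ := Measure.isProbabilityMeasure_map hq.measurable.aemeasurable
  have hcell : ∀ᵐ x ∂(cellMeasure d), x ∈ cell d := ae_restrict_mem measurableSet_cell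
  have hs : MeasurePreserving ofTorus τ (cellMeasure d) := by
    refine ⟨measurable_ofTorus, ?_⟩
    rw [hτ, Measure.map_map measurable_ofTorus hq.measurable]
    have : (ofTorus ∘ toTorus : E d → E d) =ᵐ[cellMeasure d] id := by
      filter_upwards [hcell] with x hx
      simp [ofTorus_toTorus, wrap_eq_self hx]
    rw [Measure.map_congr this, Measure.map_id]
  have hU : MemLp (u ∘ ofTorus) 2 τ := (Lp.memLp u).comp_measurePreserving hs
  set U := hU.toLp _
  have key : ∀ f : C(UnitAddTorus (Fin d), ℂ), inner ℂ (ContinuousMap.toLp 2 τ ℂ f) U = 0 := by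
    have hclosed : IsClosed {f : C(UnitAddTorus (Fin d), ℂ) |
        inner ℂ (ContinuousMap.toLp 2 τ ℂ f) U = 0} :=
      isClosed_eq (by fun_prop) continuous_const
    have hspan : (Submodule.span ℂ (Set.range (UnitAddTorus.mFourier (d := Fin d))) : Set _) ⊆
        {f : C(UnitAddTorus (Fin d), ℂ) | inner ℂ (ContinuousMap.toLp 2 τ ℂ f) U = 0} := by
      intro f hf
      induction hf using Submodule.span_induction with
      | mem f hf =>
        obtain ⟨n, rfl⟩ := hf
        show inner ℂ _ U = 0
        rw [← hu n, inner_eq_integral, L2.inner_def]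
        have h1 : ∫ t, inner ℂ ((ContinuousMap.toLp 2 τ ℂ (UnitAddTorus.mFourier n)) t) (U t) ∂τ =
            ∫ t, (starRingEnd ℂ) (UnitAddTorus.mFourier n t) * u (ofTorus t) ∂τ := by
          refine integral_congr_ae ?_
          filter_upwards [ContinuousMap.coeFn_toLp (𝕜 := ℂ) (p := 2) τ (UnitAddTorus.mFourier n),
            hU.coeFn_toLp] with t h1 h2
          rw [h1, h2]
          simp [mul_comm]
        rw [h1, hτ, integral_map hq.measurable.aemeasurable]
        · refine integral_congr_ae ?_
          filter_upwards [hcell, coeFn_expoLp n] with x hx h2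
          rw [mFourier_toTorus, ofTorus_toTorus, wrap_eq_self hx, h2]
        · exact (by fun_prop : Continuous fun t =>
            (starRingEnd ℂ) (UnitAddTorus.mFourier n t)).aestronglyMeasurable.mul hU.1
      | zero => simp
      | add f g _ _ hf hg =>
        simp only [Set.mem_ofPred_eq] at hf hg ⊢
        rw [map_add, inner_add_left, hf, hg, add_zero]
      | smul c f _ hf =>
        simp only [Set.mem_ofPred_eq] at hf ⊢
        rw [map_smul, inner_smul_left, hf, mul_zero]
    intro f
    have := closure_minimal hspan hclosed
    rw [← Submodule.topologicalClosure_coe, UnitAddTorus.span_mFourier_closure_eq_top] at this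
    exact this (Set.mem_univ f)
  have hU0 : U = 0 := by
    have hd := ContinuousMap.toLp_denseRange (E := ℂ) (μ := τ) (p := 2) ℂ (by simp)
    refine hd.eq_zero_of_inner_right (𝕜 := ℂ) ?_
    exact fun f => key f
  have h0 : u ∘ ofTorus =ᵐ[τ] 0 := by
    have := hU.coeFn_toLp
    rw [show hU.toLp _ = U from rfl, hU0] at this
    exact this.symm.trans (Lp.coeFn_zero _ _ _)
  have h1 := hq.quasiMeasurePreserving.ae h0
  rw [Lp.eq_zero_iff_ae_eq_zero]
  filter_upwards [hcell, h1] with x hx h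
  simpa [ofTorus_toTorus, wrap_eq_self hx] using h

/-- The Fourier basis of `L₂(Ω)`. -/
noncomputable def fourierBasis (d : ℕ) : HilbertBasis (Fin d → ℤ) ℂ (L2 d) :=
  HilbertBasis.mkOfOrthogonalEqBot orthonormal_expoLp (by
    rw [Submodule.eq_bot_iff]
    intro u hu
    refine eq_zero_of_inner_expoLp_eq_zero fun n => ?_
    exact hu _ (Submodule.subset_span ⟨n, rfl⟩))

theorem fourierBasis_apply (n : Fin d → ℤ) : fourierBasis d n = expoLp n := by
  simp [fourierBasis]

/-- The Fourier coefficients. -/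
noncomputable def coef (u : L2 d) (n : Fin d → ℤ) : ℂ := inner ℂ (expoLp n) u

theorem coef_eq_integral (u : L2 d) (n : Fin d → ℤ) :
    coef u n = ∫ x in cell d, expo (-n) x * u x := by
  rw [coef, inner_eq_integral]
  refine integral_congr_ae ?_
  filter_upwards [coeFn_expoLp n] with x h
  rw [h, conj_expo]

theorem coef_add (u w : L2 d) (n : Fin d → ℤ) : coef (u + w) n = coef u n + coef w n :=
  inner_add_right _ _ _
theorem coef_sub (u w : L2 d) (n : Fin d → ℤ) : coef (u - w) n = coef u n - coef w n :=
  inner_sub_right _ _ _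
theorem coef_smul (c : ℂ) (u : L2 d) (n : Fin d → ℤ) : coef (c • u) n = c * coef u n :=
  inner_smul_right _ _ _
theorem coef_sum {ι : Type*} (s : Finset ι) (u : ι → L2 d) (n : Fin d → ℤ) :
    coef (∑ i ∈ s, u i) n = ∑ i ∈ s, coef (u i) n := inner_sum _ _ _

theorem coef_ext {u w : L2 d} (h : ∀ n, coef u n = coef w n) : u = w := by
  rw [← sub_eq_zero]
  refine eq_zero_of_inner_expoLp_eq_zero fun n => ?_
  show coef (u - w) n = 0
  rw [coef_sub, h, sub_self]

theorem hasSum_coef (u : L2 d) : HasSum (fun n => coef u n • expoLp n) u := by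
  have := (fourierBasis d).hasSum_repr u
  simp only [HilbertBasis.repr_apply_apply, fourierBasis_apply] at this
  exact this

theorem hasSum_norm_sq_coef (u : L2 d) : HasSum (fun n => ‖coef u n‖ ^ 2) (‖u‖ ^ 2) := by
  have h := (fourierBasis d).hasSum_inner_mul_inner u u
  simp only [fourierBasis_apply] at h
  have hterm : ∀ n, inner ℂ u (expoLp n) * inner ℂ (expoLp n) u = ((‖coef u n‖ ^ 2 : ℝ) : ℂ) := by
    intro n
    rw [← inner_conj_symm u, ← Complex.normSq_eq_conj_mul_self, Complex.normSq_eq_norm_sq]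
    rfl
  have hsum : inner ℂ u u = ((‖u‖ ^ 2 : ℝ) : ℂ) := by
    rw [inner_self_eq_norm_sq_to_K]
    simp
  simp only [hterm, hsum] at h
  exact Complex.hasSum_ofReal.1 h

theorem coef_expoLp (m n : Fin d → ℤ) : coef (expoLp m) n = if n = m then 1 else 0 :=
  orthonormal_iff_ite.1 orthonormal_expoLp n m

end NonlocalHom

/-! ### Periodic extensions and weak derivatives through Fourier coefficients -/

namespace NonlocalHom

variable {d : ℕ}

/-- Composition with a map `π` into `Ω` that does not concentrate measure, followed by
multiplication by a function bounded by `1`, is a bounded operator between the `L₂` spaces. -/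
theorem exists_pullback {Y : Type*} [MeasurableSpace Y] {ν : Measure Y} {π : Y → E d}
    (hπ : Measurable π) {c : ENNReal} (hc : c ≠ ⊤) (h : ν.map π ≤ c • cellMeasure d)
    {m : Y → ℂ} (hm : AEStronglyMeasurable m ν) (hm1 : ∀ y, ‖m y‖ ≤ 1) :
    ∃ T : L2 d →L[ℂ] Lp ℂ 2 ν, ∀ u, T u =ᵐ[ν] fun y => m y * u (π y) := by
  have hac : ν.map π ≪ cellMeasure d :=
    (Measure.absolutelyContinuous_of_le h).trans (Measure.smul_absolutelyContinuous)
  have hq : Measure.QuasiMeasurePreserving π ν (cellMeasure d) := ⟨hπ, hac⟩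
  have hbd : ∀ u : L2 d, eLpNorm (fun y => m y * u (π y)) 2 ν ≤
      c ^ (1 / (2 : ENNReal)).toReal * eLpNorm u 2 (cellMeasure d) := by
    intro u
    calc eLpNorm (fun y => m y * u (π y)) 2 ν ≤ eLpNorm (u ∘ π) 2 ν := by
          refine eLpNorm_mono fun y => ?_
          rw [norm_mul]
          exact mul_le_of_le_one_left (norm_nonneg _) (hm1 y)
      _ = eLpNorm u 2 (ν.map π) :=
          (eLpNorm_map_measure ((Lp.aestronglyMeasurable u).mono_ac hac) hπ.aemeasurable).symm
      _ ≤ eLpNorm u 2 (c • cellMeasure d) := eLpNorm_mono_measure _ h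
      _ = _ := eLpNorm_smul_measure_of_ne_top (by simp) _ _
  have hmem : ∀ u : L2 d, MemLp (fun y => m y * u (π y)) 2 ν := fun u =>
    ⟨hm.mul ((Lp.aestronglyMeasurable u).comp_quasiMeasurePreserving hq),
      (hbd u).trans_lt (ENNReal.mul_lt_top (ENNReal.rpow_lt_top_of_nonneg (by simp) hc)
        (Lp.eLpNorm_lt_top u))⟩
  refine ⟨LinearMap.mkContinuous
    { toFun := fun u => (hmem u).toLp _
      map_add' := fun u w => ?_
      map_smul' := fun k u => ?_ } (c ^ (1 / (2 : ENNReal)).toReal).toReal fun u => ?_, fun u => ?_⟩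
  · rw [← MemLp.toLp_add]
    refine MemLp.toLp_congr _ _ ?_
    filter_upwards [hq.ae (Lp.coeFn_add u w)] with y hy
    rw [hy, Pi.add_apply, Pi.add_apply, mul_add]
  · rw [RingHom.id_apply, ← MemLp.toLp_const_smul]
    refine MemLp.toLp_congr _ _ ?_
    filter_upwards [hq.ae (Lp.coeFn_smul k u)] with y hy
    rw [hy, Pi.smul_apply, Pi.smul_apply, smul_eq_mul, smul_eq_mul, mul_left_comm]
  · show ‖(hmem u).toLp _‖ ≤ _
    rw [Lp.norm_toLp, Lp.norm_def, ← ENNReal.toReal_mul]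
    exact ENNReal.toReal_mono (ENNReal.mul_lt_top (ENNReal.rpow_lt_top_of_nonneg (by simp) hc)
        (Lp.eLpNorm_lt_top u)).ne (hbd u)
  · exact (hmem u).coeFn_toLp

/-- This makes the periodic extension independent, almost everywhere, of the representative of a
class in `L₂(Ω)`. -/
theorem wrap_quasiMeasurePreserving :
    Measure.QuasiMeasurePreserving (wrap : E d → E d) volume (cellMeasure d) := by
  refine ⟨measurable_wrap, Measure.AbsolutelyContinuous.mk fun S hS h0 => ?_⟩
  rw [Measure.map_apply measurable_wrap hS, ← lintegral_indicator_one (measurable_wrap hS),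
    lintegral_eq_cell_tsum, ENNReal.tsum_eq_zero]
  intro n
  rw [lintegral_eq_zero_iff' (by
    refine Measurable.aemeasurable ?_
    exact (measurable_one.indicator (measurable_wrap hS)).comp (measurable_id.add_const _))]
  have h1 : ∀ᵐ x ∂(cellMeasure d), x ∉ S := measure_eq_zero_iff_ae_notMem.1 h0
  filter_upwards [h1, ae_restrict_mem measurableSet_cell] with x hx hc
  simp [Set.indicator, wrap_eq_self hc, hx]

theorem map_wrap_restrict_ball_le (R : ℝ) :
    ∃ c : ENNReal, c ≠ ⊤ ∧
      ((volume : Measure (E d)).restrict (Metric.closedBall 0 R)).map wrap ≤ c • cellMeasure d := by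
  -- If `x` lies in the cell and `|xⱼ + nⱼ| ≤ R`, then `|nⱼ| ≤ R + 1`. Thus only finitely many
  -- lattice cells meet the ball.
  set N : ℤ := ⌈R⌉ + 1
  set T : Finset (Fin d → ℤ) := Fintype.piFinset fun _ => Finset.Icc (-N) N
  refine ⟨T.card, by simp, Measure.le_iff.2 fun S hS => ?_⟩
  rw [Measure.map_apply measurable_wrap hS, Measure.restrict_apply (measurable_wrap hS),
    ← lintegral_indicator_one ((measurable_wrap hS).inter Metric.isClosed_closedBall.measurableSet),
    lintegral_eq_cell_tsum, Measure.smul_apply, smul_eq_mul]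
  have hz : ∀ n ∉ T, ∫⁻ x in cell d, ((wrap ⁻¹' S ∩ Metric.closedBall 0 R).indicator
      (1 : E d → ENNReal)) (x + lat n) = 0 := by
    intro n hn
    rw [setLIntegral_congr_fun (g := fun _ => 0) measurableSet_cell, lintegral_zero]
    intro x hx
    refine Set.indicator_of_notMem (fun hmem => hn ?_) _
    rw [Fintype.mem_piFinset]
    intro j
    have h1 : ‖x + lat n‖ ≤ R := by simpa using hmem.2
    have h2 : |x j + n j| ≤ R := by
      have := PiLp.norm_apply_le (x + lat n) j
      simpa using this.trans h1
    have h3 := hx j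
    have h4 := abs_le.1 h2
    have h5 := Int.le_ceil R
    rw [Finset.mem_Icc]
    have hN : (N : ℝ) = ⌈R⌉ + 1 := by simp [N]
    constructor
    · have : (-N : ℝ) ≤ n j := by linarith [h3.1, h3.2]
      exact_mod_cast this
    · have : (n j : ℝ) ≤ N := by linarith [h3.1, h3.2]
      exact_mod_cast this
  rw [tsum_eq_sum hz]
  refine (Finset.sum_le_card_nsmul T _ (cellMeasure d S) fun n _ => ?_).trans (by simp)
  rw [← lintegral_indicator_one hS]
  refine setLIntegral_mono' measurableSet_cell fun x hx => ?_
  by_cases hxS : x ∈ S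
  · simp only [Set.indicator_of_mem hxS]
    exact Set.indicator_le_self' (by simp) _
  · rw [Set.indicator_of_notMem]
    · simp
    · rintro ⟨h, -⟩
      rw [Set.mem_preimage, wrap_add_lat, wrap_eq_self hx] at h
      exact hxS h

/-- Integration of periodic extensions against a test function is a bounded functional. -/
theorem exists_testFunctional {φ : E d → ℂ} (hφ : Continuous φ) (hs : HasCompactSupport φ) :
    ∃ L : L2 d →L[ℂ] ℂ, ∀ u, L u = ∫ x, perExt u x * φ x := by
  obtain ⟨R, hR⟩ := hs.isCompact.isBounded.subset_closedBall (0 : E d)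
  obtain ⟨c, hc, hle⟩ := map_wrap_restrict_ball_le (d := d) R
  obtain ⟨T, hT⟩ := exists_pullback measurable_wrap hc hle
    (m := fun _ => 1) aestronglyMeasurable_const (by simp)
  have hmem : MemLp (fun x => (starRingEnd ℂ) (φ x)) 2
      ((volume : Measure (E d)).restrict (Metric.closedBall 0 R)) :=
    ((by fun_prop : Continuous fun x => (starRingEnd ℂ) (φ x)).memLp_of_hasCompactSupport
      (hs.comp_left (g := (starRingEnd ℂ)) (by simp))).restrict _
  refine ⟨(innerSL ℂ (hmem.toLp _)).comp T, fun u => ?_⟩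
  rw [ContinuousLinearMap.comp_apply, innerSL_apply_apply, L2.inner_def]
  rw [← setIntegral_eq_integral_of_forall_compl_eq_zero (s := Metric.closedBall (0 : E d) R)
    (f := fun x => perExt u x * φ x)]
  · refine integral_congr_ae ?_
    filter_upwards [hT u, hmem.coeFn_toLp] with x h1 h2
    rw [h1, h2]
    simp [perExt_eq]
  · intro x hx
    rw [image_eq_zero_of_notMem_tsupport fun h => hx (hR h), mul_zero]

theorem perExt_expoLp (n : Fin d → ℤ) : perExt (expoLp n) =ᵐ[volume] expo n := by
  filter_upwards [wrap_quasiMeasurePreserving.ae (coeFn_expoLp n)] with x hx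
  rw [perExt_eq, hx, expo_wrap]

theorem integral_perExt_expoLp (n : Fin d → ℤ) (φ : E d → ℂ) :
    ∫ x, perExt (expoLp n) x * φ x = ∫ x, expo n x * φ x := by
  refine integral_congr_ae ?_
  filter_upwards [perExt_expoLp n] with x hx
  rw [hx]

/-- The `L₂` pairing of a periodic extension with a test function through Fourier coefficients. -/
theorem hasSum_integral_perExt {φ : E d → ℂ} (hφ : Continuous φ) (hs : HasCompactSupport φ)
    (u : L2 d) :
    HasSum (fun n => coef u n * ∫ x, expo n x * φ x) (∫ x, perExt u x * φ x) := by
  -- The Fourier series converges in `L₂(Ω)`, so continuity of the pairing allows termwise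
  -- integration.
  obtain ⟨L, hL⟩ := exists_testFunctional hφ hs
  have := (hasSum_coef u).mapL L
  simp only [ContinuousLinearMap.map_smul, hL u] at this
  simpa only [hL, integral_perExt_expoLp, smul_eq_mul] using this

/-- The linear phase of `expo n`. -/
noncomputable def expoPhase (n : Fin d → ℤ) : E d →L[ℝ] ℂ :=
  ∑ j, (2 * Real.pi * Complex.I * n j) •
    Complex.ofRealCLM.comp (EuclideanSpace.proj j : E d →L[ℝ] ℝ)

theorem expoPhase_apply (n : Fin d → ℤ) (x : E d) :
    expoPhase n x = ∑ j, (2 * Real.pi * Complex.I * n j) * (x j : ℂ) := by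
  simp [expoPhase, sum_apply]

theorem expo_eq_exp_phase (n : Fin d → ℤ) : expo n = fun x => Complex.exp (expoPhase n x) := by
  funext x
  rw [expo, expoPhase_apply]
  push_cast
  rw [Finset.mul_sum, Finset.sum_mul]
  congr 1
  exact Finset.sum_congr rfl fun j _ => by ring

theorem fderiv_expo_single (n : Fin d → ℤ) (j : Fin d) (x : E d) :
    fderiv ℝ (expo n) x (EuclideanSpace.single j 1) = 2 * Real.pi * Complex.I * n j * expo n x := by
  have h : HasFDerivAt (expo n) (Complex.exp (expoPhase n x) • expoPhase n) x := by
    rw [expo_eq_exp_phase]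
    exact (expoPhase n).hasFDerivAt.cexp
  rw [h.fderiv, expo_eq_exp_phase]
  show Complex.exp (expoPhase n x) * expoPhase n _ = _
  rw [expoPhase_apply n (EuclideanSpace.single j 1), Finset.sum_eq_single j]
  · simp
    ring
  · intro i _ hi
    simp [hi]
  · simp

theorem contDiff_expo (n : Fin d → ℤ) : ContDiff ℝ ∞ (expo n) := by
  rw [expo_eq_exp_phase]
  exact (expoPhase n).contDiff.cexp

theorem integral_expo_mul_fderiv {φ : E d → ℂ} (hφ : ContDiff ℝ ∞ φ) (hs : HasCompactSupport φ)
    (n : Fin d → ℤ) (j : Fin d) :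
    ∫ x, expo n x * fderiv ℝ φ x (EuclideanSpace.single j 1) =
      -(2 * Real.pi * Complex.I * n j * ∫ x, expo n x * φ x) := by
  have hc : Continuous fun x => fderiv ℝ φ x (EuclideanSpace.single j 1) :=
    (hφ.continuous_fderiv (by simp)).clm_apply continuous_const
  have hsd : HasCompactSupport fun x => fderiv ℝ φ x (EuclideanSpace.single j 1) :=
    hs.fderiv_apply ℝ _
  have hfd : ∀ x, fderiv ℝ (expo n) x (EuclideanSpace.single j 1) * φ x =
      2 * Real.pi * Complex.I * n j * (expo n x * φ x) := fun x => by
    rw [fderiv_expo_single]; ring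
  have hi : Integrable fun x => expo n x * φ x :=
    ((continuous_expo n).mul hφ.continuous).integrable_of_hasCompactSupport hs.mul_left
  rw [integral_mul_fderiv_eq_neg_fderiv_mul_of_integrable]
  · simp only [hfd, integral_const_mul]
  · simp only [hfd]
    exact hi.const_mul _
  · exact ((continuous_expo n).mul hc).integrable_of_hasCompactSupport hsd.mul_left
  · exact hi
  · intro x _
    exact ((contDiff_expo n).differentiable (by simp)) x
  · intro x _
    exact (hφ.differentiable (by simp)) x

/-- A smooth compactly supported function on the line whose integer translates sum to one. -/
noncomputable def cutoffLine (t : ℝ) : ℝ := Real.smoothTransition (t + 1) - Real.smoothTransition t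

theorem contDiff_cutoffLine : ContDiff ℝ ∞ cutoffLine := by
  unfold cutoffLine
  exact (Real.smoothTransition.contDiff.comp (contDiff_id.add contDiff_const)).sub
    Real.smoothTransition.contDiff

theorem cutoffLine_eq_zero {t : ℝ} (ht : 1 ≤ |t|) : cutoffLine t = 0 := by
  rcases le_abs.1 ht with h | h
  · rw [cutoffLine, Real.smoothTransition.one_of_one_le (by linarith),
      Real.smoothTransition.one_of_one_le h, sub_self]
  · rw [cutoffLine, Real.smoothTransition.zero_of_nonpos (by linarith),
      Real.smoothTransition.zero_of_nonpos (by linarith), sub_self]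

/-- The cutoff is a rising ramp on `[-1,0]` and one minus the same ramp on `[0,1]`. Shifting the
first interval by a period makes the ramps cancel, leaving the integral of the exponential over one
period. -/
theorem integral_cutoffLine_mul_exp (m : ℤ) :
    ∫ t : ℝ, (cutoffLine t : ℂ) * Complex.exp ((2 * Real.pi * (m * t) : ℝ) * Complex.I) =
      if m = 0 then 1 else 0 := by
  set e : ℝ → ℂ := fun t => Complex.exp ((2 * Real.pi * (m * t) : ℝ) * Complex.I) with he
  have hec : Continuous e := by fun_prop
  have hsc : Continuous fun t => (Real.smoothTransition t : ℂ) :=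
    Complex.continuous_ofReal.comp Real.smoothTransition.continuous
  have hsupp : Function.support (fun t : ℝ => (cutoffLine t : ℂ) * e t) ⊆ Set.Ioc (-1) 1 := by
    intro t ht
    by_contra hcon
    refine ht ?_
    have : 1 ≤ |t| := by
      rw [Set.mem_Ioc, not_and_or, not_lt, not_le] at hcon
      rcases hcon with h | h
      · exact le_abs.2 (Or.inr (by linarith))
      · exact le_abs.2 (Or.inl h.le)
    simp [cutoffLine_eq_zero this]
  have hper : ∀ t, e (t + 1) = e t := by
    intro t
    simp only [he]
    rw [Complex.exp_eq_exp_iff_exists_int]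
    exact ⟨m, by push_cast; ring⟩
  have hcc : Continuous fun t : ℝ => (cutoffLine t : ℂ) * e t :=
    (Complex.continuous_ofReal.comp contDiff_cutoffLine.continuous).mul hec
  rw [← intervalIntegral.integral_eq_integral_of_support_subset hsupp,
    ← intervalIntegral.integral_add_adjacent_intervals (hcc.intervalIntegrable (-1) 0)
      (hcc.intervalIntegrable 0 1)]
  have h1 : ∫ t in (-1 : ℝ)..0, (cutoffLine t : ℂ) * e t =
      ∫ t in (0 : ℝ)..1, (Real.smoothTransition t : ℂ) * e t := by
    have := intervalIntegral.integral_comp_add_right (a := -1) (b := 0)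
      (fun t => (Real.smoothTransition t : ℂ) * e t) 1
    norm_num at this
    rw [← this]
    refine intervalIntegral.integral_congr fun t ht => ?_
    rw [Set.uIcc_of_le (by norm_num)] at ht
    simp only [hper]
    rw [cutoffLine, Real.smoothTransition.zero_of_nonpos ht.2, sub_zero]
  have h2 : ∫ t in (0 : ℝ)..1, (cutoffLine t : ℂ) * e t =
      ∫ t in (0 : ℝ)..1, (e t - (Real.smoothTransition t : ℂ) * e t) := by
    refine intervalIntegral.integral_congr fun t ht => ?_
    rw [Set.uIcc_of_le (by norm_num)] at ht
    rw [cutoffLine, Real.smoothTransition.one_of_one_le (by linarith [ht.1])]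
    push_cast
    ring
  have hse : Continuous fun t => (Real.smoothTransition t : ℂ) * e t := hsc.mul hec
  rw [h1, h2, intervalIntegral.integral_sub (hec.intervalIntegrable 0 1)
    (hse.intervalIntegrable 0 1), add_sub_cancel]
  by_cases h : m = 0
  · simp [he, h]
  · have hc : (2 * Real.pi * m * Complex.I : ℂ) ≠ 0 := by
      simp [h, Real.pi_ne_zero]
    have : e = fun t : ℝ => Complex.exp ((2 * Real.pi * m * Complex.I) * t) := by
      funext t
      simp only [he]
      push_cast
      ring_nf
    rw [this, integral_exp_mul_complex hc, if_neg h]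
    have : Complex.exp (2 * Real.pi * m * Complex.I * (1 : ℝ)) = 1 := by
      rw [Complex.exp_eq_one_iff]
      exact ⟨m, by push_cast; ring⟩
    rw [this]
    simp

/-- A smooth compactly supported function whose lattice translates sum to one. -/
noncomputable def cutoff (x : E d) : ℂ := ∏ j, (cutoffLine (x j) : ℂ)

theorem contDiff_cutoff : ContDiff ℝ ∞ (cutoff : E d → ℂ) := by
  unfold cutoff
  refine contDiff_prod fun j _ => ?_
  exact Complex.ofRealCLM.contDiff.comp (contDiff_cutoffLine.comp (by fun_prop))

theorem hasCompactSupport_cutoff : HasCompactSupport (cutoff : E d → ℂ) := by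
  refine HasCompactSupport.intro (K := WithLp.toLp 2 '' (Set.univ.pi fun _ => Set.Icc (-1) 1))
    ((isCompact_univ_pi fun _ => isCompact_Icc).image (PiLp.continuous_toLp 2 _)) fun x hx => ?_
  have : ∃ j, x j ∉ Set.Icc (-1 : ℝ) 1 := by
    by_contra hcon
    push Not at hcon
    exact hx ⟨fun j => x j, fun j _ => hcon j, rfl⟩
  obtain ⟨j, hj⟩ := this
  refine Finset.prod_eq_zero (Finset.mem_univ j) ?_
  rw [cutoffLine_eq_zero, Complex.ofReal_zero]
  by_contra hlt
  exact hj (Set.mem_Icc.2 (abs_le.1 (not_le.1 hlt).le))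

theorem integral_expo_mul_cutoff (m : Fin d → ℤ) :
    ∫ x, expo m x * cutoff x = if m = 0 then 1 else 0 := by
  have h : ∀ x : E d, expo m x * cutoff x = ∏ j, ((cutoffLine (x j) : ℂ) *
      Complex.exp ((2 * Real.pi * (m j * x j) : ℝ) * Complex.I)) := by
    intro x
    rw [Finset.prod_mul_distrib, ← Complex.exp_sum, mul_comm, cutoff, expo]
    congr 2
    rw [← Finset.sum_mul, ← Complex.ofReal_sum, Finset.mul_sum]
  simp only [h]
  have h2 := (EuclideanSpace.volume_preserving_symm_measurableEquiv_toLp (Fin d)).integral_comp'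
    (fun y : Fin d → ℝ => ∏ j, ((cutoffLine (y j) : ℂ) *
      Complex.exp ((2 * Real.pi * (m j * y j) : ℝ) * Complex.I)))
  refine h2.trans ?_
  rw [integral_fintype_prod_volume_eq_prod (fun (j : Fin d) (t : ℝ) => ((cutoffLine t : ℂ) *
      Complex.exp ((2 * Real.pi * (m j * t) : ℝ) * Complex.I)))]
  simp only [integral_cutoffLine_mul_exp]
  split_ifs with h0
  · simp [h0]
  · obtain ⟨j, hj⟩ := Function.ne_iff.1 h0
    exact Finset.prod_eq_zero (Finset.mem_univ j) (if_neg hj)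

/-- Periodic weak derivatives are characterized by Fourier coefficients. -/
theorem hasWeakDeriv_iff (j : Fin d) (u g : L2 d) :
    HasWeakDeriv j u g ↔ ∀ n, coef g n = 2 * Real.pi * Complex.I * n j * coef u n := by
  have hpair : ∀ φ : E d → ℂ, ContDiff ℝ ∞ φ → HasCompactSupport φ →
      HasSum (fun n => (2 * Real.pi * Complex.I * n j * coef u n) * ∫ x, expo n x * φ x)
        (-∫ x, perExt u x * fderiv ℝ φ x (EuclideanSpace.single j 1)) := by
    intro φ hφ hs
    have hc : Continuous fun x => fderiv ℝ φ x (EuclideanSpace.single j 1) :=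
      (hφ.continuous_fderiv (by simp)).clm_apply continuous_const
    have := (hasSum_integral_perExt hc (hs.fderiv_apply ℝ _) u).neg
    simp only [integral_expo_mul_fderiv hφ hs] at this
    have he : ∀ n, -(coef u n * -(2 * Real.pi * Complex.I * n j * ∫ x, expo n x * φ x)) =
        (2 * Real.pi * Complex.I * n j * coef u n) * ∫ x, expo n x * φ x := fun n => by ring
    simpa only [he] using this
  constructor
  · intro h n
    -- Since the lattice translates of the cutoff sum to one, pairing with this test function
    -- unfolds to the integral over the cell and picks out the `n`-th coefficient.
    set φ : E d → ℂ := fun x => expo (-n) x * cutoff x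
    have hφ : ContDiff ℝ ∞ φ := (contDiff_expo _).mul contDiff_cutoff
    have hs : HasCompactSupport φ := hasCompactSupport_cutoff.mul_left
    have hint : ∀ m, ∫ x, expo m x * φ x = if m = n then 1 else 0 := by
      intro m
      have : ∀ x, expo m x * φ x = expo (m + -n) x * cutoff x := fun x => by
        rw [expo_add_index]; simp only [φ]; ring
      simp only [this, integral_expo_mul_cutoff, add_neg_eq_zero]
    have h1 := hpair φ hφ hs
    have h2 := hasSum_integral_perExt hφ.continuous hs g
    rw [h φ hφ hs, neg_neg] at h1
    simp only [hint, mul_ite, mul_one, mul_zero] at h1 h2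
    have hsingle : ∀ c : (Fin d → ℤ) → ℂ, HasSum (fun m => if m = n then c m else 0) (c n) :=
      fun c => by
        have := hasSum_single (f := fun m => if m = n then c m else 0) n fun m hm => if_neg hm
        rwa [if_pos rfl] at this
    exact ((hsingle _).unique h2).trans (h1.unique (hsingle _))
  · intro h φ hφ hs
    have h1 := hpair φ hφ hs
    have h2 := hasSum_integral_perExt hφ.continuous hs g
    simp only [h] at h2
    rw [h2.unique h1, neg_neg]

end NonlocalHom

/-! ### Fourier multipliers and the effective resolvent -/

namespace NonlocalHom

variable {d : ℕ}

/-- The shifted dual lattice point `ξ + 2πn`. -/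
noncomputable def freq (ξ : E d) (n : Fin d → ℤ) : E d := ξ + (2 * Real.pi) • lat n

theorem freq_apply (ξ : E d) (n : Fin d → ℤ) (j : Fin d) :
    freq ξ n j = ξ j + 2 * Real.pi * n j := by simp [freq]

@[simp] theorem freq_zero (ξ : E d) : freq ξ 0 = ξ := by
  ext j; simp [freq_apply]

/-- A single coordinate with `n j ≠ 0` suffices: `|ξⱼ| ≤ π`, whereas `|2πnⱼ| ≥ 2π`. This separates
the nonzero modes from the bottom of the spectrum. -/
theorem pi_le_norm_freq {ξ : E d} (hξ : ξ ∈ dualCell d) {n : Fin d → ℤ} (hn : n ≠ 0) :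
    Real.pi ≤ ‖freq ξ n‖ := by
  obtain ⟨j, hj⟩ := Function.ne_iff.1 hn
  refine le_trans ?_ (PiLp.norm_apply_le (freq ξ n) j)
  rw [freq_apply, Real.norm_eq_abs]
  have h := hξ j
  have hπ := Real.pi_pos
  rcases lt_or_gt_of_ne hj with h0 | h0
  · have h1 : n j ≤ -1 := by simpa using Int.le_sub_one_of_lt h0
    have h2 : (n j : ℝ) ≤ -1 := by exact_mod_cast h1
    rw [abs_of_nonpos] <;> nlinarith [h.1, h.2]
  · have h1 : 1 ≤ n j := h0
    have h2 : (1 : ℝ) ≤ n j := by exact_mod_cast h1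
    rw [abs_of_nonneg] <;> nlinarith [h.1, h.2]

theorem norm_sq_le_of_mem_dualCell {ξ : E d} (hξ : ξ ∈ dualCell d) :
    ‖ξ‖ ^ 2 ≤ d * Real.pi ^ 2 := by
  rw [EuclideanSpace.norm_sq_eq]
  calc ∑ j, ‖ξ j‖ ^ 2 ≤ ∑ _j : Fin d, Real.pi ^ 2 := by
        refine Finset.sum_le_sum fun j _ => ?_
        rw [Real.norm_eq_abs, sq_abs]
        have := hξ j
        nlinarith [this.1, this.2]
    _ = _ := by simp

/-- All statements about `𝔸⁰(ξ)` and its domain thereby become statements about multiplication by `ξ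
+ 2πn`. -/
theorem shiftedD_iff (ξ : E d) (j : Fin d) (u w : L2 d) :
    ShiftedD ξ j u w ↔ ∀ n, coef w n = (freq ξ n j : ℂ) * coef u n := by
  constructor
  · rintro ⟨g, hg, rfl⟩ n
    rw [coef_add, coef_smul, coef_smul, (hasWeakDeriv_iff j u g).1 hg, freq_apply]
    push_cast
    linear_combination (-2 * Real.pi * n j * coef u n) * Complex.I_mul_I
  · intro h
    refine ⟨Complex.I • (w - (ξ j : ℂ) • u), (hasWeakDeriv_iff j u _).2 fun n => ?_, ?_⟩
    · rw [coef_smul, coef_sub, coef_smul, h, freq_apply]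
      push_cast
      ring
    · rw [smul_smul]
      simp

/-- Bounded Fourier multipliers. -/
theorem exists_multiplier {b : (Fin d → ℤ) → ℂ} {B : ℝ} (hb : ∀ n, ‖b n‖ ≤ B) :
    ∃ T : L2 d →L[ℂ] L2 d, ∀ u n, coef (T u) n = b n * coef u n := by
  have hB : 0 ≤ B := (norm_nonneg _).trans (hb 0)
  have hmem : ∀ u : L2 d, ∃ w : L2 d, (∀ n, coef w n = b n * coef u n) ∧ ‖w‖ ≤ B * ‖u‖ := by
    intro u
    have hs : Summable fun n => ‖b n * coef u n‖ ^ 2 := by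
      refine Summable.of_nonneg_of_le (fun n => by positivity) (fun n => ?_)
        ((hasSum_norm_sq_coef u).summable.mul_left (B ^ 2))
      rw [norm_mul, mul_pow]
      have := hb n
      gcongr
    have hl : Memℓp (fun n => b n * coef u n) 2 := by
      refine memℓp_gen ?_
      simpa using hs
    set w := (fourierBasis d).repr.symm ⟨_, hl⟩
    have hw : ∀ n, coef w n = b n * coef u n := by
      intro n
      have := (fourierBasis d).repr_apply_apply w n
      rw [fourierBasis_apply] at this
      rw [coef, ← this]
      simp [w]
    refine ⟨w, hw, ?_⟩
    refine le_of_sq_le_sq ?_ (by positivity)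
    rw [mul_pow]
    refine hasSum_le (fun n => ?_) (hasSum_norm_sq_coef w)
      ((hasSum_norm_sq_coef u).mul_left (B ^ 2))
    rw [hw, norm_mul, mul_pow]
    have := hb n
    gcongr
  choose T hT hTn using hmem
  refine ⟨LinearMap.mkContinuous
    { toFun := T
      map_add' := fun u w => coef_ext fun n => ?_
      map_smul' := fun k u => coef_ext fun n => ?_ } B hTn, hT⟩
  · rw [coef_add, hT, hT, hT, coef_add, mul_add]
  · rw [RingHom.id_apply, coef_smul, hT, hT, coef_smul, mul_left_comm]

theorem norm_le_of_norm_coef_le {u w : L2 d} {B : ℝ} (hB : 0 ≤ B)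
    (h : ∀ n, ‖coef w n‖ ≤ B * ‖coef u n‖) : ‖w‖ ≤ B * ‖u‖ := by
  refine le_of_sq_le_sq ?_ (by positivity)
  rw [mul_pow]
  refine hasSum_le (fun n => ?_) (hasSum_norm_sq_coef w)
    ((hasSum_norm_sq_coef u).mul_left (B ^ 2))
  rw [← mul_pow]
  exact pow_le_pow_left₀ (norm_nonneg _) (h n) 2

/-- The quadratic form of a matrix. -/
def quadForm (g : Matrix (Fin d) (Fin d) ℝ) (η : E d) : ℝ := ∑ k, ∑ l, g k l * η k * η l

/-- The symbol of the resolvent of the effective operator. -/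
noncomputable def resSymbol (g : Matrix (Fin d) (Fin d) ℝ) (ε : ℝ) (η : E d) : ℝ :=
  (quadForm g η + ε ^ 2)⁻¹

section effective

variable {g : Matrix (Fin d) (Fin d) ℝ} {c : ℝ} (hc : 0 < c) (hg : ∀ η, c * ‖η‖ ^ 2 ≤ quadForm g η)
  {ε : ℝ} (hε : 0 < ε)

include hc hg hε

theorem resSymbol_den_pos (η : E d) : 0 < quadForm g η + ε ^ 2 := by
  exact add_pos_of_nonneg_of_pos ((by positivity : 0 ≤ c * ‖η‖ ^ 2).trans (hg η)) (by positivity)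

theorem resSymbol_nonneg (η : E d) : 0 ≤ resSymbol g ε η :=
  inv_nonneg.2 (resSymbol_den_pos hc hg hε η).le

theorem norm_resSymbol_le (η : E d) : ‖(resSymbol g ε η : ℂ)‖ ≤ (ε ^ 2)⁻¹ := by
  rw [Complex.norm_real, Real.norm_of_nonneg (resSymbol_nonneg hc hg hε η)]
  have := hg η
  exact inv_anti₀ (by positivity) (by linarith [show 0 ≤ c * ‖η‖ ^ 2 by positivity])

/-- The bound is uniform in `ε`. It absorbs the term of second order in `ξ` that the corrector
leaves over. -/
theorem norm_sq_mul_resSymbol_le (η : E d) : ‖η‖ ^ 2 * resSymbol g ε η ≤ c⁻¹ := by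
  rw [resSymbol, ← div_eq_mul_inv, div_le_iff₀ (resSymbol_den_pos hc hg hε η), ← div_eq_inv_mul,
    le_div_iff₀ hc]
  nlinarith [hg η]

theorem norm_freq_mul_freq_mul_resSymbol_le (η : E d) (k l : Fin d) :
    ‖(η k : ℂ) * (η l : ℂ) * (resSymbol g ε η : ℂ)‖ ≤ c⁻¹ := by
  refine le_trans ?_ (norm_sq_mul_resSymbol_le hc hg hε η)
  rw [norm_mul, norm_mul, Complex.norm_real, Complex.norm_real, Complex.norm_real,
    Real.norm_of_nonneg (resSymbol_nonneg hc hg hε η), sq]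
  have h1 := PiLp.norm_apply_le η k
  have h2 := PiLp.norm_apply_le η l
  have := resSymbol_nonneg hc hg hε η
  gcongr

/-- This crude bound, which degenerates as `ε → 0`, serves only to construct the first order
operators. The estimates use a sharper bound on the nonzero modes. -/
theorem norm_freq_mul_resSymbol_le (η : E d) (k : Fin d) :
    ‖(η k : ℂ) * (resSymbol g ε η : ℂ)‖ ≤ c⁻¹ + (ε ^ 2)⁻¹ := by
  have h1 := norm_sq_mul_resSymbol_le hc hg hε η
  have h2 := norm_resSymbol_le hc hg hε η
  have h0 := resSymbol_nonneg hc hg hε η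
  rw [norm_mul, Complex.norm_real] at *
  rw [Complex.norm_real, Real.norm_of_nonneg h0] at *
  have h3 := PiLp.norm_apply_le η k
  have h4 : ‖η k‖ ≤ ‖η‖ ^ 2 + 1 := by nlinarith [sq_nonneg (‖η‖ - 1)]
  calc ‖η k‖ * resSymbol g ε η ≤ (‖η‖ ^ 2 + 1) * resSymbol g ε η := by gcongr
    _ ≤ _ := by linarith

/-- The resolvent of the effective operator and its products with derivatives. -/
theorem exists_effective_resolvent (ξ : E d) :
    ∃ (R₀ : L2 d →L[ℂ] L2 d) (T : Fin d → L2 d →L[ℂ] L2 d),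
      (∀ u n, coef (R₀ u) n = (resSymbol g ε (freq ξ n) : ℂ) * coef u n) ∧
      (∀ j u n, coef (T j u) n =
        ((freq ξ n j : ℂ) * (resSymbol g ε (freq ξ n) : ℂ)) * coef u n) ∧
      IsResolvent (EffGraph g ξ) ε R₀ ∧ (∀ j f, ShiftedD ξ j (R₀ f) (T j f)) ∧
      (∀ j h w, ShiftedD ξ j h w → T j h = R₀ w) := by
  obtain ⟨R₀, hR⟩ := exists_multiplier fun n => norm_resSymbol_le hc hg hε (freq ξ n)
  choose T hT using fun j : Fin d =>
    exists_multiplier fun n => norm_freq_mul_resSymbol_le hc hg hε (freq ξ n) j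
  choose Z hZ using fun k l : Fin d =>
    exists_multiplier fun n => norm_freq_mul_freq_mul_resSymbol_le hc hg hε (freq ξ n) k l
  have hquad : ∀ n, ∑ k, ∑ l, (g k l : ℂ) * ((freq ξ n k : ℂ) * (freq ξ n l : ℂ)) =
      (quadForm g (freq ξ n) : ℂ) := by
    intro n
    simp only [quadForm]
    push_cast
    exact Finset.sum_congr rfl fun k _ => Finset.sum_congr rfl fun l _ => by ring
  have hne : ∀ n, ((quadForm g (freq ξ n) + ε ^ 2 : ℝ) : ℂ) ≠ 0 := fun n => by
    exact_mod_cast (resSymbol_den_pos hc hg hε _).ne'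
  have hTR : ∀ j f, ShiftedD ξ j (R₀ f) (T j f) := fun j f =>
    (shiftedD_iff ξ j _ _).2 fun n => by rw [hT, hR, mul_assoc]
  -- Multipliers commute, so the same `T j` represents the derivative after the resolvent and
  -- extends the resolvent after the derivative.
  refine ⟨R₀, T, hR, hT, ?_, hTR, ?_⟩
  · intro f u
    constructor
    · rintro rfl
      refine ⟨fun l => T l f, fun k l => Z k l f, fun l => hTR l f, fun k l =>
        (shiftedD_iff ξ k _ _).2 fun n => by rw [hZ, hT]; ring, coef_ext fun n => ?_⟩
      simp only [coef_sub, coef_smul, coef_sum, hR, hZ]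
      have : ∀ k l, (g k l : ℂ) * ((freq ξ n k : ℂ) * (freq ξ n l : ℂ) *
          (resSymbol g ε (freq ξ n) : ℂ) * coef f n) = ((g k l : ℂ) * ((freq ξ n k : ℂ) *
          (freq ξ n l : ℂ))) * ((resSymbol g ε (freq ξ n) : ℂ) * coef f n) := fun k l => by ring
      simp only [this, ← Finset.sum_mul, hquad]
      rw [resSymbol]
      have h1 := hne n
      push_cast at h1 ⊢
      field_simp
      ring
    · rintro ⟨w, z, hw, hz, heq⟩
      refine coef_ext fun n => ?_
      have h1 := congrArg (fun u => coef u n) heq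
      simp only [coef_sub, coef_smul, coef_sum] at h1
      have hzn : ∀ k l, coef (z k l) n = (freq ξ n k : ℂ) * (freq ξ n l : ℂ) * coef u n := by
        intro k l
        rw [(shiftedD_iff ξ k _ _).1 (hz k l), (shiftedD_iff ξ l _ _).1 (hw l), mul_assoc]
      simp only [hzn, ← mul_assoc] at h1
      simp only [← Finset.sum_mul] at h1
      have h2 := hquad n
      simp only [← mul_assoc] at h2
      rw [h2] at h1
      rw [hR, resSymbol]
      have h3 := hne n
      push_cast at h1 h3 ⊢
      rw [inv_mul_eq_div, div_eq_iff h3]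
      linear_combination h1
  · intro j h w hw
    refine coef_ext fun n => ?_
    rw [hT, hR, (shiftedD_iff ξ j _ _).1 hw]
    ring

end effective

end NonlocalHom

/-! ### Rank one approximation of both resolvents -/

namespace NonlocalHom

variable {d : ℕ}

/-- The bound for the rank one approximation of a resolvent near the bottom of the spectrum. -/
noncomputable def thresholdBound (c κ C₁ C₂ Nψ Nθ : ℝ) : ℝ :=
  ((C₂ + Nθ) / c + (C₁ + Nψ) * ((1 + (C₁ + Nψ) / c) / κ)) / c * Nψ + (1 + (C₁ + Nψ) / c) / κ

/-- Threshold approximation of a resolvent: if `ψ = o + θ` is an approximate eigenvector of `A` for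
the small number `s`, then `(A + δ)⁻¹` equals `(s + δ)⁻¹ ⟨ψ, ·⟩ ψ` up to a bounded error. -/
theorem norm_resolvent_sub_rankOne_le {H : Type*} [NormedAddCommGroup H] [InnerProductSpace ℂ H]
    {A : H →L[ℂ] H} (hA : ∀ u w, inner ℂ (A u) w = inner ℂ u (A w))
    {o θ : H} (ho : ‖o‖ = 1) (hoθ : inner ℂ o θ = 0) {c κ C₁ C₂ Nψ Nθ lam δ s : ℝ}
    (hc : 0 < c) (hc1 : c ≤ 1) (hκ : 0 < κ) (hC₁ : 0 ≤ C₁) (hC₂ : 0 ≤ C₂) (hlam : 0 ≤ lam)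
    (hδ : 0 < δ) (hψ : ‖o + θ‖ ≤ Nψ) (hθ : ‖θ‖ ^ 2 ≤ Nθ * lam) (hNθ : 0 ≤ Nθ)
    (hcoer : ∀ u, c * lam * ‖u‖ ^ 2 ≤ (inner ℂ (A u) u : ℂ).re)
    (hgap : ∀ u, inner ℂ o u = 0 → κ * ‖u‖ ^ 2 ≤ (inner ℂ (A u) u : ℂ).re)
    (hAψ : ‖A (o + θ)‖ ≤ C₁ * lam)
    (hs : ‖inner ℂ (A (o + θ)) (o + θ) - (s : ℂ)‖ ≤ C₂ * lam ^ 2) (hsc : c * lam ≤ s)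
    {f u : H} (hu : A u + (δ : ℂ) • u = f) :
    ‖u - (((s + δ)⁻¹ : ℝ) : ℂ) • inner ℂ (o + θ) f • (o + θ)‖ ≤
      thresholdBound c κ C₁ C₂ Nψ Nθ * ‖f‖ := by
  set ψ := o + θ with hψdef
  set L := lam + δ with hL
  have hLpos : 0 < L := by positivity
  have hNψ : 0 ≤ Nψ := (norm_nonneg _).trans hψ
  set e := A ψ + (δ : ℂ) • ψ with he
  set Ce := C₁ + Nψ with hCe
  have hCe0 : 0 ≤ Ce := by positivity
  -- The vector `e = (A + δ)ψ` is small of order `L = lam + δ`, which compensates the factor `1/L`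
  -- lost in `‖u‖ ≤ ‖f‖/(cL)`.
  have henorm : ‖e‖ ≤ Ce * L := by
    calc ‖e‖ ≤ ‖A ψ‖ + ‖(δ : ℂ) • ψ‖ := norm_add_le _ _
      _ ≤ C₁ * lam + δ * Nψ := by
        rw [norm_smul, Complex.norm_real, Real.norm_of_nonneg hδ.le]
        gcongr
      _ ≤ Ce * L := by
        rw [hCe, hL]
        nlinarith [mul_nonneg hC₁ hδ.le, mul_nonneg hNψ hlam]
  have hform : ∀ w : H, (inner ℂ (A w + (δ : ℂ) • w) w : ℂ).re =
      (inner ℂ (A w) w : ℂ).re + δ * ‖w‖ ^ 2 := by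
    intro w
    rw [inner_add_left, inner_smul_left, inner_self_eq_norm_sq_to_K, Complex.add_re,
      Complex.conj_ofReal]
    norm_cast
    rw [Complex.re_ofReal_mul]
    rfl
  have hre : ∀ x y : H, (inner ℂ x y : ℂ).re ≤ ‖x‖ * ‖y‖ := fun x y =>
    (Complex.re_le_norm _).trans (norm_inner_le_norm x y)
  have hunorm : c * L * ‖u‖ ≤ ‖f‖ := by
    have h1 := hform u
    rw [hu] at h1
    have h2 := hre f u
    have h3 := hcoer u
    -- Here `c ≤ 1` is used: it gives `c(lam + δ) ≤ c·lam + δ`.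
    have h4 : c * L * ‖u‖ * ‖u‖ ≤ ‖f‖ * ‖u‖ := by
      rw [hL]
      nlinarith [mul_nonneg (mul_nonneg hδ.le (sub_nonneg.2 hc1)) (sq_nonneg ‖u‖)]
    rcases (norm_nonneg u).eq_or_lt with h0 | h0
    · rw [← h0]; simp
    · exact le_of_mul_le_mul_right h4 h0
  set c₀ : ℂ := inner ℂ o u with hc₀
  have hc₀u : ‖c₀‖ ≤ ‖u‖ := by
    have := norm_inner_le_norm (𝕜 := ℂ) o u
    rwa [ho, one_mul] at this
  have hc₀f : ‖c₀‖ * L ≤ ‖f‖ / c := by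
    rw [le_div_iff₀ hc]
    nlinarith [mul_le_mul_of_nonneg_left hc₀u (mul_pos hc hLpos).le]
  -- Subtracting the multiple of `ψ` with the same component along `o` leaves a vector orthogonal to
  -- `o`, because `θ` is orthogonal to `o`. The gap then applies to `w`, which solves `(A + δ)w = f
  -- - c₀e` with a right side bounded by a multiple of `‖f‖`.
  set w := u - c₀ • ψ with hw
  have how : inner ℂ o w = 0 := by
    rw [hw, inner_sub_right, inner_smul_right, hψdef, inner_add_right, hoθ,
      inner_self_eq_norm_sq_to_K, ho]
    simp [hc₀]
  have hAw : A w + (δ : ℂ) • w = f - c₀ • e := by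
    rw [hw, he, ← hu, map_sub, map_smul]
    module
  set Cw := (1 + Ce / c) / κ with hCw
  have hCw0 : 0 ≤ Cw := by positivity
  have hc₀e : ‖c₀‖ * ‖e‖ ≤ Ce / c * ‖f‖ := by
    calc ‖c₀‖ * ‖e‖ ≤ ‖c₀‖ * (Ce * L) := by gcongr
      _ = Ce * (‖c₀‖ * L) := by ring
      _ ≤ Ce * (‖f‖ / c) := by gcongr
      _ = _ := by ring
  have hwnorm : ‖w‖ ≤ Cw * ‖f‖ := by
    have h1 := hform w
    rw [hAw] at h1
    have h2 := hre (f - c₀ • e) w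
    have h3 := hgap w how
    have h4 : ‖f - c₀ • e‖ ≤ (1 + Ce / c) * ‖f‖ := by
      calc ‖f - c₀ • e‖ ≤ ‖f‖ + ‖c₀ • e‖ := norm_sub_le _ _
        _ ≤ ‖f‖ + Ce / c * ‖f‖ := by rw [norm_smul]; gcongr
        _ = _ := by ring
    have h5 : κ * ‖w‖ * ‖w‖ ≤ (1 + Ce / c) * ‖f‖ * ‖w‖ := by
      have := mul_le_mul_of_nonneg_right h4 (norm_nonneg w)
      nlinarith [mul_nonneg hδ.le (sq_nonneg ‖w‖)]
    have h6 : κ * ‖w‖ ≤ (1 + Ce / c) * ‖f‖ := by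
      rcases (norm_nonneg w).eq_or_lt with h0 | h0
      · rw [← h0, mul_zero]; positivity
      · exact le_of_mul_le_mul_right h5 h0
    rw [hCw, div_mul_eq_mul_div, le_div_iff₀ hκ]
    linarith
  -- By symmetry `⟨ψ,f⟩ = ⟨e,u⟩`. Here `⟨e,ψ⟩` is `s + δ` up to `O(L²)` and `⟨e,w⟩` is `O(L)‖f‖`, so
  -- division by `s + δ ≥ cL` recovers `c₀` up to a bounded multiple of `‖f‖`.
  have hψf : inner ℂ ψ f = c₀ * inner ℂ e ψ + inner ℂ e w := by
    have : inner ℂ ψ f = inner ℂ e u := by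
      rw [← hu, he, inner_add_right, inner_add_left (A ψ), hA ψ u, inner_smul_left,
        inner_smul_right, Complex.conj_ofReal]
    rw [this]
    conv_lhs => rw [show u = c₀ • ψ + w by rw [hw]; abel]
    rw [inner_add_right, inner_smul_right]
  have hψsq : ‖ψ‖ ^ 2 = 1 + ‖θ‖ ^ 2 := by
    have := norm_add_sq_eq_norm_sq_add_norm_sq_of_inner_eq_zero o θ hoθ
    rw [hψdef, sq, this, ho]
    ring
  -- The vector `ψ` is not normalized: `‖ψ‖² = 1 + ‖θ‖²`, and the excess contributes `δ‖θ‖² ≤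
  -- Nθ·δ·lam ≤ Nθ L²`.
  have heψ : ‖inner ℂ e ψ - ((s + δ : ℝ) : ℂ)‖ ≤ (C₂ + Nθ) * L ^ 2 := by
    have h1 : inner ℂ e ψ - ((s + δ : ℝ) : ℂ) =
        (inner ℂ (A ψ) ψ - (s : ℂ)) + ((δ * ‖θ‖ ^ 2 : ℝ) : ℂ) := by
      rw [he, inner_add_left, inner_smul_left, inner_self_eq_norm_sq_to_K, Complex.conj_ofReal]
      have : ((‖ψ‖ : ℝ) : ℂ) ^ 2 = ((1 + ‖θ‖ ^ 2 : ℝ) : ℂ) := by rw [← hψsq]; push_cast; ring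
      simp only [Complex.coe_algebraMap]
      rw [this]
      push_cast
      ring
    rw [h1]
    refine (norm_add_le _ _).trans ?_
    rw [Complex.norm_real, Real.norm_of_nonneg (by positivity)]
    have h2 : δ * ‖θ‖ ^ 2 ≤ δ * (Nθ * lam) := by gcongr
    have h3 : C₂ * lam ^ 2 ≤ C₂ * L ^ 2 := by
      have : lam ≤ L := by rw [hL]; linarith
      gcongr
    have h4 : δ * (Nθ * lam) ≤ Nθ * L ^ 2 := by
      rw [hL]
      have h5 : (lam + δ) ^ 2 = δ * lam + (lam ^ 2 + δ ^ 2 + lam * δ) := by ring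
      have h6 : δ * lam ≤ (lam + δ) ^ 2 := by
        rw [h5]
        exact le_add_of_nonneg_right (by positivity)
      calc δ * (Nθ * lam) = Nθ * (δ * lam) := by ring
        _ ≤ _ := by gcongr
    calc _ ≤ C₂ * L ^ 2 + Nθ * L ^ 2 := add_le_add (hs.trans h3) (h2.trans h4)
      _ = _ := by ring
  have hsδ : c * L ≤ s + δ := by
    rw [hL, mul_add]
    exact add_le_add hsc (mul_le_of_le_one_left hδ.le hc1)
  have hsδ0 : 0 < s + δ := lt_of_lt_of_le (by positivity) hsδ
  set D := c₀ - (((s + δ)⁻¹ : ℝ) : ℂ) * inner ℂ ψ f with hD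
  have hDmul : ((s + δ : ℝ) : ℂ) * D =
      -(c₀ * (inner ℂ e ψ - ((s + δ : ℝ) : ℂ))) - inner ℂ e w := by
    have h1 : ((s + δ : ℝ) : ℂ) * (((s + δ)⁻¹ : ℝ) : ℂ) = 1 := by
      rw [← Complex.ofReal_mul, mul_inv_cancel₀ hsδ0.ne', Complex.ofReal_one]
    rw [hD, mul_sub, ← mul_assoc, h1, hψf]
    ring
  set C3 := ((C₂ + Nθ) / c + Ce * Cw) with hC3
  have hDnorm : ‖D‖ ≤ C3 / c * ‖f‖ := by
    have h1 : (s + δ) * ‖D‖ ≤ L * (C3 * ‖f‖) := by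
      have : (s + δ) * ‖D‖ = ‖((s + δ : ℝ) : ℂ) * D‖ := by
        rw [norm_mul, Complex.norm_real, Real.norm_of_nonneg hsδ0.le]
      rw [this, hDmul]
      calc _ ≤ ‖c₀‖ * ((C₂ + Nθ) * L ^ 2) + ‖e‖ * ‖w‖ := by
            refine (norm_sub_le _ _).trans (add_le_add ?_ (norm_inner_le_norm _ _))
            rw [norm_neg, norm_mul]
            gcongr
        _ ≤ (C₂ + Nθ) * L * (‖f‖ / c) + Ce * L * (Cw * ‖f‖) := by
            refine add_le_add ?_ (by gcongr)
            calc ‖c₀‖ * ((C₂ + Nθ) * L ^ 2) = (C₂ + Nθ) * L * (‖c₀‖ * L) := by ring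
              _ ≤ _ := by gcongr
        _ = _ := by rw [hC3]; ring
    have h2 : c * L * ‖D‖ ≤ L * (C3 * ‖f‖) :=
      (mul_le_mul_of_nonneg_right hsδ (norm_nonneg _)).trans h1
    rw [div_mul_eq_mul_div, le_div_iff₀ hc]
    refine le_of_mul_le_mul_left ?_ hLpos
    calc L * (‖D‖ * c) = c * L * ‖D‖ := by ring
      _ ≤ _ := h2
  have hfin : u - (((s + δ)⁻¹ : ℝ) : ℂ) • inner ℂ ψ f • ψ = D • ψ + w := by
    rw [hD, hw]
    module
  rw [hfin]
  calc ‖D • ψ + w‖ ≤ ‖D‖ * ‖ψ‖ + ‖w‖ := by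
        refine (norm_add_le _ _).trans ?_
        rw [norm_smul]
    _ ≤ C3 / c * ‖f‖ * Nψ + Cw * ‖f‖ := by gcongr
    _ = _ := by
      rw [thresholdBound]
      ring

theorem coef_zero_eq (u : L2 d) : coef u 0 = inner ℂ (expoLp 0) u := rfl

theorem norm_expoLp (n : Fin d → ℤ) : ‖(expoLp n : L2 d)‖ = 1 := orthonormal_expoLp.1 n

section effective

variable {g : Matrix (Fin d) (Fin d) ℝ} {c : ℝ} (hc : 0 < c) (hg : ∀ η, c * ‖η‖ ^ 2 ≤ quadForm g η)
  {ε : ℝ} (hε : 0 < ε) {ξ : E d} (hξ : ξ ∈ dualCell d)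

include hc hg hξ

/-- Away from the zero mode the frequency is at least `π`, so no power of `ε` is lost. -/
theorem resSymbol_freq_le {n : Fin d → ℤ} (hn : n ≠ 0) :
    resSymbol g ε (freq ξ n) ≤ (c * Real.pi ^ 2)⁻¹ := by
  have h := pi_le_norm_freq hξ hn
  refine inv_anti₀ (by positivity) ?_
  have h1 : Real.pi ^ 2 ≤ ‖freq ξ n‖ ^ 2 := by gcongr
  nlinarith [hg (freq ξ n), sq_nonneg ε, mul_le_mul_of_nonneg_left h1 hc.le]

include hε

theorem norm_freq_mul_resSymbol_freq_le {n : Fin d → ℤ} (hn : n ≠ 0) (j : Fin d) :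
    ‖(freq ξ n j : ℂ) * (resSymbol g ε (freq ξ n) : ℂ)‖ ≤ (c * Real.pi)⁻¹ := by
  have h := pi_le_norm_freq hξ hn
  have h0 := resSymbol_nonneg hc hg hε (freq ξ n)
  rw [norm_mul, Complex.norm_real, Complex.norm_real, Real.norm_of_nonneg h0]
  have h1 := norm_sq_mul_resSymbol_le hc hg hε (freq ξ n)
  have h2 := PiLp.norm_apply_le (freq ξ n) j
  rw [mul_inv, ← div_eq_mul_inv, le_div_iff₀ Real.pi_pos]
  refine le_trans ?_ h1
  calc ‖freq ξ n j‖ * resSymbol g ε (freq ξ n) * Real.pi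
      ≤ ‖freq ξ n‖ * resSymbol g ε (freq ξ n) * ‖freq ξ n‖ := by gcongr
    _ = _ := by ring

/-- The effective resolvent plus the corrector is a rank one operator up to a bounded error. -/
theorem norm_effective_add_corrector_sub_le {R₀ : L2 d →L[ℂ] L2 d}
    {T V : Fin d → L2 d →L[ℂ] L2 d}
    (hR : ∀ u n, coef (R₀ u) n = (resSymbol g ε (freq ξ n) : ℂ) * coef u n)
    (hT : ∀ j u n, coef (T j u) n =
        ((freq ξ n j : ℂ) * (resSymbol g ε (freq ξ n) : ℂ)) * coef u n)
    {N : ℝ} (hN : 0 ≤ N) (hV : ∀ j u, ‖V j u‖ ≤ N * ‖u‖)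
    (hVs : ∀ j u w, inner ℂ (V j u) w = inner ℂ u (V j w))
    {θ : L2 d} (hθ : θ = (-Complex.I) • ∑ j, (ξ j : ℂ) • V j (expoLp 0))
    {Nθ : ℝ} (hNθ : ‖θ‖ ^ 2 ≤ Nθ * ‖ξ‖ ^ 2) (f : L2 d) :
    ‖R₀ f + ((-Complex.I) • ∑ j, V j (T j f) + Complex.I • ∑ j, T j (V j f)) -
      (((quadForm g ξ + ε ^ 2)⁻¹ : ℝ) : ℂ) • inner ℂ (expoLp 0 + θ) f • (expoLp 0 + θ)‖ ≤
      ((c * Real.pi ^ 2)⁻¹ + 2 * d * (N * (c * Real.pi)⁻¹) + |Nθ| * c⁻¹) * ‖f‖ := by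
  set ρ : ℝ := (quadForm g ξ + ε ^ 2)⁻¹ with hρ
  have hρ' : resSymbol g ε ξ = ρ := rfl
  have hρ0 : 0 ≤ ρ := resSymbol_nonneg hc hg hε ξ
  set o : L2 d := expoLp 0 with ho
  have hco : ∀ n, coef o n = if n = 0 then 1 else 0 := fun n => coef_expoLp 0 n
  have h1 : ∀ u, ‖R₀ u - (ρ : ℂ) • inner ℂ o u • o‖ ≤ (c * Real.pi ^ 2)⁻¹ * ‖u‖ := by
    intro u
    refine norm_le_of_norm_coef_le (by positivity) fun n => ?_
    rw [coef_sub, hR, coef_smul, coef_smul, hco]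
    split_ifs with hn
    · subst hn
      rw [freq_zero, hρ', mul_one, coef_zero_eq, sub_self, norm_zero]
      positivity
    · rw [mul_zero, mul_zero, sub_zero, norm_mul, Complex.norm_real,
        Real.norm_of_nonneg (resSymbol_nonneg hc hg hε _)]
      have := resSymbol_freq_le (ε := ε) hc hg hξ hn
      gcongr
  have h2 : ∀ j u, ‖T j u - (ρ : ℂ) • (ξ j : ℂ) • inner ℂ o u • o‖ ≤ (c * Real.pi)⁻¹ * ‖u‖ := by
    intro j u
    refine norm_le_of_norm_coef_le (by positivity) fun n => ?_
    rw [coef_sub, hT, coef_smul, coef_smul, coef_smul, hco]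
    split_ifs with hn
    · subst hn
      rw [freq_zero, hρ', mul_one, coef_zero_eq]
      have : (ξ j : ℂ) * (ρ : ℂ) * inner ℂ o u - (ρ : ℂ) * ((ξ j : ℂ) * inner ℂ o u) = 0 := by ring
      rw [this, norm_zero]
      positivity
    · rw [mul_zero, mul_zero, mul_zero, sub_zero, norm_mul]
      have := norm_freq_mul_resSymbol_freq_le hc hg hε hξ hn j
      gcongr
  have hθf : inner ℂ θ f = Complex.I * ∑ j, (ξ j : ℂ) * inner ℂ o (V j f) := by
    rw [hθ, inner_smul_left, sum_inner]
    simp only [inner_smul_left, hVs, Complex.conj_ofReal, map_neg, Complex.conj_I, neg_neg]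
  -- Replacing `R₀` and `T j` by their zero mode parts produces `ρ⟨o,f⟩o`, `ρ⟨o,f⟩θ` and `ρ⟨θ,f⟩o`.
  -- Of the four terms of `ρ⟨o+θ,f⟩(o+θ)` only `ρ⟨θ,f⟩θ` remains.
  have hsplit : R₀ f + ((-Complex.I) • ∑ j, V j (T j f) + Complex.I • ∑ j, T j (V j f)) -
      (ρ : ℂ) • inner ℂ (o + θ) f • (o + θ) =
      (R₀ f - (ρ : ℂ) • inner ℂ o f • o) +
      ((-Complex.I) • ∑ j, V j (T j f - (ρ : ℂ) • (ξ j : ℂ) • inner ℂ o f • o)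
      + Complex.I • ∑ j, (T j (V j f) - (ρ : ℂ) • (ξ j : ℂ) • inner ℂ o (V j f) • o))
      - (ρ : ℂ) • inner ℂ θ f • θ := by
    have e1 : ∑ j, V j (T j f - (ρ : ℂ) • (ξ j : ℂ) • inner ℂ o f • o) =
        ∑ j, V j (T j f) - ((ρ : ℂ) * inner ℂ o f) • ∑ j, (ξ j : ℂ) • V j o := by
      rw [Finset.smul_sum, ← Finset.sum_sub_distrib]
      refine Finset.sum_congr rfl fun j _ => ?_
      simp only [map_sub, ContinuousLinearMap.map_smul]
      module
    have e2 : ∑ j, (T j (V j f) - (ρ : ℂ) • (ξ j : ℂ) • inner ℂ o (V j f) • o) =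
        ∑ j, T j (V j f) - ((ρ : ℂ) * ∑ j, (ξ j : ℂ) * inner ℂ o (V j f)) • o := by
      rw [Finset.mul_sum, Finset.sum_smul, ← Finset.sum_sub_distrib]
      refine Finset.sum_congr rfl fun j _ => ?_
      module
    rw [e1, e2, inner_add_left, hθf]
    rw [smul_sub (-Complex.I), smul_comm (-Complex.I) ((ρ : ℂ) * inner ℂ o f), ← hθ]
    module
  rw [hsplit]
  have hsum1 : ‖∑ j, V j (T j f - (ρ : ℂ) • (ξ j : ℂ) • inner ℂ o f • o)‖ ≤
      d * (N * (c * Real.pi)⁻¹ * ‖f‖) := by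
    refine (norm_sum_le _ _).trans ?_
    refine (Finset.sum_le_card_nsmul _ _ (N * (c * Real.pi)⁻¹ * ‖f‖) fun j _ => ?_).trans (by simp)
    refine (hV j _).trans ?_
    rw [mul_assoc]
    gcongr
    exact h2 j f
  have hsum2 : ‖∑ j, (T j (V j f) - (ρ : ℂ) • (ξ j : ℂ) • inner ℂ o (V j f) • o)‖ ≤
      d * (N * (c * Real.pi)⁻¹ * ‖f‖) := by
    refine (norm_sum_le _ _).trans ?_
    refine (Finset.sum_le_card_nsmul _ _ (N * (c * Real.pi)⁻¹ * ‖f‖) fun j _ => ?_).trans (by simp)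
    refine (h2 j _).trans ?_
    calc (c * Real.pi)⁻¹ * ‖V j f‖ ≤ (c * Real.pi)⁻¹ * (N * ‖f‖) := by
          gcongr
          exact hV j f
      _ = _ := by ring
  have hlast : ‖(ρ : ℂ) • inner ℂ θ f • θ‖ ≤ |Nθ| * c⁻¹ * ‖f‖ := by
    rw [norm_smul, norm_smul, Complex.norm_real, Real.norm_of_nonneg hρ0]
    have h3 := norm_sq_mul_resSymbol_le hc hg hε ξ
    rw [hρ'] at h3
    calc ρ * (‖(inner ℂ θ f : ℂ)‖ * ‖θ‖) ≤ ρ * (‖θ‖ * ‖f‖ * ‖θ‖) := by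
          gcongr
          exact norm_inner_le_norm _ _
      _ = ρ * ‖θ‖ ^ 2 * ‖f‖ := by ring
      _ ≤ ρ * (|Nθ| * ‖ξ‖ ^ 2) * ‖f‖ := by
          have : Nθ * ‖ξ‖ ^ 2 ≤ |Nθ| * ‖ξ‖ ^ 2 := by gcongr; exact le_abs_self _
          gcongr
          exact hNθ.trans this
      _ = |Nθ| * (‖ξ‖ ^ 2 * ρ) * ‖f‖ := by ring
      _ ≤ _ := by gcongr
  refine (norm_sub_le _ _).trans ?_
  refine (add_le_add_left ((norm_add_le _ _).trans (add_le_add (h1 f) (norm_add_le _ _))) _).trans ?_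
  rw [norm_smul, norm_smul, norm_neg, Complex.norm_I, one_mul, one_mul]
  linarith

end effective

end NonlocalHom

/-! ### Lower bounds for the symbol and the second moments -/

namespace NonlocalHom

variable {d : ℕ}

open Filter Topology

theorem volume_inner_eq_const {y : E d} (hy : y ≠ 0) (k : ℝ) :
    volume {z : E d | inner ℝ z y = k} = 0 := by
  have hy2 : ‖y‖ ^ 2 ≠ 0 := by simpa using hy
  set z₀ : E d := (k / ‖y‖ ^ 2) • y
  have h : {z : E d | inner ℝ z y = k} =
      (fun z => z - z₀) ⁻¹' ((LinearMap.ker (innerSL ℝ y).toLinearMap : Submodule ℝ (E d)) : Set (E d)) := by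
    ext z
    simp only [Set.mem_preimage, SetLike.mem_coe, LinearMap.mem_ker, Set.mem_ofPred_eq,
      ContinuousLinearMap.coe_coe, innerSL_apply_apply, inner_sub_right, z₀, inner_smul_right,
      real_inner_self_eq_norm_sq, sub_eq_zero]
    rw [div_mul_cancel₀ _ hy2, real_inner_comm]
  rw [h, (measurePreserving_sub_right volume z₀).measure_preimage
    (Submodule.closed_of_finiteDimensional _).measurableSet.nullMeasurableSet]
  refine Measure.addHaar_submodule _ _ fun htop => hy ?_
  have : y ∈ LinearMap.ker (innerSL ℝ y).toLinearMap := by rw [htop]; trivial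
  simpa using this

/-- Equality holds only on countably many parallel hyperplanes, each of measure zero. -/
theorem ae_cos_inner_lt_one {y : E d} (hy : y ≠ 0) :
    ∀ᵐ z : E d, Real.cos (inner ℝ z y) < 1 := by
  have h : ∀ᵐ z : E d, ∀ k : ℤ, inner ℝ z y ≠ (k : ℝ) * (2 * Real.pi) := by
    rw [ae_all_iff]
    intro k
    exact measure_eq_zero_iff_ae_notMem.1 (volume_inner_eq_const hy _)
  filter_upwards [h] with z hz
  refine lt_of_le_of_ne (Real.cos_le_one _) fun hcos => ?_
  obtain ⟨k, hk⟩ := (Real.cos_eq_one_iff _).1 hcos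
  exact hz k hk.symm

theorem integrable_one_sub_cos_mul {h : E d → ℝ} (hi : Integrable h) (y : E d) :
    Integrable fun z => (1 - Real.cos (inner ℝ z y)) * h z := by
  refine hi.bdd_mul (c := 2) (by fun_prop) (.of_forall fun z => ?_)
  rw [Real.norm_eq_abs, abs_le]
  constructor <;> linarith [Real.cos_le_one (inner ℝ z y), Real.neg_one_le_cos (inner ℝ z y)]

theorem symbol_nonneg {h : E d → ℝ} (h0 : ∀ z, 0 ≤ h z) (y : E d) : 0 ≤ symbol h y :=
  integral_nonneg fun z => mul_nonneg (sub_nonneg.2 (Real.cos_le_one _)) (h0 z)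

theorem symbol_pos {h : E d → ℝ} (hi : Integrable h) (h0 : ∀ z, 0 ≤ h z) (hpos : 0 < ∫ z, h z)
    {y : E d} (hy : y ≠ 0) : 0 < symbol h y := by
  refine lt_of_le_of_ne (symbol_nonneg h0 y) fun heq => hpos.ne' ?_
  have h1 := (integral_eq_zero_iff_of_nonneg (fun z => mul_nonneg
    (sub_nonneg.2 (Real.cos_le_one _)) (h0 z)) (integrable_one_sub_cos_mul hi y)).1 heq.symm
  refine integral_eq_zero_of_ae ?_
  filter_upwards [h1, ae_cos_inner_lt_one hy] with z hz hc
  exact (mul_eq_zero.1 hz).resolve_left (sub_pos.2 hc).ne'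

theorem continuous_symbol {h : E d → ℝ} (hi : Integrable h) : Continuous (symbol h) := by
  refine continuous_of_dominated (bound := fun z => 2 * ‖h z‖)
    (fun y => (integrable_one_sub_cos_mul hi y).1) (fun y => .of_forall fun z => ?_)
    (hi.norm.const_mul 2) (.of_forall fun z => by fun_prop)
  rw [norm_mul]
  gcongr
  rw [Real.norm_eq_abs, abs_le]
  constructor <;> linarith [Real.cos_le_one (inner ℝ z y), Real.neg_one_le_cos (inner ℝ z y)]

/-- This is the Riemann-Lebesgue lemma applied to the cosine part. -/
theorem tendsto_symbol {h : E d → ℝ} (hi : Integrable h) :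
    Tendsto (symbol h) (cocompact (E d)) (𝓝 (∫ z, h z)) := by
  have h1 := tendsto_integral_exp_inner_smul_cocompact (V := E d) (fun z => (h z : ℂ))
  have h2 := (Complex.continuous_re.tendsto 0).comp h1
  -- The rescaling accounts for the factor `2π` in the exponent of the Fourier character.
  have hscale : Tendsto (fun y : E d => (2 * Real.pi)⁻¹ • y) (cocompact _) (cocompact _) :=
    (Homeomorph.smulOfNeZero ((2 * Real.pi)⁻¹ : ℝ)
      (inv_ne_zero (by positivity))).isClosedEmbedding.tendsto_cocompact
  have h3 := h2.comp hscale
  have h4 : ∀ y : E d, (∫ v, (Real.fourierChar (-inner ℝ v ((2 * Real.pi)⁻¹ • y))) • (h v : ℂ)).re =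
      ∫ v, Real.cos (inner ℝ v y) * h v := by
    intro y
    have hint : Integrable fun v => (Real.fourierChar (-inner ℝ v ((2 * Real.pi)⁻¹ • y))) • (h v : ℂ) :=
      (Real.fourierIntegral_convergent_iff _).2 hi.ofReal
    rw [← RCLike.re_eq_complex_re, ← integral_re hint]
    refine integral_congr_ae (.of_forall fun v => ?_)
    have hπ : (Real.pi : ℂ) ≠ 0 := by exact_mod_cast Real.pi_ne_zero
    simp only [Circle.smul_def, Real.fourierChar_apply, inner_smul_right, smul_eq_mul,
      RCLike.re_eq_complex_re, Complex.re_mul_ofReal]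
    rw [Complex.exp_ofReal_mul_I_re]
    congr 1
    rw [← Real.cos_neg]
    congr 1
    field_simp
  have h5 : ∀ y, symbol h y = (∫ z, h z) - ∫ v, Real.cos (inner ℝ v y) * h v := by
    intro y
    rw [← integral_sub hi (hi.bdd_mul (c := 1) (by fun_prop)
      (.of_forall fun z => Real.abs_cos_le_one _)), symbol]
    exact integral_congr_ae (.of_forall fun z => by ring)
  have h6 : Tendsto (fun y : E d => ∫ v, Real.cos (inner ℝ v y) * h v) (cocompact _) (𝓝 0) := by
    rw [← Complex.zero_re]
    exact h3.congr h4
  have h7 := tendsto_const_nhds (x := ∫ z, h z).sub h6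
  rw [sub_zero] at h7
  exact h7.congr fun y => (h5 y).symm

/-- The symbol of an integrable nonnegative nonzero function is bounded away from zero outside of
a ball centered at the origin. -/
theorem exists_le_symbol {h : E d → ℝ} (hi : Integrable h) (h0 : ∀ z, 0 ≤ h z)
    (hpos : 0 < ∫ z, h z) {r : ℝ} (hr : 0 < r) : ∃ c > 0, ∀ y, r ≤ ‖y‖ → c ≤ symbol h y := by
  -- Near infinity the limit gives the bound. On the compact remainder the continuous symbol attains
  -- a minimum, positive since the origin is excluded.
  have h1 : ∀ᶠ y in cocompact (E d), (∫ z, h z) / 2 < symbol h y :=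
    (tendsto_symbol hi).eventually (lt_mem_nhds (half_lt_self hpos))
  obtain ⟨K, hK, hKs⟩ := Filter.mem_cocompact.1 h1
  have hKr : IsCompact (K ∩ {y | r ≤ ‖y‖}) :=
    hK.inter_right (isClosed_le continuous_const continuous_norm)
  rcases (K ∩ {y | r ≤ ‖y‖}).eq_empty_or_nonempty with he | hne
  · refine ⟨_, half_pos hpos, fun y hy => ?_⟩
    have : y ∉ K := fun hyK => by
      have : y ∈ K ∩ {y | r ≤ ‖y‖} := ⟨hyK, hy⟩
      rw [he] at this
      exact this
    exact (hKs this).le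
  · obtain ⟨y₀, hy₀, hmin⟩ := hKr.exists_isMinOn hne (continuous_symbol hi).continuousOn
    have hy₀0 : y₀ ≠ 0 := by
      rintro rfl
      have := hy₀.2
      simp only [Set.mem_ofPred_eq, norm_zero] at this
      linarith
    refine ⟨min ((∫ z, h z) / 2) (symbol h y₀), lt_min (half_pos hpos)
      (symbol_pos hi h0 hpos hy₀0), fun y hy => ?_⟩
    by_cases hyK : y ∈ K
    · exact (min_le_right _ _).trans (hmin ⟨hyK, hy⟩)
    · exact (min_le_left _ _).trans (hKs hyK).le

theorem exists_norm_eq (hd : 1 ≤ d) {r : ℝ} (hr : 0 ≤ r) : ∃ y : E d, ‖y‖ = r := by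
  refine ⟨EuclideanSpace.single ⟨0, hd⟩ r, ?_⟩
  rw [PiLp.norm_single, Real.norm_of_nonneg hr]

theorem symbolInf_le {h : E d → ℝ} (h0 : ∀ z, 0 ≤ h z) {r : ℝ} {y : E d} (hy : r ≤ ‖y‖) :
    symbolInf h r ≤ symbol h y :=
  csInf_le ⟨0, by rintro _ ⟨y, -, rfl⟩; exact symbol_nonneg h0 y⟩ ⟨y, hy, rfl⟩

theorem symbolInf_pos (hd : 1 ≤ d) {h : E d → ℝ} (hi : Integrable h) (h0 : ∀ z, 0 ≤ h z)
    (hpos : 0 < ∫ z, h z) {r : ℝ} (hr : 0 < r) : 0 < symbolInf h r := by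
  obtain ⟨c, hc, hle⟩ := exists_le_symbol hi h0 hpos hr
  obtain ⟨y, hy⟩ := exists_norm_eq hd hr.le
  refine hc.trans_le (le_csInf ⟨_, y, hy.ge, rfl⟩ ?_)
  rintro _ ⟨y, hy, rfl⟩
  exact hle y hy

theorem integrable_pow_mul {a : E d → ℝ} (ha : Integrable a) (h4 : Integrable fun x => ‖x‖ ^ 4 * a x)
    {k : ℕ} (hk : k ≤ 4) : Integrable fun x => ‖x‖ ^ k * a x := by
  refine (ha.norm.add h4.norm).mono' ((by fun_prop : Continuous fun x : E d =>
    ‖x‖ ^ k).aestronglyMeasurable.mul ha.1) (.of_forall fun x => ?_)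
  simp only [Pi.add_apply, norm_mul, norm_pow, norm_norm]
  rw [← one_add_mul]
  gcongr
  rcases le_total ‖x‖ 1 with h | h
  · have := pow_le_one₀ (n := k) (norm_nonneg x) h
    have := pow_nonneg (norm_nonneg x) 4
    linarith
  · have := pow_le_pow_right₀ h hk
    linarith

theorem moment_nonneg {a : E d → ℝ} (h0 : ∀ x, 0 ≤ a x) (k : ℕ) : 0 ≤ moment a k :=
  integral_nonneg fun x => mul_nonneg (by positivity) (h0 x)

theorem ae_ne_zero (hd : 1 ≤ d) : ∀ᵐ x : E d, x ≠ 0 := by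
  obtain ⟨y, hy⟩ := exists_norm_eq hd zero_le_one
  have hy0 : y ≠ 0 := by rintro rfl; simp at hy
  filter_upwards [measure_eq_zero_iff_ae_notMem.1 (volume_inner_eq_const hy0 0)] with x hx h
  exact hx (by simp [h])

theorem moment_pos (hd : 1 ≤ d) {a : E d → ℝ} (h0 : ∀ x, 0 ≤ a x) (hpos : 0 < ∫ x, a x) {k : ℕ}
    (hk : Integrable fun x => ‖x‖ ^ k * a x) : 0 < moment a k := by
  refine lt_of_le_of_ne (moment_nonneg h0 k) fun heq => hpos.ne' ?_
  have h1 := (integral_eq_zero_iff_of_nonneg (fun z => mul_nonneg (by positivity) (h0 z)) hk).1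
    heq.symm
  refine integral_eq_zero_of_ae ?_
  filter_upwards [h1, ae_ne_zero hd] with z hz hc
  exact (mul_eq_zero.1 hz).resolve_left (pow_ne_zero _ (norm_ne_zero_iff.2 hc))

theorem integrable_mul_inner_sq {a : E d → ℝ} (ha : Integrable a)
    (h2 : Integrable fun x => ‖x‖ ^ 2 * a x) (θ : E d) :
    Integrable fun z => a z * inner ℝ z θ ^ 2 := by
  refine (h2.norm.mul_const (‖θ‖ ^ 2)).mono' (ha.1.mul (by fun_prop)) (.of_forall fun z => ?_)
  rw [norm_mul, norm_mul, norm_pow, norm_pow, norm_norm]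
  have := norm_inner_le_norm (𝕜 := ℝ) z θ
  calc ‖a z‖ * ‖inner ℝ z θ‖ ^ 2 ≤ ‖a z‖ * (‖z‖ * ‖θ‖) ^ 2 := by gcongr
    _ = _ := by ring

theorem secondMin_le {a : E d → ℝ} (h0 : ∀ x, 0 ≤ a x) {θ : E d} (hθ : ‖θ‖ = 1) :
    secondMin a ≤ ∫ z, a z * inner ℝ z θ ^ 2 :=
  csInf_le ⟨0, by
    rintro _ ⟨y, -, rfl⟩
    exact integral_nonneg fun z => mul_nonneg (h0 z) (sq_nonneg _)⟩ ⟨θ, hθ, rfl⟩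

theorem secondMin_mul_norm_sq_le {a : E d → ℝ} (h0 : ∀ x, 0 ≤ a x) (y : E d) :
    secondMin a * ‖y‖ ^ 2 ≤ ∫ z, a z * inner ℝ z y ^ 2 := by
  rcases eq_or_ne y 0 with rfl | hy
  · simp
  have hn : ‖y‖ ≠ 0 := norm_ne_zero_iff.2 hy
  have h := secondMin_le h0 (θ := ‖y‖⁻¹ • y) (by rw [norm_smul, norm_inv, norm_norm, inv_mul_cancel₀ hn])
  have h2 : ∀ z, a z * inner ℝ z y ^ 2 = ‖y‖ ^ 2 * (a z * inner ℝ z (‖y‖⁻¹ • y) ^ 2) := by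
    intro z
    rw [inner_smul_right]
    field_simp
  simp only [h2, integral_const_mul]
  rw [mul_comm]
  gcongr

/-- The second moment is continuous in the direction, and on the compact unit sphere its minimum
cannot be zero, since the hyperplane `⟨z,θ⟩ = 0` is null. -/
theorem secondMin_pos (hd : 1 ≤ d) {a : E d → ℝ} (ha : Integrable a) (h0 : ∀ x, 0 ≤ a x)
    (hpos : 0 < ∫ x, a x) (h2 : Integrable fun x => ‖x‖ ^ 2 * a x) : 0 < secondMin a := by
  obtain ⟨y, hy⟩ := exists_norm_eq hd zero_le_one
  have hcont : Continuous fun θ : E d => ∫ z, a z * inner ℝ z θ ^ 2 := by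
    refine continuous_iff_continuousAt.2 fun θ₀ => ?_
    refine continuousAt_of_dominated (bound := fun z => ‖‖z‖ ^ 2 * a z‖ * (‖θ₀‖ + 1) ^ 2)
      (.of_forall fun θ => (integrable_mul_inner_sq ha h2 θ).1) ?_ (h2.norm.mul_const _)
      (.of_forall fun z => by fun_prop)
    filter_upwards [Metric.ball_mem_nhds θ₀ one_pos] with θ hθ
    refine .of_forall fun z => ?_
    have h1 := norm_inner_le_norm (𝕜 := ℝ) z θ
    have h3 : ‖θ‖ ≤ ‖θ₀‖ + 1 := by
      have := norm_sub_norm_le θ θ₀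
      rw [Metric.mem_ball, dist_eq_norm] at hθ
      linarith
    rw [norm_mul, norm_mul, norm_pow, norm_pow, norm_norm]
    calc ‖a z‖ * ‖inner ℝ z θ‖ ^ 2 ≤ ‖a z‖ * (‖z‖ * (‖θ₀‖ + 1)) ^ 2 := by
          gcongr
          exact h1.trans (by gcongr)
      _ = _ := by ring
  have hcomp : IsCompact {θ : E d | ‖θ‖ = 1} := by
    have h : {θ : E d | ‖θ‖ = 1} = Metric.sphere 0 1 := Set.ext fun θ => by simp
    rw [h]
    exact isCompact_sphere 0 1
  obtain ⟨θ, hθ, hmin⟩ := hcomp.exists_isMinOn ⟨y, hy⟩ hcont.continuousOn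
  have hθ0 : θ ≠ 0 := by rintro rfl; simp at hθ
  have hval : 0 < ∫ z, a z * inner ℝ z θ ^ 2 := by
    refine lt_of_le_of_ne (integral_nonneg fun z => mul_nonneg (h0 z) (sq_nonneg _))
      fun heq => hpos.ne' ?_
    have h1 := (integral_eq_zero_iff_of_nonneg (fun z => mul_nonneg (h0 z) (sq_nonneg _))
      (integrable_mul_inner_sq ha h2 θ)).1 heq.symm
    refine integral_eq_zero_of_ae ?_
    filter_upwards [h1, measure_eq_zero_iff_ae_notMem.1 (volume_inner_eq_const hθ0 0)] with z hz hc
    exact (mul_eq_zero.1 hz).resolve_right (pow_ne_zero _ hc)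
  refine hval.trans_le (le_csInf ⟨_, y, hy, rfl⟩ ?_)
  rintro _ ⟨θ', hθ', rfl⟩
  exact hmin hθ'

theorem sub_sq_le_sin {t : ℝ} (ht : 0 ≤ t) : t - t ^ 2 / 2 ≤ Real.sin t := by
  have hd : ∀ s : ℝ, HasDerivAt (fun s => Real.sin s - s + s ^ 2 / 2) (Real.cos s - 1 + s) s := by
    intro s
    have := ((Real.hasDerivAt_sin s).sub (hasDerivAt_id s)).add ((hasDerivAt_pow 2 s).div_const 2)
    exact this.congr_deriv (by simp)
  have hmono : MonotoneOn (fun s => Real.sin s - s + s ^ 2 / 2) (Set.Ici 0) := by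
    refine monotoneOn_of_deriv_nonneg (convex_Ici 0) (by fun_prop) (by fun_prop) fun s hs => ?_
    rw [interior_Ici, Set.mem_Ioi] at hs
    rw [(hd s).deriv]
    -- The derivative `cos s - 1 + s` is at least `s - s²/2` up to `s = 2`, and at least `s - 2`
    -- beyond.
    rcases le_total s 2 with h | h
    · nlinarith [Real.one_sub_sq_div_two_le_cos (x := s)]
    · linarith [Real.neg_one_le_cos s]
  have := hmono Set.self_mem_Ici ht ht
  simp only [Real.sin_zero] at this
  linarith

theorem sq_sub_cube_le_one_sub_cos (t : ℝ) : t ^ 2 / 2 - |t| ^ 3 / 6 ≤ 1 - Real.cos t := by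
  have hd : ∀ s : ℝ, HasDerivAt (fun s => 1 - Real.cos s - s ^ 2 / 2 + s ^ 3 / 6)
      (Real.sin s - s + s ^ 2 / 2) s := by
    intro s
    have := (((Real.hasDerivAt_cos s).const_sub 1).sub ((hasDerivAt_pow 2 s).div_const 2)).add
      ((hasDerivAt_pow 3 s).div_const 6)
    exact this.congr_deriv (by norm_num; ring)
  have hmono : MonotoneOn (fun s => 1 - Real.cos s - s ^ 2 / 2 + s ^ 3 / 6) (Set.Ici 0) := by
    refine monotoneOn_of_deriv_nonneg (convex_Ici 0) (by fun_prop) (by fun_prop) fun s hs => ?_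
    rw [interior_Ici, Set.mem_Ioi] at hs
    rw [(hd s).deriv]
    linarith [sub_sq_le_sin hs.le]
  have := hmono Set.self_mem_Ici (abs_nonneg t) (abs_nonneg t)
  simp only [Real.cos_zero, Real.cos_abs, sq_abs] at this
  linarith

/-- The quadratic lower bound of the symbol near the origin. -/
theorem symbol_lower_near {a : E d → ℝ} (ha : Integrable a) (h0 : ∀ x, 0 ≤ a x)
    (h2 : Integrable fun x => ‖x‖ ^ 2 * a x) (h3 : Integrable fun x => ‖x‖ ^ 3 * a x)
    (hM3 : 0 < moment a 3) {y : E d} (hy : ‖y‖ ≤ radius a) :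
    secondMin a / 4 * ‖y‖ ^ 2 ≤ symbol a y := by
  have hlow : (∫ z, a z * inner ℝ z y ^ 2) / 2 - ‖y‖ ^ 3 * moment a 3 / 6 ≤ symbol a y := by
    rw [moment, ← integral_const_mul, ← integral_div, ← integral_div, ← integral_sub
      ((integrable_mul_inner_sq ha h2 y).div_const 2) ((h3.const_mul _).div_const 6)]
    refine integral_mono (((integrable_mul_inner_sq ha h2 y).div_const 2).sub
      ((h3.const_mul _).div_const 6)) (integrable_one_sub_cos_mul ha y) fun z => ?_
    have h1 := sq_sub_cube_le_one_sub_cos (inner ℝ z y)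
    have h4 : |inner ℝ z y| ^ 3 ≤ (‖z‖ * ‖y‖) ^ 3 :=
      pow_le_pow_left₀ (abs_nonneg _) (abs_real_inner_le_norm z y) 3
    have h5 := mul_le_mul_of_nonneg_right h1 (h0 z)
    have h6 := mul_le_mul_of_nonneg_right h4 (h0 z)
    simp only
    nlinarith
  have h4 := secondMin_mul_norm_sq_le h0 y
  -- This is the definition of `r(a)`: in this range the cubic error is at most half of the
  -- quadratic term `ℳ(a)|y|²/2`, which leaves the factor `1/4`.
  have h5 : ‖y‖ * moment a 3 ≤ 3 * secondMin a / 2 := by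
    rw [radius] at hy
    rw [le_div_iff₀ (by positivity)] at hy
    linarith
  have h6 := mul_le_mul_of_nonneg_left h5 (sq_nonneg ‖y‖)
  nlinarith

end NonlocalHom

/-! ### Periodization, truncation and the number `t₀` -/

namespace NonlocalHom

variable {d : ℕ}

open Filter Topology

section unfolding

variable {G : Type*} [NormedAddCommGroup G] {F : E d → G}

theorem aestronglyMeasurable_translate (hF : AEStronglyMeasurable F) (n : Fin d → ℤ) :
    AEStronglyMeasurable (fun x => F (x + lat n)) (cellMeasure d) :=
  (hF.comp_measurePreserving (measurePreserving_add_right volume (lat n))).restrict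

theorem tsum_lintegral_enorm_ne_top (hF : Integrable F) :
    ∑' n : Fin d → ℤ, ∫⁻ x in cell d, ‖F (x + lat n)‖ₑ ≠ ⊤ := by
  rw [← lintegral_eq_cell_tsum fun x => ‖F x‖ₑ]
  exact hF.2.ne

theorem integrable_tsum_translates [CompleteSpace G] (hF : Integrable F) :
    Integrable (fun x => ∑' n : Fin d → ℤ, F (x + lat n)) (cellMeasure d) := by
  have hm : ∀ n : Fin d → ℤ, AEMeasurable (fun x => ‖F (x + lat n)‖ₑ) (cellMeasure d) :=
    fun n => (aestronglyMeasurable_translate hF.1 n).enorm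
  refine ⟨AEStronglyMeasurable.tsum fun n => aestronglyMeasurable_translate hF.1 n, ?_⟩
  refine lt_of_le_of_lt ?_ (tsum_lintegral_enorm_ne_top hF).lt_top
  rw [← lintegral_tsum hm]
  exact lintegral_mono fun x => enorm_tsum_le_tsum_enorm

theorem integral_tsum_translates [NormedSpace ℝ G] (hF : Integrable F) :
    ∫ x in cell d, ∑' n : Fin d → ℤ, F (x + lat n) = ∫ x, F x := by
  rw [integral_tsum (fun n => aestronglyMeasurable_translate hF.1 n)
    (tsum_lintegral_enorm_ne_top hF), integral_eq_cell_tsum hF]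

end unfolding

section periodization

variable {a : E d → ℝ}

theorem periodization_add_lat (a : E d → ℝ) (x : E d) (m : Fin d → ℤ) :
    periodization a (x + lat m) = periodization a x := by
  rw [periodization, periodization, ← (Equiv.addLeft m).tsum_eq fun n => a (x + lat n)]
  refine tsum_congr fun n => ?_
  rw [Equiv.coe_addLeft, lat_add, add_assoc]

theorem periodization_wrap (a : E d → ℝ) (x : E d) :
    periodization a (wrap x) = periodization a x := by
  rw [wrap_eq_add_lat, periodization_add_lat]

theorem periodization_nonneg (h0 : ∀ x, 0 ≤ a x) (x : E d) : 0 ≤ periodization a x :=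
  tsum_nonneg fun _ => h0 _

theorem integrable_periodization (ha : Integrable a) :
    Integrable (periodization a) (cellMeasure d) := integrable_tsum_translates ha

theorem integral_periodization (ha : Integrable a) :
    ∫ x in cell d, periodization a x = ∫ x, a x := integral_tsum_translates ha

/-- The cube `[-2,2]^d`. -/
def cube (d : ℕ) : Set (E d) := {z | ∀ j, z j ∈ Set.Icc (-2 : ℝ) 2}

theorem cube_subset_closedBall : cube d ⊆ Metric.closedBall 0 (Real.sqrt (4 * d)) := by
  intro x hx
  rw [mem_closedBall_zero_iff]
  refine Real.le_sqrt_of_sq_le ?_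
  rw [EuclideanSpace.norm_sq_eq]
  calc ∑ j, ‖x j‖ ^ 2 ≤ ∑ _j : Fin d, (4 : ℝ) := by
        refine Finset.sum_le_sum fun j _ => ?_
        rw [Real.norm_eq_abs, sq_abs]
        nlinarith [(hx j).1, (hx j).2]
    _ = _ := by simp [mul_comm]

/-- The cube is covered by finitely many translates of the cell, on each of which the periodic
function has the same finite integral. This makes the supremum defining the modulus finite. -/
theorem integrableOn_cube_periodization (ha : Integrable a) :
    IntegrableOn (periodization a) (cube d) := by
  obtain ⟨c, hc, hle⟩ := map_wrap_restrict_ball_le (d := d) (Real.sqrt (4 * d))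
  have h1 : Integrable (periodization a)
      ((volume.restrict (Metric.closedBall 0 (Real.sqrt (4 * d)))).map wrap) :=
    ((integrable_periodization ha).smul_measure hc).mono_measure hle
  have h2 := h1.comp_measurable measurable_wrap
  have h3 : (periodization a ∘ wrap) = periodization a := funext fun x => periodization_wrap a x
  rw [h3] at h2
  exact IntegrableOn.mono_set h2 cube_subset_closedBall

theorem setIntegral_le_modulus (ha : Integrable a) (h0 : ∀ x, 0 ≤ a x) {t : ℝ} {O : Set (E d)}
    (hO : MeasurableSet O) (hOc : O ⊆ cube d) (hOt : volume O ≤ ENNReal.ofReal t) :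
    ∫ z in O, periodization a z ≤ modulus a t := by
  refine le_csSup ⟨∫ z in cube d, periodization a z, ?_⟩ ⟨O, hO, fun z hz => hOc hz, hOt, rfl⟩
  rintro _ ⟨U, hU, hUc, -, rfl⟩
  exact setIntegral_mono_set (integrableOn_cube_periodization ha)
    (.of_forall fun x => periodization_nonneg h0 x) (LE.le.eventuallyLE hUc)

theorem modulus_nonneg (h0 : ∀ x, 0 ≤ a x) (t : ℝ) : 0 ≤ modulus a t := by
  refine Real.sSup_nonneg ?_
  rintro _ ⟨U, hU, hUc, -, rfl⟩
  exact setIntegral_nonneg hU fun x _ => periodization_nonneg h0 x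

/-- Absolute continuity of the integral gives the existence of admissible `t₀`. -/
theorem exists_modulus_le (ha : Integrable a) {η : ℝ} (hη : 0 < η) :
    ∃ t > 0, modulus a t ≤ η := by
  have hint := integrableOn_cube_periodization ha
  obtain ⟨δ, hδ, h⟩ := exists_pos_setLIntegral_lt_of_measure_lt (μ := volume.restrict (cube d))
    (f := fun x => ‖periodization a x‖ₑ) hint.2.ne (ENNReal.ofReal_pos.2 hη).ne'
  obtain ⟨t, ht, htδ⟩ := ENNReal.lt_iff_exists_real_btwn.1 hδ
  refine ⟨t, ?_, csSup_le ⟨_, ∅, .empty, by simp, by simp, rfl⟩ ?_⟩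
  · exact ENNReal.ofReal_pos.1 htδ.1
  rintro _ ⟨U, hU, hUc, hUt, rfl⟩
  have h1 : (volume.restrict (cube d)) U < δ :=
    (Measure.restrict_apply_le _ _).trans_lt (hUt.trans_lt htδ.2)
  have h2 := h U h1
  rw [Measure.restrict_restrict hU, Set.inter_eq_left.2 (show U ⊆ cube d from hUc)] at h2
  refine (le_abs_self _).trans ?_
  rw [← Real.norm_eq_abs]
  have h3 := (enorm_integral_le_lintegral_enorm (μ := volume.restrict U)
    (periodization a)).trans h2.le
  rw [← ofReal_norm] at h3
  exact (ENNReal.ofReal_le_ofReal_iff hη.le).1 h3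

theorem truncation_nonneg (h0 : ∀ x, 0 ≤ a x) (x : E d) : 0 ≤ truncation a x :=
  le_min (periodization_nonneg h0 x) zero_le_one

theorem integrable_truncation (ha : Integrable a) (h0 : ∀ x, 0 ≤ a x) :
    Integrable (truncation a) (cellMeasure d) := by
  have h1 := integrable_periodization ha
  refine h1.mono (h1.1.aemeasurable.min aemeasurable_const).aestronglyMeasurable
    (.of_forall fun x => ?_)
  rw [Real.norm_of_nonneg (truncation_nonneg h0 x), Real.norm_of_nonneg (periodization_nonneg h0 x)]
  exact min_le_left _ _

theorem truncMass_le_integral (ha : Integrable a) (h0 : ∀ x, 0 ≤ a x) :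
    truncMass a ≤ ∫ x, a x := by
  rw [← integral_periodization ha]
  exact integral_mono (integrable_truncation ha h0) (integrable_periodization ha)
    fun x => min_le_left _ _

theorem truncMass_le_one (ha : Integrable a) (h0 : ∀ x, 0 ≤ a x) : truncMass a ≤ 1 := by
  have : truncMass a ≤ ∫ _x in cell d, (1 : ℝ) :=
    integral_mono (integrable_truncation ha h0) (integrable_const _) fun x => min_le_right _ _
  simpa using this

theorem truncMass_pos (ha : Integrable a) (h0 : ∀ x, 0 ≤ a x) (hpos : 0 < ∫ x, a x) :
    0 < truncMass a := by
  refine lt_of_le_of_ne (integral_nonneg fun x => truncation_nonneg h0 x) fun heq => hpos.ne' ?_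
  have h1 := (integral_eq_zero_iff_of_nonneg (fun x => truncation_nonneg h0 x)
    (integrable_truncation ha h0)).1 heq.symm
  rw [← integral_periodization ha]
  refine integral_eq_zero_of_ae ?_
  filter_upwards [h1] with x hx
  rcases min_choice (periodization a x) 1 with h | h
  · exact h.symm.trans hx
  · have : (1 : ℝ) = 0 := h.symm.trans hx
    norm_num at this

theorem truncSymbolInf_eq (a : E d → ℝ) :
    truncSymbolInf a = symbolInf ((cell d).indicator (truncation a)) (2 * Real.pi) := by
  rw [truncSymbolInf, symbolInf]
  congr 1
  refine Set.image_congr fun y _ => ?_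
  rw [symbol, ← integral_indicator measurableSet_cell]
  refine integral_congr_ae (.of_forall fun z => ?_)
  by_cases hz : z ∈ cell d <;> simp [hz, mul_comm]

theorem indicator_truncation_nonneg (h0 : ∀ x, 0 ≤ a x) (x : E d) :
    0 ≤ (cell d).indicator (truncation a) x :=
  Set.indicator_nonneg (fun x _ => truncation_nonneg h0 x) x

theorem truncSymbolInf_pos (hd : 1 ≤ d) (ha : Integrable a) (h0 : ∀ x, 0 ≤ a x)
    (hpos : 0 < ∫ x, a x) : 0 < truncSymbolInf a := by
  rw [truncSymbolInf_eq]
  refine symbolInf_pos hd ((integrable_indicator_iff measurableSet_cell).2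
    (integrable_truncation ha h0)) (indicator_truncation_nonneg h0) ?_ (by positivity)
  rw [integral_indicator measurableSet_cell]
  exact truncMass_pos ha h0 hpos

theorem truncSymbolInf_le_two (hd : 1 ≤ d) (ha : Integrable a) (h0 : ∀ x, 0 ≤ a x) :
    truncSymbolInf a ≤ 2 := by
  obtain ⟨y, hy⟩ := exists_norm_eq hd (show (0 : ℝ) ≤ 2 * Real.pi by positivity)
  rw [truncSymbolInf_eq]
  have hi : Integrable ((cell d).indicator (truncation a)) :=
    (integrable_indicator_iff measurableSet_cell).2 (integrable_truncation ha h0)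
  refine (symbolInf_le (indicator_truncation_nonneg h0) hy.ge).trans ?_
  have h1 : symbol ((cell d).indicator (truncation a)) y ≤
      ∫ z, 2 * (cell d).indicator (truncation a) z := by
    refine integral_mono (integrable_one_sub_cos_mul hi y) (hi.const_mul 2) fun z => ?_
    have := indicator_truncation_nonneg h0 z
    have := Real.neg_one_le_cos (inner ℝ z y)
    simp only
    gcongr
    linarith
  rw [integral_const_mul, integral_indicator measurableSet_cell] at h1
  have := truncMass_le_one ha h0
  rw [truncMass] at this
  linarith

theorem exists_isThreshold (ha : Integrable a) (h0 : ∀ x, 0 ≤ a x) (hpos : 0 < ∫ x, a x)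
    {μm μp : ℝ} (hm : 0 < μm) (hp : 0 < μp) : ∃ t₀, IsThreshold a μm μp t₀ := by
  have hT := truncMass_pos ha h0 hpos
  obtain ⟨t, ht, hle⟩ := exists_modulus_le ha (η := μm * truncMass a / (2 * μp)) (by positivity)
  refine ⟨t, ht, ?_⟩
  rw [div_le_iff₀ (by positivity)]
  rw [le_div_iff₀ (by positivity)] at hle
  linarith

/-- Both the threshold and the truncated mass are controlled by `boundConst`. -/
theorem inv_threshold_le (hd : 1 ≤ d) (ha : Integrable a) (h0 : ∀ x, 0 ≤ a x)
    (hpos : 0 < ∫ x, a x) {μm μp t₀ : ℝ} (hm : 0 < μm) (ht : 0 < t₀) :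
    t₀⁻¹ ≤ 2 * μm * Real.sqrt (boundConst a μm μp t₀) := by
  have hC := truncSymbolInf_pos hd ha h0 hpos
  have hC2 := truncSymbolInf_le_two hd ha h0
  have h1 : (1 / (t₀ * μm * truncSymbolInf a)) ^ 2 ≤ boundConst a μm μp t₀ := by
    rw [div_pow, one_pow]
    exact le_max_left _ _
  have h2 := Real.le_sqrt_of_sq_le h1
  -- The bound `truncSymbolInf a ≤ 2` removes this infimum from the estimate, leaving only `μ₋` and
  -- `ℭ`.
  calc t₀⁻¹ = μm * truncSymbolInf a * (1 / (t₀ * μm * truncSymbolInf a)) := by field_simp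
    _ ≤ μm * 2 * Real.sqrt (boundConst a μm μp t₀) := by gcongr
    _ = _ := by ring

theorem inv_truncMass_le (ha : Integrable a) (h0 : ∀ x, 0 ≤ a x)
    (hpos : 0 < ∫ x, a x) {μm μp t₀ : ℝ} (hm : 0 < μm) (hp : 0 ≤ μp) :
    (μm * truncMass a)⁻¹ ≤ boundConst a μm μp t₀ / 2 := by
  have hT := truncMass_pos ha h0 hpos
  have h1 : (μp / μm + Real.sqrt (2 / (μm * truncMass a) + μp ^ 2 / μm ^ 2)) ^ 2 ≤
      boundConst a μm μp t₀ := le_max_right _ _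
  have h2 : Real.sqrt (2 / (μm * truncMass a) + μp ^ 2 / μm ^ 2) ^ 2 ≤
      (μp / μm + Real.sqrt (2 / (μm * truncMass a) + μp ^ 2 / μm ^ 2)) ^ 2 := by
    have : 0 ≤ μp / μm := by positivity
    gcongr
    linarith
  rw [Real.sq_sqrt (by positivity)] at h2
  have h3 : 0 ≤ μp ^ 2 / μm ^ 2 := by positivity
  have h4 : 2 / (μm * truncMass a) = 2 * (μm * truncMass a)⁻¹ := div_eq_mul_inv _ _
  linarith

/-- The mass of the kernel carried by a small set. -/
theorem integral_mul_indicator_wrap_le (ha : Integrable a) (h0 : ∀ x, 0 ≤ a x) {t : ℝ}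
    {O : Set (E d)} (hO : MeasurableSet O) (hOc : O ⊆ cell d) (hOt : volume O ≤ ENNReal.ofReal t)
    {x : E d} (hx : x ∈ cell d) :
    ∫ z, a z * O.indicator 1 (wrap (x - z)) ≤ modulus a t := by
  have hint : Integrable fun y => a (x - y) * O.indicator 1 (wrap y) := by
    refine (ha.comp_sub_left x).mul_bdd (c := 1)
      ((measurable_one.indicator hO).comp measurable_wrap).aestronglyMeasurable
      (.of_forall fun y => ?_)
    by_cases h : wrap y ∈ O <;> simp [h]
  have h1 : ∫ z, a z * O.indicator 1 (wrap (x - z)) = ∫ y, a (x - y) * O.indicator 1 (wrap y) := by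
    rw [← integral_sub_left_eq_self (fun y => a y * O.indicator 1 (wrap (x - y))) volume x]
    simp only [sub_sub_cancel]
  have h2 : ∫ y, a (x - y) * O.indicator 1 (wrap y) = ∫ y in O, periodization a (x - y) := by
    rw [← integral_tsum_translates hint]
    have : ∫ y in O, periodization a (x - y) =
        ∫ y in cell d, O.indicator (fun y => periodization a (x - y)) y := by
      rw [integral_indicator hO, Measure.restrict_restrict hO, Set.inter_eq_left.2 hOc]
    rw [this]
    refine setIntegral_congr_fun measurableSet_cell fun y hy => ?_
    simp only [wrap_add_lat, wrap_eq_self hy]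
    by_cases h : y ∈ O
    · simp only [h, Set.indicator_of_mem, Pi.one_apply, mul_one, periodization]
      -- Unfolding in `y` gives translates of `x - y` by `-n`, so the summation index changes sign.
      rw [← (Equiv.neg (Fin d → ℤ)).tsum_eq]
      refine tsum_congr fun n => ?_
      rw [Equiv.neg_apply, lat_neg, sub_add_eq_sub_sub, sub_neg_eq_add]
    · simp [h]
  have h3 : ∫ y in O, periodization a (x - y) =
      ∫ z in (fun y => x - y) ⁻¹' O, periodization a z := by
    rw [← (Measure.measurePreserving_sub_left volume x).setIntegral_preimage_emb
      (MeasurableEquiv.subLeft x).measurableEmbedding]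
    simp only [sub_sub_cancel]
  rw [h1, h2, h3]
  refine setIntegral_le_modulus ha h0 ((by fun_prop : Measurable fun y => x - y) hO) ?_ ?_
  -- The difference of two points of `Ω` has coordinates in `(-1,1)`, hence lies in the cube.
  · intro z hz j
    have h4 := hOc hz j
    have h5 := hx j
    rw [PiLp.sub_apply] at h4
    constructor <;> linarith [h4.1, h4.2, h5.1, h5.2]
  · rw [(Measure.measurePreserving_sub_left volume x).measure_preimage hO.nullMeasurableSet]
    exact hOt

end periodization

end NonlocalHom

/-! ### The symmetric pair measure -/

namespace NonlocalHom

variable {d : ℕ}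

/-- The density `a(z) μ(x,x-z)`. -/
def kern (a : E d → ℝ) (μ : E d → E d → ℝ) (p : E d × E d) : ℝ := a p.2 * μ p.1 (p.1 - p.2)

/-- The measure `a(z) μ(x,x-z) dx dz` on `Ω × ℝ^d`. -/
noncomputable def pairMeasure (a : E d → ℝ) (μ : E d → E d → ℝ) : Measure (E d × E d) :=
  ((cellMeasure d).prod volume).withDensity fun p => ENNReal.ofReal (kern a μ p)

/-- The involution `(x,z) ↦ (x-z,-z)`, where `x-z` is taken modulo `ℤ^d`. -/
noncomputable def flip (p : E d × E d) : E d × E d := (wrap (p.1 - p.2), -p.2)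

theorem measurable_wrap_sub : Measurable fun p : E d × E d => wrap (p.1 - p.2) :=
  measurable_wrap.comp (measurable_fst.sub measurable_snd)

/-- For fixed `z` the shift by `z` modulo the lattice preserves the measure of the cell, and
reflection preserves that of `ℝ^d`. The flip is a skew product of the two. -/
theorem measurePreserving_flip :
    MeasurePreserving (flip : E d × E d → E d × E d) ((cellMeasure d).prod volume)
      ((cellMeasure d).prod volume) := by
  have h1 : MeasurePreserving (fun p : E d × E d => (-p.1, wrap (p.2 - p.1)))
      ((volume : Measure (E d)).prod (cellMeasure d)) (volume.prod (cellMeasure d)) :=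
    (Measure.measurePreserving_neg volume).skew_product (g := fun z x => wrap (x - z))
      (measurable_wrap.comp (measurable_snd.sub measurable_fst))
      (.of_forall fun z => (measurePreserving_wrap_sub z).map_eq)
  exact Measure.measurePreserving_swap.comp (h1.comp Measure.measurePreserving_swap)

theorem flip_flip {p : E d × E d} (hp : p.1 ∈ cell d) : flip (flip p) = p := by
  ext1
  · show wrap (wrap (p.1 - p.2) - -p.2) = p.1
    rw [wrap_wrap_sub, sub_sub, add_neg_cancel, sub_zero, wrap_eq_self hp]
  · exact neg_neg _

section

variable {a : E d → ℝ} {μ : E d → E d → ℝ} {μm μp : ℝ} (H : Coefficients a μ μm μp)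

include H

theorem Coefficients.upper_pos : 0 < μp := H.lower_pos.trans_le ((H.lower 0 0).trans (H.upper 0 0))

theorem Coefficients.integral_pos : 0 < ∫ x, a x := by
  refine lt_of_le_of_ne (integral_nonneg H.nonneg) fun heq => H.nontrivial.ne' ?_
  have h1 := (integral_eq_zero_iff_of_nonneg H.nonneg H.integrable).1 heq.symm
  exact h1

theorem Coefficients.kern_nonneg (p : E d × E d) : 0 ≤ kern a μ p :=
  mul_nonneg (H.nonneg _) (H.lower_pos.le.trans (H.lower _ _))

theorem Coefficients.kern_le (p : E d × E d) : kern a μ p ≤ a p.2 * μp :=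
  mul_le_mul_of_nonneg_left (H.upper _ _) (H.nonneg _)

theorem Coefficients.le_kern (p : E d × E d) : a p.2 * μm ≤ kern a μ p :=
  mul_le_mul_of_nonneg_left (H.lower _ _) (H.nonneg _)

/-- Evenness of `a`, together with symmetry and periodicity of `μ`, enters here. The resulting
invariance makes `𝔸(ξ)` symmetric. -/
theorem Coefficients.kern_flip (p : E d × E d) : kern a μ (flip p) = kern a μ p := by
  simp only [kern, flip, H.even]
  rw [wrap_eq_add_lat, sub_neg_eq_add, add_right_comm, sub_add_cancel, H.periodic, H.symm]

theorem Coefficients.aestronglyMeasurable_kern :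
    AEStronglyMeasurable (kern a μ) ((cellMeasure d).prod volume) := by
  have hac : (cellMeasure d).prod (volume : Measure (E d)) ≪ volume.prod volume :=
    Measure.AbsolutelyContinuous.prod (Measure.absolutelyContinuous_of_le Measure.restrict_le_self)
      Measure.AbsolutelyContinuous.rfl
  have hsh : MeasurePreserving (fun p : E d × E d => (p.1, p.1 - p.2))
      ((volume : Measure (E d)).prod volume) (volume.prod volume) :=
    (MeasurePreserving.id volume).skew_product (g := fun x z => x - z)
      (measurable_fst.sub measurable_snd)
      (.of_forall fun x => (Measure.measurePreserving_sub_left volume x).map_eq)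
  exact AEStronglyMeasurable.mul H.integrable.1.comp_snd
    ((H.measurable.comp_measurePreserving hsh).mono_ac hac)

theorem Coefficients.aemeasurable_density :
    AEMeasurable (fun p => ENNReal.ofReal (kern a μ p)) ((cellMeasure d).prod volume) :=
  H.aestronglyMeasurable_kern.aemeasurable.ennreal_ofReal

theorem Coefficients.measurePreserving_flip :
    MeasurePreserving flip (pairMeasure a μ) (pairMeasure a μ) := by
  have hm := NonlocalHom.measurePreserving_flip (d := d)
  have hd := H.aemeasurable_density
  -- Since the density is only almost everywhere measurable, the change of variables is carried out
  -- with a measurable version, invariant almost everywhere.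
  set f' := hd.mk _
  have hf' : Measurable f' := hd.measurable_mk
  have hae : (fun p => ENNReal.ofReal (kern a μ p)) =ᵐ[(cellMeasure d).prod volume] f' := hd.ae_eq_mk
  have hinv : f' ∘ flip =ᵐ[(cellMeasure d).prod volume] f' := by
    filter_upwards [hae, hm.quasiMeasurePreserving.ae hae] with p h1 h2
    rw [Function.comp_apply, ← h2, ← h1, H.kern_flip]
  have hν : pairMeasure a μ = ((cellMeasure d).prod volume).withDensity f' :=
    withDensity_congr_ae hae
  refine ⟨hm.measurable, ?_⟩
  rw [hν]
  ext S hS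
  rw [Measure.map_apply hm.measurable hS, withDensity_apply _ (hm.measurable hS),
    withDensity_apply _ hS, ← hm.setLIntegral_comp_preimage hS hf']
  exact lintegral_congr_ae (ae_restrict_of_ae (hinv.mono fun p hp => hp.symm))

/-- The marginal has a density bounded by `μ₊∫a`, so functions in `L₂(Ω)` pull back boundedly to the
pair space. The flip gives the same for the second point. -/
theorem Coefficients.map_fst_le :
    (pairMeasure a μ).map Prod.fst ≤
      (ENNReal.ofReal μp * ∫⁻ z, ENNReal.ofReal (a z)) • cellMeasure d := by
  refine Measure.le_iff.2 fun S hS => ?_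
  rw [Measure.map_apply measurable_fst hS, pairMeasure, withDensity_apply _ (measurable_fst hS),
    Measure.smul_apply, smul_eq_mul, ← lintegral_indicator (measurable_fst hS)]
  calc _ ≤ ∫⁻ p : E d × E d, S.indicator 1 p.1 * (ENNReal.ofReal μp * ENNReal.ofReal (a p.2))
          ∂((cellMeasure d).prod volume) := by
        refine lintegral_mono fun p => ?_
        by_cases hp : p.1 ∈ S
        · rw [Set.indicator_of_mem (show p ∈ Prod.fst ⁻¹' S from hp), Set.indicator_of_mem hp,
            Pi.one_apply, one_mul, ← ENNReal.ofReal_mul H.upper_pos.le]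
          exact ENNReal.ofReal_le_ofReal (by rw [mul_comm]; exact H.kern_le p)
        · rw [Set.indicator_of_notMem (show p ∉ Prod.fst ⁻¹' S from hp)]
          exact zero_le
    _ = _ := by
        rw [lintegral_prod_mul (measurable_one.indicator hS).aemeasurable
          (H.integrable.1.aemeasurable.ennreal_ofReal.const_mul _),
          lintegral_indicator_one hS, lintegral_const_mul' _ _ ENNReal.ofReal_ne_top]
        ring

theorem Coefficients.density_const_ne_top :
    ENNReal.ofReal μp * ∫⁻ z, ENNReal.ofReal (a z) ≠ ⊤ := by
  refine ENNReal.mul_ne_top ENNReal.ofReal_ne_top ?_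
  exact (lintegral_ofReal_le_lintegral_enorm a).trans_lt H.integrable.2 |>.ne

theorem Coefficients.isFiniteMeasure : IsFiniteMeasure (pairMeasure a μ) := by
  refine ⟨?_⟩
  have h := Measure.le_iff.1 H.map_fst_le Set.univ .univ
  rw [Measure.map_apply measurable_fst .univ, Set.preimage_univ, Measure.smul_apply, smul_eq_mul,
    measure_univ (μ := cellMeasure d), mul_one] at h
  exact h.trans_lt H.density_const_ne_top.lt_top

theorem Coefficients.map_wrap_sub_le :
    (pairMeasure a μ).map (fun p => wrap (p.1 - p.2)) ≤
      (ENNReal.ofReal μp * ∫⁻ z, ENNReal.ofReal (a z)) • cellMeasure d := by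
  have : (fun p : E d × E d => wrap (p.1 - p.2)) = Prod.fst ∘ flip := rfl
  rw [this, ← Measure.map_map measurable_fst H.measurePreserving_flip.measurable,
    H.measurePreserving_flip.map_eq]
  exact H.map_fst_le

theorem Coefficients.quasi_fst :
    Measure.QuasiMeasurePreserving Prod.fst (pairMeasure a μ) (cellMeasure d) :=
  ⟨measurable_fst, (Measure.absolutelyContinuous_of_le H.map_fst_le).trans
    Measure.smul_absolutelyContinuous⟩

theorem Coefficients.quasi_wrap_sub :
    Measure.QuasiMeasurePreserving (fun p => wrap (p.1 - p.2)) (pairMeasure a μ) (cellMeasure d) :=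
  ⟨measurable_wrap_sub, (Measure.absolutelyContinuous_of_le H.map_wrap_sub_le).trans
    Measure.smul_absolutelyContinuous⟩

theorem Coefficients.ae_fst_mem_cell : ∀ᵐ p ∂(pairMeasure a μ), p.1 ∈ cell d :=
  H.quasi_fst.ae (ae_restrict_mem measurableSet_cell)

theorem Coefficients.ae_flip_flip : ∀ᵐ p ∂(pairMeasure a μ), flip (flip p) = p :=
  H.ae_fst_mem_cell.mono fun _ hp => flip_flip hp

theorem Coefficients.integrable_iff {G : Type*} [NormedAddCommGroup G] [NormedSpace ℝ G]
    (f : E d × E d → G) :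
    Integrable f (pairMeasure a μ) ↔
      Integrable (fun p => kern a μ p • f p) ((cellMeasure d).prod volume) := by
  rw [pairMeasure, integrable_withDensity_iff_integrable_smul₀' H.aemeasurable_density
    (.of_forall fun p => ENNReal.ofReal_lt_top)]
  simp only [ENNReal.toReal_ofReal (H.kern_nonneg _)]

theorem Coefficients.integral_eq {G : Type*} [NormedAddCommGroup G] [NormedSpace ℝ G]
    (f : E d × E d → G) :
    ∫ p, f p ∂(pairMeasure a μ) = ∫ p, kern a μ p • f p ∂((cellMeasure d).prod volume) := by
  rw [pairMeasure, integral_withDensity_eq_integral_toReal_smul₀ H.aemeasurable_density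
    (.of_forall fun p => ENNReal.ofReal_lt_top)]
  simp only [ENNReal.toReal_ofReal (H.kern_nonneg _)]

theorem Coefficients.integral_eq_iterated {G : Type*} [NormedAddCommGroup G] [NormedSpace ℝ G]
    {f : E d × E d → G} (hf : Integrable f (pairMeasure a μ)) :
    ∫ p, f p ∂(pairMeasure a μ) = ∫ x in cell d, ∫ z, kern a μ (x, z) • f (x, z) := by
  rw [H.integral_eq, integral_prod _ ((H.integrable_iff f).1 hf)]

theorem Coefficients.integral_flip {G : Type*} [NormedAddCommGroup G] [NormedSpace ℝ G]
    {f : E d × E d → G} (hf : AEStronglyMeasurable f (pairMeasure a μ)) :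
    ∫ p, f (flip p) ∂(pairMeasure a μ) = ∫ p, f p ∂(pairMeasure a μ) := by
  have h := H.measurePreserving_flip
  conv_rhs => rw [← h.map_eq]
  rw [integral_map h.measurable.aemeasurable (by rw [h.map_eq]; exact hf)]

theorem Coefficients.integrable_mul {w q : E d → ℝ} (hw : Integrable w (cellMeasure d))
    (hq : Integrable fun z => q z * a z) (hqm : Measurable q) :
    Integrable (fun p => w p.1 * q p.2) (pairMeasure a μ) := by
  rw [H.integrable_iff]
  refine ((hw.norm.mul_prod hq.norm).mul_const μp).mono'
    (H.aestronglyMeasurable_kern.mul (hw.1.comp_fst.mul (hqm.comp measurable_snd).aestronglyMeasurable))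
    (.of_forall fun p => ?_)
  rw [smul_eq_mul, norm_mul, Real.norm_of_nonneg (H.kern_nonneg p), norm_mul, norm_mul,
    Real.norm_of_nonneg (H.nonneg _)]
  calc kern a μ p * (‖w p.1‖ * ‖q p.2‖) ≤ a p.2 * μp * (‖w p.1‖ * ‖q p.2‖) := by
        gcongr
        exact H.kern_le p
    _ = _ := by ring

theorem Coefficients.integral_mul_le {w q : E d → ℝ} (hw : Integrable w (cellMeasure d))
    (hw0 : ∀ x, 0 ≤ w x) (hq : Integrable fun z => q z * a z) (hqm : Measurable q)
    (hq0 : ∀ z, 0 ≤ q z) :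
    ∫ p, w p.1 * q p.2 ∂(pairMeasure a μ) ≤ μp * (∫ z, q z * a z) * ∫ x in cell d, w x := by
  have hi := (H.integrable_iff _).1 (H.integrable_mul hw hq hqm)
  rw [H.integral_eq]
  calc _ ≤ ∫ p : E d × E d, w p.1 * (q p.2 * a p.2) * μp ∂((cellMeasure d).prod volume) := by
        refine integral_mono hi ((hw.mul_prod hq).mul_const μp) fun p => ?_
        have := H.kern_le p
        have h1 := mul_nonneg (hw0 p.1) (hq0 p.2)
        simp only [smul_eq_mul]
        calc kern a μ p * (w p.1 * q p.2) ≤ a p.2 * μp * (w p.1 * q p.2) := by gcongr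
          _ = _ := by ring
    _ = _ := by
        rw [integral_mul_const, integral_prod_mul w fun z => q z * a z]
        ring

end

end NonlocalHom

/-! ### Twisted differences and the fiber operator -/

namespace NonlocalHom

variable {d : ℕ}

/-- The factor `exp(-i⟨ξ,z⟩)`. -/
noncomputable def phase (ξ z : E d) : ℂ := Complex.exp (-Complex.I * ((inner ℝ ξ z : ℝ) : ℂ))

theorem phase_eq (ξ z : E d) : phase ξ z = Complex.exp ((-inner ℝ ξ z : ℝ) * Complex.I) := by
  rw [phase]
  congr 1
  push_cast
  ring

theorem norm_phase (ξ z : E d) : ‖phase ξ z‖ = 1 := by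
  rw [phase_eq, Complex.norm_exp_ofReal_mul_I]

theorem conj_phase (ξ z : E d) : (starRingEnd ℂ) (phase ξ z) = phase ξ (-z) := by
  rw [phase_eq, phase_eq, ← Complex.exp_conj, map_mul, Complex.conj_ofReal, Complex.conj_I,
    inner_neg_right]
  push_cast
  ring_nf

theorem phase_mul_phase_neg (ξ z : E d) : phase ξ z * phase ξ (-z) = 1 := by
  rw [← conj_phase, Complex.mul_conj, Complex.normSq_eq_norm_sq, norm_phase]
  simp

@[simp] theorem phase_zero_left (z : E d) : phase 0 z = 1 := by simp [phase]

theorem continuous_phase (ξ : E d) : Continuous (phase ξ) := by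
  unfold phase
  fun_prop

/-- The twisted difference `u(x) - exp(-i⟨ξ,z⟩) u(x-z)` of a periodic function. -/
noncomputable def twistedDiff (ξ : E d) (u : E d → ℂ) (p : E d × E d) : ℂ :=
  u p.1 - phase ξ p.2 * u (wrap (p.1 - p.2))

/-- Interchanging the points changes the sign and multiplies by a unimodular factor, which cancels
in sesquilinear expressions. -/
theorem twistedDiff_flip (ξ : E d) (u : E d → ℂ) {p : E d × E d} (hp : flip (flip p) = p) :
    twistedDiff ξ u (flip p) = -phase ξ (-p.2) * twistedDiff ξ u p := by
  have h1 : wrap ((flip p).1 - (flip p).2) = p.1 := congrArg Prod.fst hp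
  rw [twistedDiff, h1]
  have h2 := phase_mul_phase_neg ξ p.2
  simp only [flip, twistedDiff]
  linear_combination (-u (wrap (p.1 - p.2))) * h2

section

variable {a : E d → ℝ} {μ : E d → E d → ℝ} {μm μp : ℝ} (H : Coefficients a μ μm μp)

include H

theorem Coefficients.memLp_fst {G : Type*} [NormedAddCommGroup G] {w : E d → G} {q : ENNReal}
    (hw : MemLp w q (cellMeasure d)) : MemLp (fun p => w p.1) q (pairMeasure a μ) :=
  (hw.of_measure_le_smul H.density_const_ne_top H.map_fst_le).comp_of_map
    measurable_fst.aemeasurable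

theorem Coefficients.memLp_wrap_sub {G : Type*} [NormedAddCommGroup G] {w : E d → G} {q : ENNReal}
    (hw : MemLp w q (cellMeasure d)) :
    MemLp (fun p => w (wrap (p.1 - p.2))) q (pairMeasure a μ) :=
  (hw.of_measure_le_smul H.density_const_ne_top H.map_wrap_sub_le).comp_of_map
    measurable_wrap_sub.aemeasurable

theorem Coefficients.memLp_phase_mul (ξ : E d) {w : E d → ℂ} {q : ENNReal}
    (hw : MemLp w q (cellMeasure d)) :
    MemLp (fun p => phase ξ p.2 * w (wrap (p.1 - p.2))) q (pairMeasure a μ) := by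
  refine (H.memLp_wrap_sub hw).of_le ((continuous_phase ξ).measurable.comp
    measurable_snd |>.aestronglyMeasurable.mul (H.memLp_wrap_sub hw).1) (.of_forall fun p => ?_)
  rw [norm_mul, norm_phase, one_mul]

theorem Coefficients.memLp_twistedDiff (ξ : E d) {u : E d → ℂ} {q : ENNReal}
    (hu : MemLp u q (cellMeasure d)) : MemLp (twistedDiff ξ u) q (pairMeasure a μ) :=
  (H.memLp_fst hu).sub (H.memLp_phase_mul ξ hu)

theorem Coefficients.twistedDiff_congr (ξ : E d) {u w : E d → ℂ} (h : u =ᵐ[cellMeasure d] w) :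
    twistedDiff ξ u =ᵐ[pairMeasure a μ] twistedDiff ξ w := by
  filter_upwards [H.quasi_fst.ae h, H.quasi_wrap_sub.ae h] with p h1 h2
  rw [twistedDiff, twistedDiff, h1, h2]

/-- The symmetrized form of `𝔸(ξ)` equals the plain one. -/
theorem Coefficients.half_integral_conj_mul (ξ : E d) {u w : E d → ℂ}
    (hu : MemLp u 2 (cellMeasure d)) (hw : MemLp w 2 (cellMeasure d)) :
    (1 / 2 : ℂ) * ∫ p, (starRingEnd ℂ) (twistedDiff ξ w p) * twistedDiff ξ u p ∂(pairMeasure a μ) =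
      ∫ p, (starRingEnd ℂ) (w p.1) * twistedDiff ξ u p ∂(pairMeasure a μ) := by
  have hD := H.memLp_twistedDiff ξ hu
  have hw1 : MemLp (fun p : E d × E d => (starRingEnd ℂ) (w p.1)) 2 (pairMeasure a μ) :=
    (H.memLp_fst hw).star
  have hw2 : MemLp (fun p : E d × E d => (starRingEnd ℂ) (phase ξ p.2 * w (wrap (p.1 - p.2)))) 2
      (pairMeasure a μ) := (H.memLp_phase_mul ξ hw).star
  have h1 : Integrable (fun p => (starRingEnd ℂ) (w p.1) * twistedDiff ξ u p) (pairMeasure a μ) :=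
    hw1.integrable_mul hD
  have h2 : Integrable (fun p => (starRingEnd ℂ) (phase ξ p.2 * w (wrap (p.1 - p.2))) *
      twistedDiff ξ u p) (pairMeasure a μ) := hw2.integrable_mul hD
  -- The change of variables by the flip carries the part with `w` at the second point into minus
  -- the part with `w` at the first.
  have h3 : ∫ p, (starRingEnd ℂ) (phase ξ p.2 * w (wrap (p.1 - p.2))) *
      twistedDiff ξ u p ∂(pairMeasure a μ) =
      -∫ p, (starRingEnd ℂ) (w p.1) * twistedDiff ξ u p ∂(pairMeasure a μ) := by
    rw [← H.integral_flip h2.1, ← integral_neg]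
    refine integral_congr_ae ?_
    filter_upwards [H.ae_flip_flip] with p hp
    have h1 : wrap ((flip p).1 - (flip p).2) = p.1 := congrArg Prod.fst hp
    rw [twistedDiff_flip ξ u hp, h1, map_mul, conj_phase]
    simp only [flip, neg_neg]
    have h2 := phase_mul_phase_neg ξ p.2
    linear_combination (-(starRingEnd ℂ) (w p.1) * twistedDiff ξ u p) * h2
  have h4 : ∀ p, (starRingEnd ℂ) (twistedDiff ξ w p) * twistedDiff ξ u p =
      (starRingEnd ℂ) (w p.1) * twistedDiff ξ u p -
      (starRingEnd ℂ) (phase ξ p.2 * w (wrap (p.1 - p.2))) * twistedDiff ξ u p := by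
    intro p
    conv_lhs => rw [twistedDiff, map_sub]
    ring
  simp only [h4]
  rw [integral_sub h1 h2, h3]
  ring

/-- The pointwise formula for the fiber operator through the pair measure. -/
theorem Coefficients.ae_integral_twistedDiff (ξ : E d) {u : E d → ℂ}
    (hu : MemLp u 2 (cellMeasure d)) :
    ∀ᵐ x ∂(cellMeasure d),
      ∫ z, kern a μ (x, z) • twistedDiff ξ u (x, z) = fiberFun a μ ξ u x := by
  have := H.isFiniteMeasure
  have hu1 : MemLp u 1 (cellMeasure d) := hu.mono_exponent (by norm_num)
  have i1 := ((H.integrable_iff _).1 (memLp_one_iff_integrable.1 (H.memLp_fst hu1))).prod_right_ae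
  have i2 := ((H.integrable_iff _).1
    (memLp_one_iff_integrable.1 (H.memLp_phase_mul ξ hu1))).prod_right_ae
  filter_upwards [i1, i2, ae_restrict_mem measurableSet_cell] with x h1 h2 hx
  have hsplit : ∀ z, kern a μ (x, z) • twistedDiff ξ u (x, z) = kern a μ (x, z) • u x -
      kern a μ (x, z) • (phase ξ z * u (wrap (x - z))) := fun z => by
    rw [twistedDiff, smul_sub]
  simp only [hsplit]
  rw [integral_sub h1 h2, fiberFun]
  congr 1
  · rw [integral_smul_const, Complex.real_smul, potential]
    congr 2
    rw [← integral_sub_left_eq_self (fun y => a (x - y) * μ x y) volume x]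
    simp only [sub_sub_cancel, kern]
  · have e1 : ∀ y, kern a μ (x, x - y) • (phase ξ (x - y) * u (wrap (x - (x - y)))) =
        (a (x - y) : ℂ) * phase ξ (x - y) * (μ x y : ℂ) * u (wrap y) := by
      intro y
      simp only [kern, sub_sub_cancel, Complex.real_smul]
      push_cast
      ring
    have h3 := h2.comp_sub_left x
    simp only [e1] at h3
    rw [← integral_sub_left_eq_self (fun z => kern a μ (x, z) • (phase ξ z * u (wrap (x - z))))
      volume x]
    simp only [e1]
    -- Summation over the lattice cells assembles the Bloch kernel, as `u` and `μ(x,·)` are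
    -- periodic.
    rw [← integral_tsum_translates h3]
    refine setIntegral_congr_fun measurableSet_cell fun y hy => ?_
    simp only [wrap_add_lat, wrap_eq_self hy]
    have hμ : ∀ n : Fin d → ℤ, μ x (y + lat n) = μ x y := fun n => by
      have := H.periodic x y 0 n
      rwa [show lat (0 : Fin d → ℤ) = 0 from (latHom d).map_zero, add_zero] at this
    simp only [hμ, tsum_mul_right]
    congr 2
    rw [blochKernel, ← (Equiv.neg (Fin d → ℤ)).tsum_eq]
    refine tsum_congr fun n => ?_
    rw [Equiv.neg_apply, lat_neg, sub_add_eq_sub_sub, sub_neg_eq_add]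
    rfl

/-- The fiber operator as a bounded operator. -/
theorem Coefficients.exists_fiberOp (ξ : E d) :
    ∃ A : L2 d →L[ℂ] L2 d,
      (∀ u w : L2 d, inner ℂ w (A u) =
        ∫ p, (starRingEnd ℂ) (w p.1) * twistedDiff ξ u p ∂(pairMeasure a μ)) ∧
      (∀ u h, FiberGraph a μ ξ u h ↔ h = A u) := by
  have := H.isFiniteMeasure
  obtain ⟨T₀, hT₀⟩ := exists_pullback measurable_fst H.density_const_ne_top H.map_fst_le
    (m := fun _ => 1) aestronglyMeasurable_const (by simp)
  obtain ⟨T₁, hT₁⟩ := exists_pullback measurable_wrap_sub H.density_const_ne_top H.map_wrap_sub_le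
    (m := fun p => phase ξ p.2)
    ((continuous_phase ξ).measurable.comp measurable_snd).aestronglyMeasurable
    fun p => (norm_phase ξ p.2).le
  set J := T₀ - T₁
  have hJ : ∀ u, J u =ᵐ[pairMeasure a μ] twistedDiff ξ u := by
    intro u
    have h0 : J u = T₀ u - T₁ u := rfl
    rw [h0]
    filter_upwards [Lp.coeFn_sub (T₀ u) (T₁ u), hT₀ u, hT₁ u] with p h1 h2 h3
    rw [h1, Pi.sub_apply, h2, h3, twistedDiff, one_mul]
  -- With `J` the twisted difference, `½ J*J` is bounded, symmetric and nonnegative by construction.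
  -- It remains to identify it with the integral formula.
  set A : L2 d →L[ℂ] L2 d := (1 / 2 : ℂ) • (ContinuousLinearMap.adjoint J).comp J
  have hform : ∀ u w : L2 d, inner ℂ w (A u) =
      ∫ p, (starRingEnd ℂ) (w p.1) * twistedDiff ξ u p ∂(pairMeasure a μ) := by
    intro u w
    rw [← H.half_integral_conj_mul ξ (Lp.memLp u) (Lp.memLp w)]
    show inner ℂ w ((1 / 2 : ℂ) • (ContinuousLinearMap.adjoint J) (J u)) = _
    rw [inner_smul_right, ContinuousLinearMap.adjoint_inner_right, L2.inner_def]
    congr 1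
    refine integral_congr_ae ?_
    filter_upwards [hJ u, hJ w] with p h1 h2
    rw [h1, h2]
    simp [mul_comm]
  have hae : ∀ u : L2 d, (A u : E d → ℂ) =ᵐ[cellMeasure d] fiberFun a μ ξ u := by
    intro u
    have hpt := H.ae_integral_twistedDiff ξ (Lp.memLp u)
    have hDi : Integrable (twistedDiff ξ u) (pairMeasure a μ) :=
      (H.memLp_twistedDiff ξ (Lp.memLp u)).integrable (by norm_num)
    have hfi : Integrable (fiberFun a μ ξ u) (cellMeasure d) :=
      ((H.integrable_iff _).1 hDi).integral_prod_left.congr hpt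
    -- The pointwise formula is at this stage known only to be integrable, so the two functions are
    -- compared through their integrals over measurable sets.
    refine Integrable.ae_eq_of_forall_setIntegral_eq _ _
      ((Lp.memLp (A u)).integrable (by norm_num)) hfi fun S hS _ => ?_
    have hind : MemLp (S.indicator fun _ => (1 : ℂ)) 2 (cellMeasure d) :=
      memLp_indicator_const 2 hS 1 (Or.inr (measure_ne_top _ _))
    have h1 := hform u (hind.toLp _)
    rw [inner_eq_integral] at h1
    have h2 : ∫ x in cell d, (starRingEnd ℂ) (hind.toLp _ x) * A u x = ∫ x in S, A u x ∂(cellMeasure d) := by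
      rw [← integral_indicator hS]
      refine integral_congr_ae ?_
      filter_upwards [hind.coeFn_toLp] with x hx
      rw [hx]
      by_cases h : x ∈ S <;> simp [h]
    rw [← h2, h1]
    have hpre : MeasurableSet (Prod.fst ⁻¹' S : Set (E d × E d)) := measurable_fst hS
    have h3 : ∫ p, (starRingEnd ℂ) (hind.toLp _ p.1) * twistedDiff ξ u p ∂(pairMeasure a μ) =
        ∫ p, (Prod.fst ⁻¹' S).indicator (twistedDiff ξ u) p ∂(pairMeasure a μ) := by
      refine integral_congr_ae ?_
      filter_upwards [H.quasi_fst.ae hind.coeFn_toLp] with p hp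
      rw [hp]
      by_cases h : p.1 ∈ S <;> simp [h]
    rw [h3, H.integral_eq_iterated (hDi.indicator hpre), ← integral_indicator hS]
    refine integral_congr_ae ?_
    filter_upwards [hpt] with x hx
    by_cases h : x ∈ S
    · simp only [Set.indicator_of_mem h, ← hx]
      refine integral_congr_ae (.of_forall fun z => ?_)
      simp [Set.indicator, h]
    · simp [Set.indicator, h]
  refine ⟨A, hform, fun u h => ⟨fun hg => Lp.ext (hg.trans (hae u).symm), ?_⟩⟩
  rintro rfl
  exact hae u

end

end NonlocalHom

/-! ### Coercivity and the spectral gap -/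

namespace NonlocalHom

variable {d : ℕ}

theorem phase_mul_expo (ξ : E d) (n : Fin d → ℤ) (z : E d) :
    phase ξ z * expo (-n) z = phase (freq ξ n) z := by
  rw [phase_eq, phase_eq, expo, ← Complex.exp_add, ← add_mul, ← Complex.ofReal_add]
  congr 3
  simp only [PiLp.inner_apply, freq_apply, RCLike.inner_apply, conj_trivial, Pi.neg_apply,
    Finset.mul_sum, ← Finset.sum_neg_distrib, ← Finset.sum_add_distrib]
  refine Finset.sum_congr rfl fun j _ => ?_
  push_cast
  ring

theorem norm_one_sub_phase_sq (η z : E d) :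
    ‖1 - phase η z‖ ^ 2 = 2 * (1 - Real.cos (inner ℝ z η)) := by
  rw [phase_eq, ← Complex.normSq_eq_norm_sq, Complex.normSq_apply]
  simp only [Complex.sub_re, Complex.sub_im, Complex.one_re, Complex.one_im,
    Complex.exp_ofReal_mul_I_re, Complex.exp_ofReal_mul_I_im, Real.cos_neg, Real.sin_neg]
  rw [real_inner_comm]
  nlinarith [Real.sin_sq_add_cos_sq (inner ℝ z η)]

theorem norm_sq_eq_integral (u : L2 d) : ‖u‖ ^ 2 = ∫ x in cell d, ‖u x‖ ^ 2 := by
  have h := inner_eq_integral u u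
  rw [inner_self_eq_norm_sq_to_K] at h
  simp only [mul_comm _ (u _), Complex.mul_conj, Complex.normSq_eq_norm_sq] at h
  have h6 := integral_ofReal (𝕜 := ℂ) (μ := cellMeasure d) (f := fun x => ‖u x‖ ^ 2)
  refine Complex.ofReal_injective (Eq.trans ?_ (h.trans h6))
  exact Complex.ofReal_pow _ _

theorem integral_comp_wrap_sub {f : E d → ℂ} (z : E d)
    (hf : AEStronglyMeasurable f (cellMeasure d)) :
    ∫ x in cell d, f (wrap (x - z)) = ∫ x in cell d, f x := by
  have hm := measurePreserving_wrap_sub (d := d) z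
  rw [← integral_map (f := f) hm.measurable.aemeasurable (by rwa [hm.map_eq]), hm.map_eq]

/-- Bessel's inequality for the twisted difference by a fixed vector. -/
theorem sum_coef_le_integral_twistedDiff (ξ : E d) (u : L2 d) (z : E d) (s : Finset (Fin d → ℤ)) :
    ∑ n ∈ s, 2 * (1 - Real.cos (inner ℝ z (freq ξ n))) * ‖coef u n‖ ^ 2 ≤
      ∫ x in cell d, ‖twistedDiff ξ u (x, z)‖ ^ 2 := by
  have hT : MemLp (fun x => u (wrap (x - z))) 2 (cellMeasure d) :=
    (Lp.memLp u).comp_measurePreserving (measurePreserving_wrap_sub z)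
  have hD : MemLp (fun x => twistedDiff ξ u (x, z)) 2 (cellMeasure d) :=
    (Lp.memLp u).sub (hT.const_mul (phase ξ z))
  -- For fixed `z` the twisted difference is a Fourier multiplier. Its squared modulus `2(1 -
  -- cos⟨z,ξ+2πn⟩)` integrates against `a` to twice the symbol.
  have hcoef : ∀ n, coef (hD.toLp _) n = (1 - phase (freq ξ n) z) * coef u n := by
    intro n
    have hi : ∀ {w : E d → ℂ}, MemLp w 2 (cellMeasure d) →
        Integrable (fun x => expo (-n) x * w x) (cellMeasure d) := fun hw =>
      (memLp_expo (-n)).integrable_mul hw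
    have h1 : coef (hD.toLp _) n =
        ∫ x in cell d, (expo (-n) x * u x - phase ξ z * (expo (-n) x * u (wrap (x - z)))) := by
      rw [coef_eq_integral]
      refine integral_congr_ae ?_
      filter_upwards [hD.coeFn_toLp] with x hx
      rw [hx, twistedDiff]
      ring
    have h2 : ∫ x in cell d, expo (-n) x * u (wrap (x - z)) = expo (-n) z * coef u n := by
      have h3 : ∀ x, expo (-n) x * u (wrap (x - z)) =
          expo (-n) z * (expo (-n) (wrap (x - z)) * u (wrap (x - z))) := fun x => by
        rw [expo_wrap, ← mul_assoc, ← expo_add, add_sub_cancel]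
      simp only [h3]
      rw [integral_const_mul, coef_eq_integral,
        integral_comp_wrap_sub (f := fun x => expo (-n) x * u x) z (hi (Lp.memLp u)).1]
    rw [h1, integral_sub (hi (Lp.memLp u)) ((hi hT).const_mul _), integral_const_mul, h2,
      ← coef_eq_integral, ← phase_mul_expo]
    ring
  have h4 : ‖hD.toLp _‖ ^ 2 = ∫ x in cell d, ‖twistedDiff ξ u (x, z)‖ ^ 2 := by
    rw [norm_sq_eq_integral]
    refine integral_congr_ae ?_
    filter_upwards [hD.coeFn_toLp] with x hx
    rw [hx]
  rw [← h4]
  refine le_trans (Finset.sum_le_sum fun n _ => ?_)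
    (sum_le_hasSum s (fun n _ => sq_nonneg _) (hasSum_norm_sq_coef (hD.toLp _)))
  rw [hcoef, norm_mul, mul_pow, norm_one_sub_phase_sq]

section

variable {a : E d → ℝ} {μ : E d → E d → ℝ} {μm μp : ℝ} (H : Coefficients a μ μm μp)

include H

theorem Coefficients.integrable_norm_twistedDiff_sq (ξ : E d) {u : E d → ℂ}
    (hu : MemLp u 2 (cellMeasure d)) :
    Integrable (fun p => ‖twistedDiff ξ u p‖ ^ 2) (pairMeasure a μ) :=
  (memLp_two_iff_integrable_sq_norm (H.memLp_twistedDiff ξ hu).1).1 (H.memLp_twistedDiff ξ hu)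

/-- Coercivity of the form of `𝔸(ξ)` on a span of exponentials. -/
theorem Coefficients.coercive (ξ : E d) (u : L2 d) {α : ℝ}
    (hα : ∀ n, coef u n ≠ 0 → α ≤ symbol a (freq ξ n)) :
    μm * α * ‖u‖ ^ 2 ≤ 1 / 2 * ∫ p, ‖twistedDiff ξ u p‖ ^ 2 ∂(pairMeasure a μ) := by
  have hi := (H.integrable_iff _).1 (H.integrable_norm_twistedDiff_sq ξ (Lp.memLp u))
  have hum := Lp.stronglyMeasurable u
  have hDm : StronglyMeasurable (twistedDiff ξ u) :=
    (hum.comp_measurable measurable_fst).sub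
      ((((continuous_phase ξ).measurable.comp measurable_snd).stronglyMeasurable).mul
        (hum.comp_measurable measurable_wrap_sub))
  have hle : ∀ p, ‖a p.2 * ‖twistedDiff ξ u p‖ ^ 2‖ ≤
      μm⁻¹ * (kern a μ p • ‖twistedDiff ξ u p‖ ^ 2) := by
    intro p
    have h1 := H.le_kern p
    have h0 := H.lower_pos
    rw [Real.norm_of_nonneg (mul_nonneg (H.nonneg _) (sq_nonneg _)), smul_eq_mul, ← mul_assoc]
    gcongr
    rw [inv_mul_eq_div, le_div_iff₀ h0]
    exact h1
  have hi2 : Integrable (fun p : E d × E d => a p.2 * ‖twistedDiff ξ u p‖ ^ 2)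
      ((cellMeasure d).prod volume) :=
    (hi.const_mul μm⁻¹).mono' (H.integrable.1.comp_snd.mul
      (hDm.norm.pow 2).aestronglyMeasurable) (.of_forall hle)
  have hlow : μm * ∫ z, a z * ∫ x in cell d, ‖twistedDiff ξ u (x, z)‖ ^ 2 ≤
      ∫ p, ‖twistedDiff ξ u p‖ ^ 2 ∂(pairMeasure a μ) := by
    rw [H.integral_eq]
    have h1 : ∫ z, a z * ∫ x in cell d, ‖twistedDiff ξ u (x, z)‖ ^ 2 =
        ∫ p : E d × E d, a p.2 * ‖twistedDiff ξ u p‖ ^ 2 ∂((cellMeasure d).prod volume) := by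
      rw [integral_prod_symm _ hi2]
      simp only [integral_const_mul]
    rw [h1, ← integral_const_mul]
    refine integral_mono (hi2.const_mul _) hi fun p => ?_
    have := hle p
    have h0 := H.lower_pos
    rw [inv_mul_eq_div, le_div_iff₀ h0] at this
    rw [mul_comm]
    exact (mul_le_mul_of_nonneg_right (le_abs_self _) h0.le).trans this
  -- Bessel's inequality on finite sets of modes, followed by a limit, avoids interchanging an
  -- infinite sum with the integral over `z`.
  have hsum : ∀ s : Finset (Fin d → ℤ), ∑ n ∈ s, 2 * (μm * α) * ‖coef u n‖ ^ 2 ≤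
      ∫ p, ‖twistedDiff ξ u p‖ ^ 2 ∂(pairMeasure a μ) := by
    intro s
    refine le_trans ?_ hlow
    have hin : ∀ n, Integrable fun z => a z * (2 * (1 - Real.cos (inner ℝ z (freq ξ n))) *
        ‖coef u n‖ ^ 2) := fun n => by
      refine ((integrable_one_sub_cos_mul H.integrable (freq ξ n)).const_mul
        (2 * ‖coef u n‖ ^ 2)).congr (.of_forall fun z => ?_)
      ring
    have h1 : ∫ z, ∑ n ∈ s, a z * (2 * (1 - Real.cos (inner ℝ z (freq ξ n))) * ‖coef u n‖ ^ 2) ≤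
        ∫ z, a z * ∫ x in cell d, ‖twistedDiff ξ u (x, z)‖ ^ 2 := by
      refine integral_mono (integrable_finsetSum _ fun n _ => hin n) ?_ fun z => ?_
      · refine hi2.integral_prod_right.congr (.of_forall fun z => ?_)
        simp only [integral_const_mul]
      · rw [← Finset.mul_sum]
        exact mul_le_mul_of_nonneg_left (sum_coef_le_integral_twistedDiff ξ u z s) (H.nonneg z)
    have h2 : ∀ n, ∫ z, a z * (2 * (1 - Real.cos (inner ℝ z (freq ξ n))) * ‖coef u n‖ ^ 2) =
        2 * ‖coef u n‖ ^ 2 * symbol a (freq ξ n) := fun n => by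
      rw [symbol, ← integral_const_mul]
      congr 1 with z
      ring
    rw [integral_finsetSum _ fun n _ => hin n] at h1
    simp only [h2] at h1
    refine le_trans ?_ (mul_le_mul_of_nonneg_left h1 H.lower_pos.le)
    rw [Finset.mul_sum]
    refine Finset.sum_le_sum fun n _ => ?_
    by_cases h : coef u n = 0
    · simp [h]
    · have := mul_le_mul_of_nonneg_left (hα n h)
        (mul_nonneg H.lower_pos.le (sq_nonneg ‖coef u n‖))
      linarith
  have h := le_of_tendsto ((hasSum_norm_sq_coef u).mul_left (2 * (μm * α)))
    (.of_forall hsum)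
  linarith

end

/-- A lower bound for `symbol a y / ‖ξ‖²` at the frequencies `y = ξ + 2πn`. -/
noncomputable def lowerConst (a : E d → ℝ) : ℝ :=
  min (secondMin a / 4)
    (min (symbolInf a (radius a) / (d * Real.pi ^ 2)) (symbolInf a Real.pi / (d * Real.pi ^ 2)))

section

variable {a : E d → ℝ} {μ : E d → E d → ℝ} {μm μp : ℝ} (H : Coefficients a μ μm μp)
  (h4 : Integrable fun x => ‖x‖ ^ 4 * a x) (hd : 1 ≤ d)

include H h4 hd

theorem Coefficients.radius_pos : 0 < radius a := by
  have h1 := secondMin_pos hd H.integrable H.nonneg H.integral_pos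
    (integrable_pow_mul H.integrable h4 (by norm_num : 2 ≤ 4))
  have h2 := moment_pos hd H.nonneg H.integral_pos
    (integrable_pow_mul H.integrable h4 (by norm_num : 3 ≤ 4))
  rw [radius]
  positivity

theorem Coefficients.lowerConst_pos : 0 < lowerConst a := by
  have h0 : (0 : ℝ) < d := by exact_mod_cast hd
  have h1 := secondMin_pos hd H.integrable H.nonneg H.integral_pos
    (integrable_pow_mul H.integrable h4 (by norm_num : 2 ≤ 4))
  have h2 := symbolInf_pos hd H.integrable H.nonneg H.integral_pos (H.radius_pos h4 hd)
  have h3 := symbolInf_pos hd H.integrable H.nonneg H.integral_pos Real.pi_pos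
  refine lt_min (by positivity) (lt_min (by positivity) (by positivity))

/-- For `n = 0` and `|ξ| ≤ r(a)` the quadratic bound near the origin applies. In the other cases the
symbol is bounded below by a positive constant, comparable with `|ξ|²` because `|ξ|² ≤ dπ²`. -/
theorem Coefficients.lowerConst_mul_le_symbol {ξ : E d} (hξ : ξ ∈ dualCell d) (n : Fin d → ℤ) :
    lowerConst a * ‖ξ‖ ^ 2 ≤ symbol a (freq ξ n) := by
  have h0 : (0 : ℝ) < d := by exact_mod_cast hd
  have hsq := norm_sq_le_of_mem_dualCell hξ
  have hlow : ∀ r y, 0 < r → r ≤ ‖y‖ → lowerConst a ≤ symbolInf a r / (d * Real.pi ^ 2) →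
      lowerConst a * ‖ξ‖ ^ 2 ≤ symbol a y := by
    intro r y hr hy hl
    have h1 := symbolInf_le (d := d) H.nonneg hy
    rw [le_div_iff₀ (by positivity)] at hl
    have := H.lowerConst_pos h4 hd
    nlinarith
  by_cases hn : n = 0
  · subst hn
    rw [freq_zero]
    rcases le_total ‖ξ‖ (radius a) with h | h
    · refine le_trans ?_ (symbol_lower_near H.integrable H.nonneg
        (integrable_pow_mul H.integrable h4 (by norm_num : 2 ≤ 4))
        (integrable_pow_mul H.integrable h4 (by norm_num : 3 ≤ 4)) ?_ h)
      · exact mul_le_mul_of_nonneg_right (min_le_left _ _) (sq_nonneg _)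
      · exact moment_pos hd H.nonneg H.integral_pos
          (integrable_pow_mul H.integrable h4 (by norm_num : 3 ≤ 4))
    · exact hlow _ _ (H.radius_pos h4 hd) h ((min_le_right _ _).trans (min_le_left _ _))
  · exact hlow _ _ Real.pi_pos (pi_le_norm_freq hξ hn) ((min_le_right _ _).trans (min_le_right _ _))

theorem Coefficients.coercive_norm_sq {ξ : E d} (hξ : ξ ∈ dualCell d) (u : L2 d) :
    μm * lowerConst a * ‖ξ‖ ^ 2 * ‖u‖ ^ 2 ≤
      1 / 2 * ∫ p, ‖twistedDiff ξ u p‖ ^ 2 ∂(pairMeasure a μ) := by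
  rw [mul_assoc μm]
  exact H.coercive ξ u fun n _ => H.lowerConst_mul_le_symbol h4 hd hξ n

omit h4 hd in
theorem Coefficients.coercive_gap {ξ : E d} (hξ : ξ ∈ dualCell d) {u : L2 d} (hu : coef u 0 = 0) :
    μm * symbolInf a Real.pi * ‖u‖ ^ 2 ≤
      1 / 2 * ∫ p, ‖twistedDiff ξ u p‖ ^ 2 ∂(pairMeasure a μ) := by
  refine H.coercive ξ u fun n hn => symbolInf_le H.nonneg (pi_le_norm_freq hξ ?_)
  rintro rfl
  exact hn hu

end

end NonlocalHom

/-! ### The auxiliary problems: weak form and solvability -/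

namespace NonlocalHom

variable {d : ℕ}

/-- The difference `v(x) - v(x-z)` of a periodic function. -/
noncomputable def pdiff (v : E d → ℝ) (p : E d × E d) : ℝ := v p.1 - v (wrap (p.1 - p.2))

/-- The auxiliary equation in the direction `ξ`, for functions on the cell. -/
def SolvesAux (a : E d → ℝ) (μ : E d → E d → ℝ) (ξ : E d) (v : E d → ℝ) : Prop :=
  ∀ᵐ x ∂(cellMeasure d), ∫ z, kern a μ (x, z) * (pdiff v (x, z) - inner ℝ ξ z) = 0

theorem inner_single_one (j : Fin d) (z : E d) :
    inner ℝ (EuclideanSpace.single j (1 : ℝ)) z = z j := by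
  simp [EuclideanSpace.inner_single_left]

theorem inner_eq_sum_mul (ξ z : E d) : inner ℝ ξ z = ∑ j, ξ j * z j := by
  simp [PiLp.inner_apply, mul_comm]

section

variable {a : E d → ℝ} {μ : E d → E d → ℝ} {μm μp : ℝ} (H : Coefficients a μ μm μp)

include H

theorem Coefficients.memLp_pdiff {v : E d → ℝ} {q : ENNReal} (hv : MemLp v q (cellMeasure d)) :
    MemLp (pdiff v) q (pairMeasure a μ) := (H.memLp_fst hv).sub (H.memLp_wrap_sub hv)

theorem Coefficients.integrable_kern_pdiff {v : E d → ℝ} (hv : MemLp v 2 (cellMeasure d)) :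
    Integrable (fun p => kern a μ p * pdiff v p) ((cellMeasure d).prod volume) := by
  have := H.isFiniteMeasure
  exact (H.integrable_iff _).1 ((H.memLp_pdiff hv).integrable (by norm_num))

theorem Coefficients.integrable_norm_pow {k : ℕ} (hk : Integrable fun x => ‖x‖ ^ k * a x) :
    Integrable (fun p => ‖p.2‖ ^ k) (pairMeasure a μ) := by
  simpa using H.integrable_mul (w := fun _ => 1) (q := fun z => ‖z‖ ^ k) (integrable_const _) hk
    (by fun_prop)

theorem Coefficients.integrable_inner (h1 : Integrable fun x => ‖x‖ ^ 1 * a x) (ξ : E d) :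
    Integrable (fun p => (inner ℝ ξ p.2 : ℝ)) (pairMeasure a μ) := by
  refine ((H.integrable_norm_pow h1).const_mul ‖ξ‖).mono'
    (by fun_prop) (.of_forall fun p => ?_)
  simpa using norm_inner_le_norm (𝕜 := ℝ) ξ p.2

theorem Coefficients.memLp_inner (h2 : Integrable fun x => ‖x‖ ^ 2 * a x) (ξ : E d) :
    MemLp (fun p => (inner ℝ ξ p.2 : ℝ)) 2 (pairMeasure a μ) := by
  rw [memLp_two_iff_integrable_sq
    (by fun_prop : Continuous fun p : E d × E d => (inner ℝ ξ p.2 : ℝ)).aestronglyMeasurable]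
  refine ((H.integrable_norm_pow h2).const_mul (‖ξ‖ ^ 2)).mono'
    (by fun_prop) (.of_forall fun p => ?_)
  rw [norm_pow, ← mul_pow]
  gcongr
  exact norm_inner_le_norm ξ p.2

theorem Coefficients.integral_flip_neg {f : E d × E d → ℝ}
    (hf : AEStronglyMeasurable f (pairMeasure a μ))
    (h : ∀ᵐ p ∂(pairMeasure a μ), f (flip p) = -f p) :
    ∫ p, f p ∂(pairMeasure a μ) = 0 := by
  have h1 := H.integral_flip hf
  rw [integral_congr_ae h, integral_neg] at h1
  linarith

theorem Coefficients.solvesAux_of_isCellSolution (h1 : Integrable fun x => ‖x‖ ^ 1 * a x)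
    {v : Fin d → E d → ℝ} (hv : IsCellSolution a μ v) (ξ : E d) :
    SolvesAux a μ ξ fun x => ∑ j, ξ j * v j x := by
  have i1 : ∀ j, ∀ᵐ x ∂(cellMeasure d), Integrable fun z => kern a μ (x, z) * pdiff (v j) (x, z) :=
    fun j => (H.integrable_kern_pdiff (hv.memLp j)).prod_right_ae
  have i2 : ∀ j, ∀ᵐ x ∂(cellMeasure d), Integrable fun z : E d => kern a μ (x, z) * z j := by
    intro j
    have := ((H.integrable_iff _).1 (H.integrable_inner h1
      (EuclideanSpace.single j 1))).prod_right_ae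
    simpa only [inner_single_one, smul_eq_mul] using this
  filter_upwards [ae_all_iff.2 i1, ae_all_iff.2 i2, ae_all_iff.2 hv.equation] with x h1 h2 h3
  have h4 : ∀ j, ∫ z, kern a μ (x, z) * pdiff (v j) (x, z) = ∫ z, kern a μ (x, z) * z j := by
    intro j
    rw [← integral_sub_left_eq_self _ volume x, ← integral_sub_left_eq_self
      (fun z : E d => kern a μ (x, z) * z j) volume x]
    have h5 : ∀ y, v j (wrap y) = v j y := fun y => by
      rw [wrap_eq_add_lat, hv.periodic]
    simp only [kern, pdiff, sub_sub_cancel, PiLp.sub_apply, h5]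
    exact h3 j
  have h5 : ∀ z, kern a μ (x, z) * (pdiff (fun x => ∑ j, ξ j * v j x) (x, z) - inner ℝ ξ z) =
      ∑ j, ξ j * (kern a μ (x, z) * pdiff (v j) (x, z) - kern a μ (x, z) * z j) := by
    intro z
    rw [inner_eq_sum_mul]
    simp only [pdiff, ← Finset.sum_sub_distrib, Finset.mul_sum]
    exact Finset.sum_congr rfl fun j _ => by ring
  simp only [h5]
  rw [integral_finsetSum _ fun j _ => by exact ((h1 j).sub (h2 j)).const_mul _]
  refine Finset.sum_eq_zero fun j _ => ?_
  rw [integral_const_mul, integral_sub (h1 j) (h2 j), h4, sub_self, mul_zero]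

/-- The weak form of the auxiliary equation. -/
theorem Coefficients.integral_smul_eq_zero (h2 : Integrable fun x => ‖x‖ ^ 2 * a x)
    {ξ : E d} {v : E d → ℝ} (hv : MemLp v 2 (cellMeasure d)) (hs : SolvesAux a μ ξ v)
    {𝕜 : Type*} [RCLike 𝕜] {w : E d → 𝕜} (hw : MemLp w 2 (cellMeasure d)) :
    ∫ p, w p.1 * ((pdiff v p - inner ℝ ξ p.2 : ℝ) : 𝕜) ∂(pairMeasure a μ) = 0 := by
  have hq : MemLp (fun p => ((pdiff v p - inner ℝ ξ p.2 : ℝ) : 𝕜)) 2 (pairMeasure a μ) :=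
    ((H.memLp_pdiff hv).sub (H.memLp_inner h2 ξ)).ofReal
  have hi : Integrable (fun p => w p.1 * ((pdiff v p - inner ℝ ξ p.2 : ℝ) : 𝕜))
    (pairMeasure a μ) := (H.memLp_fst hw).integrable_mul hq
  rw [H.integral_eq_iterated hi]
  refine integral_eq_zero_of_ae ?_
  filter_upwards [hs] with x hx
  have h1 : ∀ z, kern a μ (x, z) • (w x * ((pdiff v (x, z) - inner ℝ ξ z : ℝ) : 𝕜)) =
      w x * ((kern a μ (x, z) * (pdiff v (x, z) - inner ℝ ξ z) : ℝ) : 𝕜) := by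
    intro z
    rw [RCLike.real_smul_eq_coe_mul]
    push_cast
    ring
  simp only [h1]
  rw [integral_const_mul, integral_ofReal, hx]
  simp

end

section

variable {a : E d → ℝ} {μ : E d → E d → ℝ} {μm μp : ℝ} (H : Coefficients a μ μm μp)
  (h4 : Integrable fun x => ‖x‖ ^ 4 * a x) (hd : 1 ≤ d)

include H

theorem Coefficients.norm_integral_kern_mul_le (h1 : Integrable fun x => ‖x‖ ^ 1 * a x)
    (j : Fin d) (x : E d) : ‖∫ z : E d, kern a μ (x, z) * z j‖ ≤ μp * moment a 1 := by
  rw [moment, ← integral_const_mul]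
  refine norm_integral_le_of_norm_le (h1.const_mul μp) (.of_forall fun z => ?_)
  rw [norm_mul, Real.norm_of_nonneg (H.kern_nonneg _)]
  calc kern a μ (x, z) * ‖z j‖ ≤ a z * μp * ‖z‖ := by
        refine mul_le_mul (H.kern_le _) (PiLp.norm_apply_le z j) (norm_nonneg _) ?_
        exact mul_nonneg (H.nonneg _) H.upper_pos.le
    _ = _ := by ring

omit H in
theorem zero_mem_dualCell : (0 : E d) ∈ dualCell d := fun j => by
  simp [Real.pi_pos, Real.pi_pos.le]

omit H in
theorem coef_single_sub (u : L2 d) : coef (u - coef u 0 • expoLp 0) 0 = 0 := by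
  rw [coef_sub, coef_smul, coef_expoLp]
  simp

theorem Coefficients.integral_conj_mul_self (ξ : E d) {u : E d → ℂ}
    (hu : MemLp u 2 (cellMeasure d)) :
    ∫ p, (starRingEnd ℂ) (u p.1) * twistedDiff ξ u p ∂(pairMeasure a μ) =
      ((1 / 2 * ∫ p, ‖twistedDiff ξ u p‖ ^ 2 ∂(pairMeasure a μ) : ℝ) : ℂ) := by
  rw [← H.half_integral_conj_mul ξ hu hu]
  have : ∀ p, (starRingEnd ℂ) (twistedDiff ξ u p) * twistedDiff ξ u p =
      ((‖twistedDiff ξ u p‖ ^ 2 : ℝ) : ℂ) := fun p => by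
    rw [mul_comm, Complex.mul_conj, Complex.normSq_eq_norm_sq]
  simp only [this]
  have h5 := integral_ofReal (𝕜 := ℂ) (μ := pairMeasure a μ) (f := fun p => ‖twistedDiff ξ u p‖ ^ 2)
  erw [h5]
  push_cast
  rfl

theorem Coefficients.re_integral_conj_mul_self (ξ : E d) {u : E d → ℂ}
    (hu : MemLp u 2 (cellMeasure d)) :
    (∫ p, (starRingEnd ℂ) (u p.1) * twistedDiff ξ u p ∂(pairMeasure a μ)).re =
      1 / 2 * ∫ p, ‖twistedDiff ξ u p‖ ^ 2 ∂(pairMeasure a μ) := by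
  rw [H.integral_conj_mul_self ξ hu, Complex.ofReal_re]

include h4 hd in
/-- Solvability of the auxiliary equations. -/
theorem Coefficients.exists_isCellSolution : ∃ v, IsCellSolution a μ v := by
  have hM1 := integrable_pow_mul H.integrable h4 (by norm_num : 1 ≤ 4)
  have hfin := H.isFiniteMeasure
  obtain ⟨A, hA, hG⟩ := H.exists_fiberOp 0
  set κ := μm * symbolInf a Real.pi
  have hκ : 0 < κ := mul_pos H.lower_pos
    (symbolInf_pos hd H.integrable H.nonneg H.integral_pos Real.pi_pos)
  have hAe : ∀ w : L2 d, inner ℂ (expoLp 0) (A w) = 0 := by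
    intro w
    rw [hA, ← H.half_integral_conj_mul 0 (Lp.memLp _) (Lp.memLp _)]
    have : twistedDiff 0 (expoLp 0 : L2 d) =ᵐ[pairMeasure a μ] 0 := by
      refine (H.twistedDiff_congr 0 (coeFn_expoLp 0)).trans (.of_forall fun p => ?_)
      simp [twistedDiff]
    rw [integral_eq_zero_of_ae, mul_zero]
    filter_upwards [this] with p hp
    rw [hp]
    simp
  have hself : ∀ u : L2 d, (inner ℂ u (A u)).re =
      1 / 2 * ∫ p, ‖twistedDiff 0 u p‖ ^ 2 ∂(pairMeasure a μ) := fun u => by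
    rw [hA, H.re_integral_conj_mul_self 0 (Lp.memLp u)]
  -- Constants span the kernel of `𝔸(0)`. Adding the projection `P` onto them makes the operator
  -- coercive, since the form of `𝔸(0)` sees only `u'` and `P` only the mean.
  set P : L2 d →L[ℂ] L2 d := (innerSL ℂ (expoLp 0)).smulRight (expoLp 0)
  have hP : ∀ u, P u = coef u 0 • expoLp 0 := fun u => rfl
  have hco : ∀ u : L2 d, min κ 1 * ‖u‖ ^ 2 ≤ ‖inner ℂ ((A + P) u) u‖ := by
    intro u
    set u' := u - coef u 0 • expoLp 0
    have hu' : u = u' + coef u 0 • expoLp 0 := by simp [u']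
    have h1 : ‖u‖ ^ 2 = ‖u'‖ ^ 2 + ‖coef u 0‖ ^ 2 := by
      have h0 : inner ℂ u' (coef u 0 • expoLp 0) = 0 := by
        rw [inner_smul_right, ← inner_conj_symm, show inner ℂ (expoLp 0) u' = 0 from
          coef_single_sub u]
        simp
      conv_lhs => rw [hu']
      have := norm_add_sq_eq_norm_sq_add_norm_sq_of_inner_eq_zero _ _ h0
      rw [norm_smul, norm_expoLp, mul_one] at this
      nlinarith
    have h2 := H.coercive_gap zero_mem_dualCell (coef_single_sub u)
    have h3 : ∫ p, ‖twistedDiff 0 u p‖ ^ 2 ∂(pairMeasure a μ) =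
        ∫ p, ‖twistedDiff 0 u' p‖ ^ 2 ∂(pairMeasure a μ) := by
      refine integral_congr_ae ?_
      have h5 : (u' : E d → ℂ) =ᵐ[cellMeasure d] fun x => u x - coef u 0 := by
        filter_upwards [Lp.coeFn_sub u (coef u 0 • expoLp 0),
          Lp.coeFn_smul (coef u 0) (expoLp (d := d) 0), coeFn_expoLp (d := d) 0] with x h6 h7 h8
        rw [h6, Pi.sub_apply, h7, Pi.smul_apply, h8]
        simp
      filter_upwards [H.twistedDiff_congr 0 h5] with p hp
      rw [hp]
      simp [twistedDiff]
    have h6 : (inner ℂ u ((A + P) u)).re =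
        1 / 2 * ∫ p, ‖twistedDiff 0 u p‖ ^ 2 ∂(pairMeasure a μ) + ‖coef u 0‖ ^ 2 := by
      rw [add_apply, inner_add_right, Complex.add_re, hself, hP,
        inner_smul_right, ← inner_conj_symm, ← coef, Complex.mul_conj, Complex.normSq_eq_norm_sq]
      rfl
    rw [norm_inner_symm]
    refine le_trans ?_ (Complex.re_le_norm _)
    rw [h6, h3, h1]
    have h7 := min_le_left κ 1
    have h8 := min_le_right κ 1
    have h9 := mul_le_mul_of_nonneg_right h7 (sq_nonneg ‖u'‖)
    have h10 := mul_le_mul_of_nonneg_right h8 (sq_nonneg ‖coef u 0‖)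
    linarith
  have hunit : IsUnit (A + P) := by
    have hc : (0 : ℝ) < min κ 1 := lt_min hκ one_pos
    refine ContinuousLinearMap.isUnit_of_forall_le_norm_inner_map (c := ⟨min κ 1, hc.le⟩) _
      hc fun u => ?_
    rw [mul_comm]
    exact hco u
  have key : ∀ j, ∃ u : L2 d, coef u 0 = 0 ∧ ∀ᵐ x ∂(cellMeasure d),
      ∫ z, kern a μ (x, z) • twistedDiff 0 u (x, z) =
        ((∫ z : E d, kern a μ (x, z) * z j : ℝ) : ℂ) := by
    intro j
    have hzi : Integrable (fun p : E d × E d => p.2 j) (pairMeasure a μ) := by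
      simpa only [inner_single_one] using H.integrable_inner hM1 (EuclideanSpace.single j 1)
    have hpi : Integrable (fun x => ∫ z : E d, kern a μ (x, z) * z j) (cellMeasure d) :=
      ((H.integrable_iff _).1 hzi).integral_prod_left
    have hF : MemLp (fun x => ((∫ z : E d, kern a μ (x, z) * z j : ℝ) : ℂ)) 2 (cellMeasure d) :=
      (MemLp.of_bound hpi.1 _
        (.of_forall fun x => H.norm_integral_kern_mul_le hM1 j x)).ofReal
    obtain ⟨B, hB⟩ := hunit
    set u := (↑B⁻¹ : L2 d →L[ℂ] L2 d) (hF.toLp _)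
    have hu : (A + P) u = hF.toLp _ := by
      rw [← hB]
      show ((↑B : L2 d →L[ℂ] L2 d) * (↑B⁻¹ : L2 d →L[ℂ] L2 d)) (hF.toLp _) = _
      rw [B.mul_inv]
      rfl
    have hmean : inner ℂ (expoLp 0) (hF.toLp _) = 0 := by
      have h5 : inner ℂ (expoLp 0) (hF.toLp _) =
          ((∫ x in cell d, ∫ z : E d, kern a μ (x, z) * z j : ℝ) : ℂ) := by
        rw [inner_eq_integral]
        refine Eq.trans (integral_congr_ae ?_) (integral_ofReal (𝕜 := ℂ))
        filter_upwards [coeFn_expoLp (d := d) 0, hF.coeFn_toLp] with x h6 h7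
        rw [h6, h7]
        simp
      -- The coordinate `zⱼ` is odd under the flip, so the right side of the equation has mean zero
      -- and the solvability condition holds.
      have h6 : ∫ x in cell d, ∫ z : E d, kern a μ (x, z) * z j = 0 := by
        have h7 := H.integral_flip_neg (f := fun p => p.2 j) hzi.1 (.of_forall fun p => rfl)
        rw [H.integral_eq_iterated hzi] at h7
        exact h7
      rw [h5, h6, Complex.ofReal_zero]
    -- Pairing with the constant removes `𝔸(0)u`, whence `Pu = 0` and `u` solves the original
    -- equation.
    have hu0 : coef u 0 = 0 := by
      have h5 : inner ℂ (expoLp 0) ((A + P) u) = 0 := by rw [hu, hmean]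
      rw [add_apply, inner_add_right, hAe, zero_add, hP, inner_smul_right,
        inner_self_eq_norm_sq_to_K, norm_expoLp] at h5
      simpa using h5
    refine ⟨u, hu0, ?_⟩
    have hAu : hF.toLp _ = A u := by
      rw [← hu, add_apply, hP, hu0, zero_smul, add_zero]
    have hg := (hG u _).2 hAu
    filter_upwards [hg, hF.coeFn_toLp, H.ae_integral_twistedDiff 0 (Lp.memLp u)] with x h5 h6 h7
    rw [h7, ← h5, h6]
  choose u hu0 hu using key
  have hre : ∀ j, MemLp (fun x => (u j x).re) 2 (cellMeasure d) := fun j => (Lp.memLp (u j)).re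
  -- At `ξ = 0` the kernel and the right side are real, so the real part is again a solution.
  refine ⟨fun j x => (u j (wrap x)).re, ⟨fun j => (hre j).ae_eq ?_, fun j x n => ?_,
    fun j => ?_, fun j => ?_⟩⟩
  · filter_upwards [ae_restrict_mem measurableSet_cell] with x hx
    rw [wrap_eq_self hx]
  · rw [wrap_add_lat]
  · have hI := ((H.integrable_iff _).1 ((H.memLp_twistedDiff 0 (Lp.memLp (u j))).integrable
      (by norm_num))).prod_right_ae
    filter_upwards [hu j, hI, ae_restrict_mem measurableSet_cell] with x h5 h6 hx
    have h7 := congrArg Complex.re h5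
    rw [Complex.ofReal_re, ← RCLike.re_eq_complex_re, ← integral_re h6,
      ← integral_sub_left_eq_self (fun z : E d => kern a μ (x, z) * z j) volume x,
      ← integral_sub_left_eq_self _ volume x] at h7
    simp only [kern, twistedDiff, sub_sub_cancel, PiLp.sub_apply, phase_zero_left, one_mul,
      map_sub, RCLike.re_eq_complex_re, RCLike.smul_re] at h7
    simp only [wrap_eq_self hx]
    exact h7
  · have h5 : ∫ x in cell d, u j x = 0 := by
      have := coef_eq_integral (u j) 0
      rw [hu0] at this
      simpa using this.symm
    have h6 : ∫ x in cell d, (u j x).re = 0 := by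
      have h7 := integral_re ((Lp.memLp (u j)).integrable (by norm_num : (1 : ENNReal) ≤ 2))
      rw [h5] at h7
      simpa using h7
    rw [← h6]
    refine setIntegral_congr_fun measurableSet_cell fun x hx => ?_
    simp only [wrap_eq_self hx]

end

end NonlocalHom

/-! ### Truncation inequalities for the sup bound -/

namespace NonlocalHom

variable {d : ℕ}

/-- The part of `s` outside `[-b,b]`. -/
def excess (b s : ℝ) : ℝ := max (s - b) 0 + min (s + b) 0

theorem measurable_excess (b : ℝ) : Measurable (excess b) := by
  unfold excess
  fun_prop

theorem abs_excess_le {b : ℝ} (hb : 0 ≤ b) (s : ℝ) : |excess b s| ≤ |s| := by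
  unfold excess
  rcases max_cases (s - b) 0 with h | h <;> rcases min_cases (s + b) 0 with h' | h' <;>
    rcases abs_cases s with h'' | h'' <;> rw [abs_le] <;> constructor <;> linarith

theorem excess_eq_zero_iff {b : ℝ} (hb : 0 ≤ b) (s : ℝ) : excess b s = 0 ↔ |s| ≤ b := by
  unfold excess
  rw [abs_le]
  rcases max_cases (s - b) 0 with h | h <;> rcases min_cases (s + b) 0 with h' | h' <;>
    constructor <;> intro h0 <;> (try constructor) <;> linarith

theorem abs_le_abs_excess_add {b : ℝ} (hb : 0 ≤ b) (s : ℝ) : |s| ≤ |excess b s| + b := by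
  unfold excess
  rcases max_cases (s - b) 0 with h | h <;> rcases min_cases (s + b) 0 with h' | h' <;>
    rw [h.1, h'.1] <;> rcases abs_cases s with h1 | h1 <;>
    linarith [le_abs_self (s - b + 0), neg_abs_le (0 + (s + b)), abs_nonneg (s - b + (s + b)),
      abs_nonneg ((0 : ℝ) + 0)]

theorem excess_mul_self {b : ℝ} (hb : 0 ≤ b) (s : ℝ) :
    excess b s * s = |excess b s| * (|excess b s| + b) := by
  unfold excess
  rcases max_cases (s - b) 0 with h | h <;> rcases min_cases (s + b) 0 with h' | h' <;>
    rw [h.1, h'.1]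
  · have : s = 0 := by linarith
    have : b = 0 := by linarith
    subst_vars; simp
  · rw [abs_of_nonneg (by linarith)]; ring
  · rw [abs_of_nonpos (by linarith)]; ring
  · simp

/-- The pointwise inequality behind the bound of the solutions of the auxiliary equations;
`i` is the indicator of `|t| > r`. -/
theorem excess_mul_sub_ge {b r : ℝ} (hr : 0 ≤ r) (hb : r ≤ b) (s t i k : ℝ)
    (hi : i = 1 ∨ i = 0 ∧ |t| ≤ r) {l : ℝ} (hl : l = 1 ∨ l = 0 ∧ |s| ≤ r) {m : ℝ} (hk : |k| ≤ m) :
    |excess b s| ^ 2 - 1 / 2 * (|excess b s| ^ 2 * i + |excess b t| ^ 2 * l)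
      + (b - r) * (|excess b s| * (1 - i)) - |excess b s| * m ≤ excess b s * (s - t - k) := by
  have hb0 := hr.trans hb
  have h1 := excess_mul_self hb0 s
  have h2 : excess b s * t ≤ |excess b s| * |t| := (le_abs_self _).trans (abs_mul _ _).le
  have h3 : excess b s * k ≤ |excess b s| * m := (le_abs_self _).trans
    ((abs_mul _ _).le.trans (mul_le_mul_of_nonneg_left hk (abs_nonneg _)))
  have h4 := abs_le_abs_excess_add hb0 t
  have h5 := abs_nonneg (excess b s)
  have h5' := abs_nonneg (excess b t)
  set x := |excess b s|
  set y := |excess b t|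
  -- If `x ≠ 0` then `|s| > b ≥ r`, so `l = 1`. For `i = 1` the claim follows from `|t| ≤ y + b` and
  -- `xy ≤ (x² + y²)/2`. For `i = 0` it follows from `|t| ≤ r`, and the term with `b - r` is the
  -- gain.
  have key : x ^ 2 - 1 / 2 * (x ^ 2 * i + y ^ 2 * l) + (b - r) * (x * (1 - i)) ≤
      x * (x + b) - x * |t| := by
    have hl' : x = 0 ∨ l = 1 := by
      rcases hl with hl | ⟨-, hl⟩
      · exact .inr hl
      · left
        rw [show x = |excess b s| from rfl, (excess_eq_zero_iff hb0 s).2 (hl.trans hb), abs_zero]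
    have hl0 : 0 ≤ l := by rcases hl with rfl | ⟨rfl, -⟩ <;> norm_num
    rcases hl' with hx | rfl
    · rw [hx]
      nlinarith [mul_nonneg (sq_nonneg y) hl0]
    · rcases hi with rfl | ⟨rfl, ht⟩
      · nlinarith [mul_le_mul_of_nonneg_left h4 h5, sq_nonneg (x - y)]
      · nlinarith [mul_le_mul_of_nonneg_left ht h5, sq_nonneg y]
  nlinarith

section

variable {a : E d → ℝ} {μ : E d → E d → ℝ} {μm μp : ℝ} (H : Coefficients a μ μm μp)

include H

theorem Coefficients.le_integral_fst {w : E d → ℝ} (hw : Integrable w (cellMeasure d))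
    (hw0 : ∀ x, 0 ≤ w x) :
    μm * truncMass a * ∫ x in cell d, w x ≤ ∫ p, w p.1 ∂(pairMeasure a μ) := by
  have hi : Integrable (fun p : E d × E d => w p.1) (pairMeasure a μ) := by
    simpa using H.integrable_mul (q := fun _ => 1) hw (by simpa using H.integrable) (by fun_prop)
  rw [H.integral_eq]
  calc μm * truncMass a * ∫ x in cell d, w x ≤ μm * (∫ z, a z) * ∫ x in cell d, w x := by
        have := H.lower_pos
        have := integral_nonneg (μ := cellMeasure d) (f := w) hw0
        have := truncMass_le_integral H.integrable H.nonneg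
        gcongr
    _ = ∫ p : E d × E d, w p.1 * (a p.2 * μm) ∂((cellMeasure d).prod volume) := by
        rw [integral_prod_mul w (fun z => a z * μm), integral_mul_const]
        ring
    _ ≤ _ := by
        refine integral_mono (hw.mul_prod (H.integrable.mul_const μm)) ((H.integrable_iff _).1 hi)
          fun p => ?_
        simp only [smul_eq_mul]
        rw [mul_comm]
        exact mul_le_mul_of_nonneg_right (H.le_kern p) (hw0 _)

/-- The condition on `t₀` says that for each `x` the kernel mass on a set of measure at most `t₀` is
at most half of `μ₋‖ã₁‖`, the lower bound for the total mass. The other half remains available in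
the sup bound. -/
theorem Coefficients.integral_mul_indicator_le {t₀ : ℝ} (ht : IsThreshold a μm μp t₀)
    {w : E d → ℝ} (hw : Integrable w (cellMeasure d)) (hw0 : ∀ x, 0 ≤ w x) {O : Set (E d)}
    (hO : MeasurableSet O) (hOc : O ⊆ cell d) (hOt : volume O ≤ ENNReal.ofReal t₀) :
    ∫ p, w p.1 * O.indicator 1 (wrap (p.1 - p.2)) ∂(pairMeasure a μ) ≤
      μm * truncMass a / 2 * ∫ x in cell d, w x := by
  have hi : Integrable (fun p : E d × E d => w p.1) (pairMeasure a μ) := by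
    simpa using H.integrable_mul (q := fun _ => 1) hw (by simpa using H.integrable) (by fun_prop)
  have hm : Measurable fun p : E d × E d => O.indicator (1 : E d → ℝ) (wrap (p.1 - p.2)) :=
    (measurable_one.indicator hO).comp measurable_wrap_sub
  have hb : ∀ x : E d, O.indicator (1 : E d → ℝ) x ∈ Set.Icc 0 1 := fun x => by
    by_cases h : x ∈ O <;> simp [h]
  have hi2 : Integrable (fun p : E d × E d => w p.1 * O.indicator 1 (wrap (p.1 - p.2)))
      (pairMeasure a μ) :=
    hi.mul_bdd (c := 1) hm.aestronglyMeasurable (.of_forall fun p => by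
      rw [Real.norm_of_nonneg (hb _).1]
      exact (hb _).2)
  have h1 : ∀ x ∈ cell d, ∫ z, kern a μ (x, z) * O.indicator 1 (wrap (x - z)) ≤
      μm * truncMass a / 2 := by
    intro x hx
    have hn := modulus_nonneg H.nonneg t₀
    have h2 := integral_mul_indicator_wrap_le H.integrable H.nonneg hO hOc hOt hx
    have htm := mul_pos H.lower_pos (truncMass_pos H.integrable H.nonneg H.integral_pos)
    have h3 := ht.2
    rw [div_le_iff₀ htm] at h3
    calc ∫ z, kern a μ (x, z) * O.indicator 1 (wrap (x - z)) ≤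
        ∫ z, μp * (a z * O.indicator 1 (wrap (x - z))) := by
          refine integral_mono_of_nonneg (.of_forall fun z => mul_nonneg (H.kern_nonneg _) (hb _).1)
            ((H.integrable.mul_bdd (c := 1) ?_ (.of_forall fun z => ?_)).const_mul _)
            (.of_forall fun z => ?_)
          · exact ((measurable_one.indicator hO).comp
              (measurable_wrap.comp (measurable_const.sub measurable_id))).aestronglyMeasurable
          · rw [Real.norm_of_nonneg (hb _).1]
            exact (hb _).2
          · have := mul_le_mul_of_nonneg_right (H.kern_le (x, z)) (hb (wrap (x - z))).1
            simp only at this ⊢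
            linarith
      _ ≤ μp * modulus a t₀ := by
          rw [integral_const_mul]
          exact mul_le_mul_of_nonneg_left h2 H.upper_pos.le
      _ ≤ _ := by linarith
  rw [H.integral_eq_iterated hi2, ← integral_const_mul]
  refine setIntegral_mono_on ((H.integrable_iff _).1 hi2).integral_prod_left (hw.const_mul _)
    measurableSet_cell fun x hx => ?_
  have h2 : ∀ z, kern a μ (x, z) • (w x * O.indicator 1 (wrap (x - z))) =
      w x * (kern a μ (x, z) * O.indicator 1 (wrap (x - z))) := fun z => by
    rw [smul_eq_mul]; ring
  simp only [h2]
  rw [integral_const_mul, mul_comm (_ / 2)]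
  exact mul_le_mul_of_nonneg_left (h1 x hx) (hw0 x)

end

end NonlocalHom

/-! ### Bounds for the solutions of the auxiliary problems -/

namespace NonlocalHom

variable {d : ℕ} {a : E d → ℝ} {μ : E d → E d → ℝ} {μm μp : ℝ} (H : Coefficients a μ μm μp)

theorem integral_five_terms {X : Type*} [MeasurableSpace X] {ν : Measure X} {f₁ f₂ f₃ f₄ f₅ : X → ℝ}
    (h₁ : Integrable f₁ ν) (h₂ : Integrable f₂ ν) (h₃ : Integrable f₃ ν) (h₄ : Integrable f₄ ν)
    (h₅ : Integrable f₅ ν) (c : ℝ) :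
    ∫ x, (f₁ x - 1 / 2 * (f₂ x + f₃ x) + c * f₄ x - f₅ x) ∂ν =
      ∫ x, f₁ x ∂ν - 1 / 2 * (∫ x, f₂ x ∂ν + ∫ x, f₃ x ∂ν) + c * ∫ x, f₄ x ∂ν - ∫ x, f₅ x ∂ν := by
  have i1 : Integrable (fun x => 1 / 2 * (f₂ x + f₃ x)) ν := (h₂.add h₃).const_mul _
  have i2 : Integrable (fun x => f₁ x - 1 / 2 * (f₂ x + f₃ x)) ν := h₁.sub i1
  have i3 : Integrable (fun x => c * f₄ x) ν := h₄.const_mul c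
  have i4 : Integrable (fun x => f₁ x - 1 / 2 * (f₂ x + f₃ x) + c * f₄ x) ν := i2.add i3
  rw [integral_sub i4 h₅, integral_add i2 i3, integral_sub h₁ i1, integral_const_mul,
    integral_const_mul, integral_add h₂ h₃]

include H

/-- Testing the equation with `v` and using the gap at `ξ = 0`, available as `v` has mean zero,
gives `κ∫v² ≤ B∫|v|`. Young's inequality with weights `κ/B` and `B/κ` absorbs half of the left side.
-/
theorem Coefficients.integral_sq_le (hd : 1 ≤ d) (h4 : Integrable fun x => ‖x‖ ^ 4 * a x)
    {ξ : E d} (hξ : ‖ξ‖ = 1) {v : E d → ℝ} (hv : MemLp v 2 (cellMeasure d))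
    (hs : SolvesAux a μ ξ v) (h0 : ∫ x in cell d, v x = 0) :
    ∫ x in cell d, v x ^ 2 ≤ (μp * moment a 1 / (μm * symbolInf a Real.pi)) ^ 2 := by
  have hM1 := integrable_pow_mul H.integrable h4 (by norm_num : 1 ≤ 4)
  have hM2 := integrable_pow_mul H.integrable h4 (by norm_num : 2 ≤ 4)
  set κ := μm * symbolInf a Real.pi
  have hκ : 0 < κ := mul_pos H.lower_pos
    (symbolInf_pos hd H.integrable H.nonneg H.integral_pos Real.pi_pos)
  have hB : 0 < μp * moment a 1 := mul_pos H.upper_pos (moment_pos hd H.nonneg H.integral_pos hM1)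
  set B := μp * moment a 1
  set L := ∫ x in cell d, v x ^ 2
  have hvc : MemLp (fun x => (v x : ℂ)) 2 (cellMeasure d) := hv.ofReal
  have hL : ‖hvc.toLp _‖ ^ 2 = L := by
    rw [norm_sq_eq_integral]
    refine integral_congr_ae ?_
    filter_upwards [hvc.coeFn_toLp] with x hx
    rw [hx, Complex.norm_real, Real.norm_eq_abs, sq_abs]
  have hc0 : coef (hvc.toLp _) 0 = 0 := by
    rw [coef_eq_integral]
    have h1 : ∫ x in cell d, expo (-0) x * (hvc.toLp _) x = ∫ x in cell d, (v x : ℂ) := by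
      refine integral_congr_ae ?_
      filter_upwards [hvc.coeFn_toLp] with x hx
      rw [hx, neg_zero, expo_zero_index, one_mul]
    have h2 := integral_ofReal (𝕜 := ℂ) (μ := cellMeasure d) (f := v)
    rw [h0] at h2
    rw [h1]
    simpa using h2
  have hgap := H.coercive_gap zero_mem_dualCell hc0
  have hDae := H.twistedDiff_congr 0 hvc.coeFn_toLp
  have hD : ∫ p, ‖twistedDiff 0 (hvc.toLp _) p‖ ^ 2 ∂(pairMeasure a μ) =
      ∫ p, ‖twistedDiff 0 (fun x => (v x : ℂ)) p‖ ^ 2 ∂(pairMeasure a μ) := by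
    refine integral_congr_ae ?_
    filter_upwards [hDae] with p hp
    rw [hp]
  have hre : 1 / 2 * ∫ p, ‖twistedDiff 0 (fun x => (v x : ℂ)) p‖ ^ 2 ∂(pairMeasure a μ) =
      ∫ p, v p.1 * pdiff v p ∂(pairMeasure a μ) := by
    rw [← H.re_integral_conj_mul_self 0 hvc]
    have h1 : ∀ p, (starRingEnd ℂ) (v p.1 : ℂ) * twistedDiff 0 (fun x => (v x : ℂ)) p =
        ((v p.1 * pdiff v p : ℝ) : ℂ) := fun p => by simp [twistedDiff, pdiff]
    simp only [h1]
    exact congrArg Complex.re (integral_ofReal (𝕜 := ℂ)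
      (f := fun p => v p.1 * pdiff v p) (μ := pairMeasure a μ))
  have hi1 : Integrable (fun p => v p.1 * pdiff v p) (pairMeasure a μ) :=
    (H.memLp_fst hv).integrable_mul (H.memLp_pdiff hv)
  have hi2 : Integrable (fun p => v p.1 * inner ℝ ξ p.2) (pairMeasure a μ) :=
    (H.memLp_fst hv).integrable_mul (H.memLp_inner hM2 ξ)
  have hweak : ∫ p, v p.1 * pdiff v p ∂(pairMeasure a μ) =
      ∫ p, v p.1 * inner ℝ ξ p.2 ∂(pairMeasure a μ) := by
    have h1 := H.integral_smul_eq_zero hM2 hv hs hv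
    simp only [RCLike.ofReal_real_eq_id, id, mul_sub] at h1
    rw [integral_sub hi1 hi2] at h1
    linarith
  have hvi : Integrable v (cellMeasure d) := hv.integrable (by norm_num)
  have hbound : ∫ p, v p.1 * inner ℝ ξ p.2 ∂(pairMeasure a μ) ≤ B * ∫ x in cell d, |v x| := by
    have h1 := H.integral_mul_le hvi.abs (fun x => abs_nonneg _) hM1 (by fun_prop)
      (fun z => by positivity)
    refine le_trans (integral_mono hi2 (H.integrable_mul hvi.abs hM1 (by fun_prop)) fun p => ?_) h1
    refine (le_abs_self _).trans ?_
    rw [abs_mul, pow_one]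
    refine mul_le_mul_of_nonneg_left ?_ (abs_nonneg _)
    simpa [hξ] using abs_real_inner_le_norm ξ p.2
  have habs : ∫ x in cell d, |v x| ≤ (κ / B * L + B / κ) / 2 := by
    have h1 : ∫ x in cell d, |v x| ≤ ∫ x in cell d, (κ / B * v x ^ 2 + B / κ) / 2 := by
      refine integral_mono hvi.abs (((hv.integrable_sq.const_mul _).add
        (integrable_const _)).div_const _) fun x => ?_
      have h2 : 0 ≤ κ / B * (|v x| - B / κ) ^ 2 := by positivity
      have h3 : κ / B * (|v x| - B / κ) ^ 2 = κ / B * v x ^ 2 - 2 * |v x| + B / κ := by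
        rw [sub_sq, sq_abs]
        field_simp
      simp only
      linarith
    refine h1.trans_eq ?_
    rw [integral_div, integral_add (hv.integrable_sq.const_mul _) (integrable_const _),
      integral_const_mul]
    simp [L]
  have hfin : κ * L ≤ B * ((κ / B * L + B / κ) / 2) := by
    have := mul_le_mul_of_nonneg_left habs hB.le
    rw [hL, hD, hre, hweak] at hgap
    linarith
  have h5 : B * ((κ / B * L + B / κ) / 2) = κ * L / 2 + B ^ 2 / κ / 2 := by
    field_simp
  rw [h5] at hfin
  rw [div_pow, le_div_iff₀ (by positivity)]
  have h6 : κ * L ≤ B ^ 2 / κ := by linarith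
  rw [le_div_iff₀ hκ] at h6
  linarith

/-- The solutions of the auxiliary equations are bounded. -/
theorem Coefficients.ae_abs_le_of_solvesAux (hd : 1 ≤ d) (h4 : Integrable fun x => ‖x‖ ^ 4 * a x)
    {t₀ : ℝ} (ht : IsThreshold a μm μp t₀)
    {ξ : E d} (hξ : ‖ξ‖ = 1) {v : E d → ℝ} (hv : MemLp v 2 (cellMeasure d))
    (hs : SolvesAux a μ ξ v) {r b : ℝ} (hr : 0 < r)
    (hvr : ∫ x in cell d, v x ^ 2 ≤ r ^ 2 * t₀)
    (hb : 2 * (μp * moment a 1) ≤ (b - r) * (μm * truncMass a)) :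
    ∀ᵐ x ∂(cellMeasure d), |v x| ≤ b := by
  have hM1 := integrable_pow_mul H.integrable h4 (by norm_num : 1 ≤ 4)
  have hM2 := integrable_pow_mul H.integrable h4 (by norm_num : 2 ≤ 4)
  have hm := mul_pos H.lower_pos (truncMass_pos H.integrable H.nonneg H.integral_pos)
  set m := μm * truncMass a
  have hB : 0 < μp * moment a 1 := mul_pos H.upper_pos (moment_pos hd H.nonneg H.integral_pos hM1)
  have hrb : r ≤ b := by
    by_contra h
    push Not at h
    nlinarith
  have hb0 : 0 ≤ b := hr.le.trans hrb
  obtain ⟨g, hgm, hvg⟩ := hv.1.aemeasurable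
  have hg : MemLp g 2 (cellMeasure d) := hv.ae_eq hvg
  set O : Set (E d) := cell d ∩ {x | r < |g x|}
  have hO : MeasurableSet O := measurableSet_cell.inter (measurableSet_lt measurable_const hgm.abs)
  -- Chebyshev's inequality applies, the level `r` being such that `∫v² ≤ r²t₀`.
  have hOt : volume O ≤ ENNReal.ofReal t₀ := by
    have h1 := mul_meas_ge_le_integral_of_nonneg (μ := cellMeasure d) (f := fun x => g x ^ 2)
      (.of_forall fun x => sq_nonneg _) hg.integrable_sq (r ^ 2)
    have h2 : ∫ x in cell d, g x ^ 2 = ∫ x in cell d, v x ^ 2 := by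
      refine integral_congr_ae ?_
      filter_upwards [hvg] with x hx
      rw [hx]
    have h3 : (cellMeasure d).real {x | r ^ 2 ≤ g x ^ 2} ≤ t₀ := by
      have h4 := (h1.trans_eq h2).trans hvr
      exact le_of_mul_le_mul_left h4 (by positivity)
    have h4 : volume O ≤ cellMeasure d {x | r ^ 2 ≤ g x ^ 2} := by
      rw [Measure.restrict_apply (measurableSet_le measurable_const (hgm.pow_const 2))]
      refine measure_mono fun x hx => ⟨?_, hx.1⟩
      show r ^ 2 ≤ g x ^ 2
      rw [← sq_abs (g x)]
      exact pow_le_pow_left₀ hr.le (le_of_lt hx.2) 2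
    refine h4.trans ?_
    rw [← ENNReal.ofReal_toReal (measure_ne_top (cellMeasure d) _)]
    exact ENNReal.ofReal_le_ofReal h3
  set w : E d → ℝ := fun x => excess b (g x)
  have hw : MemLp w 2 (cellMeasure d) :=
    hg.of_le ((measurable_excess b).comp hgm).aestronglyMeasurable
      (.of_forall fun x => abs_excess_le hb0 _)
  have hW : Integrable (fun x => |w x|) (cellMeasure d) := (hw.integrable (by norm_num)).abs
  have hW2 : Integrable (fun x => |w x| ^ 2) (cellMeasure d) := by
    simpa only [sq_abs] using hw.integrable_sq
  have hmeasO : Measurable fun p : E d × E d => O.indicator (1 : E d → ℝ) (wrap (p.1 - p.2)) :=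
    (measurable_one.indicator hO).comp measurable_wrap_sub
  have hbdd : ∀ x : E d, ‖O.indicator (1 : E d → ℝ) x‖ ≤ 1 := fun x => by
    by_cases h : x ∈ O <;> simp [h]
  have hfst : ∀ {q : E d → ℝ}, Integrable q (cellMeasure d) →
      Integrable (fun p : E d × E d => q p.1) (pairMeasure a μ) := fun hq => by
    simpa using H.integrable_mul (q := fun _ => 1) hq (by simpa using H.integrable) (by fun_prop)
  have hfO : ∀ {q : E d → ℝ}, Integrable q (cellMeasure d) →
      Integrable (fun p : E d × E d => q p.1 * O.indicator 1 (wrap (p.1 - p.2)))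
        (pairMeasure a μ) := fun hq =>
    (hfst hq).mul_bdd (c := 1) hmeasO.aestronglyMeasurable (.of_forall fun p => hbdd _)
  have j1 := hfst hW2
  have j2 := hfO hW2
  have hflip : (fun p : E d × E d => |w (flip p).1| ^ 2 * O.indicator 1 (wrap ((flip p).1 - (flip p).2)))
      =ᵐ[pairMeasure a μ] fun p => |w (wrap (p.1 - p.2))| ^ 2 * O.indicator 1 p.1 := by
    filter_upwards [H.ae_flip_flip] with p hp
    have h1 : wrap ((flip p).1 - (flip p).2) = p.1 := congrArg Prod.fst hp
    rw [h1]
    rfl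
  have j3 : Integrable (fun p : E d × E d => |w (wrap (p.1 - p.2))| ^ 2 * O.indicator 1 p.1)
      (pairMeasure a μ) :=
    (H.measurePreserving_flip.integrable_comp_of_integrable j2).congr hflip
  have j4 : Integrable (fun p : E d × E d => |w p.1| * (1 - O.indicator 1 (wrap (p.1 - p.2))))
      (pairMeasure a μ) := by
    refine ((hfst hW).sub (hfO hW)).congr (.of_forall fun p => ?_)
    simp only [Pi.sub_apply]
    ring
  have j5 := H.integrable_mul hW hM1 (by fun_prop)
  simp only [pow_one] at j5
  have j6 : Integrable (fun p => w p.1 * (pdiff v p - inner ℝ ξ p.2)) (pairMeasure a μ) :=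
    (H.memLp_fst hw).integrable_mul ((H.memLp_pdiff hv).sub (H.memLp_inner hM2 ξ))
  have hweak : ∫ p, w p.1 * (pdiff v p - inner ℝ ξ p.2) ∂(pairMeasure a μ) = 0 :=
    H.integral_smul_eq_zero hM2 hv hs hw
  have hmain : ∫ p, (|w p.1| ^ 2 - 1 / 2 * (|w p.1| ^ 2 * O.indicator 1 (wrap (p.1 - p.2)) +
      |w (wrap (p.1 - p.2))| ^ 2 * O.indicator 1 p.1) +
      (b - r) * (|w p.1| * (1 - O.indicator 1 (wrap (p.1 - p.2)))) - |w p.1| * ‖p.2‖)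
      ∂(pairMeasure a μ) ≤ 0 := by
    -- The equation tested with the excess of `v` over `b` gives zero. The pointwise inequality
    -- bounds its integrand from below.
    rw [← hweak]
    refine integral_mono_ae (((j1.sub ((j2.add j3).const_mul _)).add (j4.const_mul _)).sub j5) j6 ?_
    filter_upwards [H.quasi_fst.ae hvg, H.quasi_wrap_sub.ae hvg, H.ae_fst_mem_cell] with p h1 h2 h3
    have hind : ∀ x ∈ cell d, O.indicator (1 : E d → ℝ) x = 1 ∨
        O.indicator (1 : E d → ℝ) x = 0 ∧ |g x| ≤ r := by
      intro x hx
      by_cases h : r < |g x|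
      · left
        simp [O, hx, h]
      · right
        exact ⟨by simp [O, h], not_lt.1 h⟩
    simp only [pdiff]
    rw [h1, h2]
    refine excess_mul_sub_ge hr.le hrb _ _ _ _ (hind _ (wrap_mem_cell _)) (hind _ h3) ?_
    simpa [hξ] using abs_real_inner_le_norm ξ p.2
  replace hmain := (integral_five_terms j1 j2 j3 j4 j5 (b - r)).symm.le.trans hmain
  have k1 := H.le_integral_fst hW2 fun x => sq_nonneg _
  have k2 := H.integral_mul_indicator_le ht hW2 (fun x => sq_nonneg _) hO Set.inter_subset_left hOt
  have k3 : ∫ p : E d × E d, |w (wrap (p.1 - p.2))| ^ 2 * O.indicator 1 p.1 ∂(pairMeasure a μ) =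
      ∫ p : E d × E d, |w p.1| ^ 2 * O.indicator 1 (wrap (p.1 - p.2)) ∂(pairMeasure a μ) := by
    rw [← H.integral_flip j2.1]
    exact (integral_congr_ae hflip).symm
  have k4 : m / 2 * ∫ x in cell d, |w x| ≤
      ∫ p : E d × E d, |w p.1| * (1 - O.indicator 1 (wrap (p.1 - p.2))) ∂(pairMeasure a μ) := by
    have h1 := H.le_integral_fst hW fun x => abs_nonneg _
    have h2 := H.integral_mul_indicator_le ht hW (fun x => abs_nonneg _) hO
      Set.inter_subset_left hOt
    simp only [mul_sub, mul_one]
    rw [integral_sub (hfst hW) (hfO hW)]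
    linarith
  have k5 := H.integral_mul_le hW (fun x => abs_nonneg _) hM1 (by fun_prop) fun z => by positivity
  simp only [pow_one] at k5
  have hP : 0 ≤ ∫ x in cell d, |w x| := integral_nonneg fun x => abs_nonneg _
  have hQ : 0 ≤ ∫ x in cell d, |w x| ^ 2 := integral_nonneg fun x => sq_nonneg _
  have hM : moment a 1 = ∫ z : E d, ‖z‖ * a z := by simp only [moment, pow_one]
  rw [← hM] at k5
  -- The quadratic terms leave `(m/2)∫|w|²`. The linear ones have coefficient `(b-r)m/2 - μ₊M₁`,
  -- nonnegative by the choice of `b`. Their sum is at most zero, so `w` vanishes.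
  have hzero : ∫ x in cell d, |w x| ^ 2 = 0 := by
    have h5 := mul_le_mul_of_nonneg_left k4 (sub_nonneg.2 hrb)
    have h6 := mul_le_mul_of_nonneg_right hb hP
    rw [k3] at hmain
    have h7 : m / 2 * ∫ x in cell d, |w x| ^ 2 ≤ 0 := by linarith
    nlinarith
  filter_upwards [(integral_eq_zero_iff_of_nonneg (fun x => sq_nonneg _) hW2).1 hzero, hvg] with x h5 h6
  rw [h6]
  refine (excess_eq_zero_iff hb0 _).1 ?_
  simpa using h5

end NonlocalHom

/-! ### Elementary expansions of the corrected constant -/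

namespace NonlocalHom

variable {d : ℕ}

theorem abs_sin_sub_le (x : ℝ) : |Real.sin x - x| ≤ 2 * |x| ^ 3 := by
  have key : ∀ x : ℝ, 0 ≤ x → |Real.sin x - x| ≤ 2 * x ^ 3 := by
    intro x hx
    have h1 := Real.sin_le hx
    rw [abs_of_nonpos (by linarith)]
    rcases hx.eq_or_lt with rfl | hx0
    · simp
    rcases le_total x 1 with h | h
    · have h2 := Real.sin_gt_sub_cube hx0
      have := pow_pos hx0 3
      linarith
    · have h2 := Real.neg_one_le_sin x
      nlinarith [mul_nonneg (sub_nonneg.2 h) (sub_nonneg.2 h), pow_pos hx0 3,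
        mul_nonneg (mul_nonneg (sub_nonneg.2 h) hx) hx, mul_nonneg (sub_nonneg.2 h) hx]
  rcases le_total 0 x with h | h
  · rw [abs_of_nonneg h]
    exact key x h
  · have := key (-x) (neg_nonneg.2 h)
    rw [abs_of_nonpos h]
    rwa [Real.sin_neg, ← neg_add', abs_neg, ← sub_eq_add_neg] at this

theorem norm_one_sub_exp_sub_le (t : ℝ) :
    ‖1 - Complex.exp ((-t : ℝ) * Complex.I) - (t : ℂ) * Complex.I‖ ≤ 2 * t ^ 2 := by
  have hn : ‖((-t : ℝ) : ℂ) * Complex.I‖ = |t| := by simp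
  rcases le_total |t| 1 with h | h
  · have h1 := Complex.norm_exp_sub_one_sub_id_le (hn.trans_le h)
    rw [hn, sq_abs] at h1
    rw [← norm_neg]
    refine le_trans (le_of_eq ?_) (h1.trans (by nlinarith [sq_nonneg t]))
    congr 1
    push_cast
    ring
  · have h1 := Real.norm_exp_I_mul_ofReal_sub_one_le (x := -t)
    rw [mul_comm, norm_sub_rev] at h1
    refine (norm_sub_le _ _).trans ?_
    have h2 : ‖(t : ℂ) * Complex.I‖ = |t| := by simp
    rw [h2]
    rw [norm_neg, Real.norm_eq_abs] at h1
    rw [← sq_abs t]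
    nlinarith

theorem norm_one_sub_exp_le (t : ℝ) : ‖1 - Complex.exp ((-t : ℝ) * Complex.I)‖ ≤ |t| := by
  have h1 := Real.norm_exp_I_mul_ofReal_sub_one_le (x := -t)
  rwa [mul_comm, norm_sub_rev, norm_neg, Real.norm_eq_abs] at h1

/-- First-order expansion of the twisted difference of `1 - iΘ`. -/
theorem norm_corrected_diff_sub_le (t x y : ℝ) :
    ‖(1 - Complex.I * x) - Complex.exp ((-t : ℝ) * Complex.I) * (1 - Complex.I * y)
      - Complex.I * ((t - (x - y) : ℝ) : ℂ)‖ ≤ 2 * t ^ 2 + |t| * |y| := by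
  have h : (1 - Complex.I * x) - Complex.exp ((-t : ℝ) * Complex.I) * (1 - Complex.I * y)
      - Complex.I * ((t - (x - y) : ℝ) : ℂ) =
      (1 - Complex.exp ((-t : ℝ) * Complex.I) - (t : ℂ) * Complex.I) -
      Complex.I * y * (1 - Complex.exp ((-t : ℝ) * Complex.I)) := by
    push_cast
    ring
  rw [h]
  refine (norm_sub_le _ _).trans (add_le_add (norm_one_sub_exp_sub_le t) ?_)
  rw [norm_mul, norm_mul, Complex.norm_I, one_mul, Complex.norm_real, Real.norm_eq_abs, mul_comm]
  exact mul_le_mul_of_nonneg_right (norm_one_sub_exp_le t) (abs_nonneg _)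

/-- Multiplication by the unimodular `exp(it/2)` symmetrizes the expression and separates real and
imaginary parts. For `t`, `x`, `y` of order `l`, the first square is of order four and the imaginary
part is `t - (x - y)` up to order three, so the squared norm has no cubic error. -/
theorem norm_corrected_diff_sq (t x y : ℝ) :
    ‖(1 - Complex.I * x) - Complex.exp ((-t : ℝ) * Complex.I) * (1 - Complex.I * y)‖ ^ 2 =
      (Real.sin (t / 2) * (x + y)) ^ 2 +
        (2 * Real.sin (t / 2) - Real.cos (t / 2) * (x - y)) ^ 2 := by
  have hc := Real.cos_two_mul (t / 2)
  have hs := Real.sin_two_mul (t / 2)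
  have h1 := Real.sin_sq_add_cos_sq (t / 2)
  rw [show 2 * (t / 2) = t by ring] at hc hs
  rw [← Complex.normSq_eq_norm_sq, Complex.normSq_apply]
  simp only [Complex.sub_re, Complex.sub_im, Complex.one_re, Complex.one_im, Complex.mul_re,
    Complex.mul_im, Complex.I_re, Complex.I_im, Complex.ofReal_re, Complex.ofReal_im,
    Complex.exp_ofReal_mul_I_re, Complex.exp_ofReal_mul_I_im, Real.cos_neg, Real.sin_neg, hc, hs]
  set s := Real.sin (t / 2)
  set c := Real.cos (t / 2)
  have hs2 : s ^ 2 = 1 - c ^ 2 := by linarith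
  ring_nf
  simp only [hs2]
  ring

theorem abs_corrected_diff_sq_sub_le {t x y l Z K : ℝ} (ht : |t| ≤ Z * l) (hx : |x| ≤ K * l)
    (hy : |y| ≤ K * l) (hl : 0 ≤ l) (hZ : 0 ≤ Z) (hK : 0 ≤ K) :
    |‖(1 - Complex.I * x) - Complex.exp ((-t : ℝ) * Complex.I) * (1 - Complex.I * y)‖ ^ 2 -
      (t - (x - y)) ^ 2| ≤ (Z ^ 4 + 5 / 2 * K * Z ^ 3 + 2 * K ^ 2 * Z ^ 2) * l ^ 4 := by
  rw [norm_corrected_diff_sq]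
  have e1 := abs_sin_sub_le (t / 2)
  have e2 := Real.one_sub_sq_div_two_le_cos (x := t / 2)
  have e3 := Real.cos_le_one (t / 2)
  have e4 := Real.abs_sin_le_abs (x := t / 2)
  have e5 := Real.abs_cos_le_one (t / 2)
  set s := Real.sin (t / 2)
  set c := Real.cos (t / 2)
  rw [abs_div, abs_two] at e1 e4
  have hxy : |x + y| ≤ 2 * K * l := (abs_add_le _ _).trans (by linarith)
  have hxy' : |x - y| ≤ 2 * K * l := (abs_sub _ _).trans (by linarith)
  have f1 : |2 * s - t| ≤ (Z * l) ^ 3 / 2 := by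
    have : 2 * s - t = 2 * (s - t / 2) := by ring
    rw [this, abs_mul, abs_two]
    have : |t| ^ 3 ≤ (Z * l) ^ 3 := pow_le_pow_left₀ (abs_nonneg _) ht 3
    nlinarith
  have f2 : |1 - c| ≤ (Z * l) ^ 2 / 8 := by
    rw [abs_of_nonneg (by linarith)]
    have : |t| ^ 2 ≤ (Z * l) ^ 2 := pow_le_pow_left₀ (abs_nonneg _) ht 2
    rw [sq_abs] at this
    nlinarith
  have f3 : |2 * s - t + (1 - c) * (x - y)| ≤ (Z * l) ^ 3 / 2 + (Z * l) ^ 2 / 8 * (2 * K * l) := by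
    refine (abs_add_le _ _).trans (add_le_add f1 ?_)
    rw [abs_mul]
    gcongr
  have f4 : |2 * s - c * (x - y) + (t - (x - y))| ≤ 2 * (Z * l) + 2 * (2 * K * l) := by
    have g1 : |2 * s| ≤ Z * l := by
      rw [abs_mul, abs_two]
      linarith
    have g2 : |c * (x - y)| ≤ 2 * K * l := by
      rw [abs_mul]
      calc |c| * |x - y| ≤ 1 * (2 * K * l) := by gcongr
        _ = _ := one_mul _
    rw [abs_le] at *
    constructor <;> linarith
  have f5 : (s * (x + y)) ^ 2 ≤ (Z * l / 2 * (2 * K * l)) ^ 2 := by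
    rw [← sq_abs, abs_mul]
    have : |s| ≤ Z * l / 2 := by linarith
    gcongr
  have h : (s * (x + y)) ^ 2 + (2 * s - c * (x - y)) ^ 2 - (t - (x - y)) ^ 2 =
      (s * (x + y)) ^ 2 + (2 * s - t + (1 - c) * (x - y)) *
        (2 * s - c * (x - y) + (t - (x - y))) := by ring
  rw [h]
  refine (abs_add_le _ _).trans ?_
  rw [abs_of_nonneg (sq_nonneg _), abs_mul]
  calc (s * (x + y)) ^ 2 + |2 * s - t + (1 - c) * (x - y)| *
        |2 * s - c * (x - y) + (t - (x - y))|
      ≤ (Z * l / 2 * (2 * K * l)) ^ 2 + ((Z * l) ^ 3 / 2 + (Z * l) ^ 2 / 8 * (2 * K * l)) *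
        (2 * (Z * l) + 2 * (2 * K * l)) := by gcongr
    _ = _ := by ring

end NonlocalHom

/-! ### The effective form and the approximate eigenfunction -/

namespace NonlocalHom

variable {d : ℕ}

/-- The combination `∑ ξⱼ vⱼ`. -/
noncomputable def combo (v : Fin d → E d → ℝ) (ξ x : E d) : ℝ := ∑ j, ξ j * v j x

theorem memLp_combo {v : Fin d → E d → ℝ} (hv : ∀ j, MemLp (v j) 2 (cellMeasure d)) (ξ : E d) :
    MemLp (combo v ξ) 2 (cellMeasure d) :=
  memLp_finsetSum _ fun j _ => (hv j).const_mul (ξ j)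

variable {a : E d → ℝ} {μ : E d → E d → ℝ} {μm μp : ℝ} (H : Coefficients a μ μm μp)

include H

theorem Coefficients.effMatrix_eq (h2 : Integrable fun x => ‖x‖ ^ 2 * a x)
    {v : Fin d → E d → ℝ} (hv : ∀ j, MemLp (v j) 2 (cellMeasure d)) (k l : Fin d) :
    Integrable (fun p : E d × E d => p.2 k * p.2 l - v k p.1 * p.2 l - v l p.1 * p.2 k)
      (pairMeasure a μ) ∧
    effMatrix a μ v k l = 1 / 2 *
      ∫ p : E d × E d, (p.2 k * p.2 l - v k p.1 * p.2 l - v l p.1 * p.2 k) ∂(pairMeasure a μ) := by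
  have hz : ∀ j, MemLp (fun p : E d × E d => p.2 j) 2 (pairMeasure a μ) := fun j => by
    simpa only [inner_single_one] using H.memLp_inner h2 (EuclideanSpace.single j 1)
  have hi : Integrable (fun p : E d × E d => p.2 k * p.2 l - v k p.1 * p.2 l - v l p.1 * p.2 k)
      (pairMeasure a μ) :=
    (((hz k).integrable_mul (hz l)).sub ((H.memLp_fst (hv k)).integrable_mul (hz l))).sub
      ((H.memLp_fst (hv l)).integrable_mul (hz k))
  refine ⟨hi, ?_⟩
  rw [H.integral_eq_iterated hi, effMatrix]
  congr 2 with x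
  rw [← integral_sub_left_eq_self _ volume x]
  refine integral_congr_ae (.of_forall fun y => ?_)
  simp only [kern, sub_sub_cancel, PiLp.sub_apply, smul_eq_mul]
  ring

theorem Coefficients.quadForm_effMatrix (h1 : Integrable fun x => ‖x‖ ^ 1 * a x)
    (h2 : Integrable fun x => ‖x‖ ^ 2 * a x)
    {v : Fin d → E d → ℝ} (hv : IsCellSolution a μ v) (ξ : E d) :
    quadForm (effMatrix a μ v) ξ =
      1 / 2 * ∫ p, (inner ℝ ξ p.2 - pdiff (combo v ξ) p) ^ 2 ∂(pairMeasure a μ) := by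
  have hΘ := memLp_combo hv.memLp ξ
  have hs : SolvesAux a μ ξ (combo v ξ) := H.solvesAux_of_isCellSolution h1 hv ξ
  have hτ := H.memLp_inner h2 ξ
  have hδ := H.memLp_pdiff hΘ
  have hx := H.memLp_fst hΘ
  have hy := H.memLp_wrap_sub hΘ
  have i1 : Integrable (fun p => (inner ℝ ξ p.2 : ℝ) ^ 2) (pairMeasure a μ) := hτ.integrable_sq
  have i2 : Integrable (fun p => combo v ξ p.1 * inner ℝ ξ p.2) (pairMeasure a μ) :=
    hx.integrable_mul hτ
  have i3 : Integrable (fun p => combo v ξ p.1 * (pdiff (combo v ξ) p - inner ℝ ξ p.2))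
    (pairMeasure a μ) := hx.integrable_mul (hδ.sub hτ)
  have i4 : Integrable (fun p => (combo v ξ p.1 + combo v ξ (wrap (p.1 - p.2))) *
    (pdiff (combo v ξ) p - 2 * inner ℝ ξ p.2)) (pairMeasure a μ) :=
    (hx.add hy).integrable_mul (hδ.sub (hτ.const_mul 2))
  have hweak : ∫ p, combo v ξ p.1 * (pdiff (combo v ξ) p - inner ℝ ξ p.2) ∂(pairMeasure a μ) = 0 :=
    H.integral_smul_eq_zero h2 hΘ hs hΘ
  have hodd : ∫ p, (combo v ξ p.1 + combo v ξ (wrap (p.1 - p.2))) *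
    (pdiff (combo v ξ) p - 2 * inner ℝ ξ p.2) ∂(pairMeasure a μ) = 0 := by
    refine H.integral_flip_neg i4.1 ?_
    filter_upwards [H.ae_flip_flip] with p hp
    have h1 : wrap ((flip p).1 - (flip p).2) = p.1 := congrArg Prod.fst hp
    simp only [pdiff]
    rw [h1]
    simp only [flip, inner_neg_right]
    ring
  have hquad : quadForm (effMatrix a μ v) ξ =
      1 / 2 * ∫ p, ((inner ℝ ξ p.2) ^ 2 - 2 * (combo v ξ p.1 * inner ℝ ξ p.2))
        ∂(pairMeasure a μ) := by
    have hk := fun k l => H.effMatrix_eq h2 hv.memLp k l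
    have e1 : ∀ p : E d × E d, (inner ℝ ξ p.2) ^ 2 - 2 * (combo v ξ p.1 * inner ℝ ξ p.2) =
        ∑ k, ∑ l, (ξ k * ξ l) * (p.2 k * p.2 l - v k p.1 * p.2 l - v l p.1 * p.2 k) := by
      intro p
      have e2 : ∀ k l, (ξ k * ξ l) * (p.2 k * p.2 l - v k p.1 * p.2 l - v l p.1 * p.2 k) =
          (ξ k * p.2 k) * (ξ l * p.2 l) - (ξ k * v k p.1) * (ξ l * p.2 l) -
          (ξ k * p.2 k) * (ξ l * v l p.1) := fun k l => by ring
      simp only [e2, Finset.sum_sub_distrib, ← Finset.mul_sum, ← Finset.sum_mul,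
        ← inner_eq_sum_mul]
      rw [combo]
      ring
    simp only [e1]
    rw [integral_finsetSum _ fun k _ => integrable_finsetSum _ fun l _ => (hk k l).1.const_mul _,
      quadForm, Finset.mul_sum]
    refine Finset.sum_congr rfl fun k _ => ?_
    rw [integral_finsetSum _ fun l _ => (hk k l).1.const_mul _, Finset.mul_sum]
    refine Finset.sum_congr rfl fun l _ => ?_
    rw [(hk k l).2, integral_const_mul]
    ring
  rw [hquad]
  congr 1
  -- The added terms integrate to zero: one is the weak equation tested with the combination itself,
  -- the other is odd under the flip.
  have e3 : ∀ p, (inner ℝ ξ p.2 - pdiff (combo v ξ) p) ^ 2 =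
      (inner ℝ ξ p.2) ^ 2 - 2 * (combo v ξ p.1 * inner ℝ ξ p.2) +
      (2 * (combo v ξ p.1 * (pdiff (combo v ξ) p - inner ℝ ξ p.2)) -
        (combo v ξ p.1 + combo v ξ (wrap (p.1 - p.2))) *
          (pdiff (combo v ξ) p - 2 * inner ℝ ξ p.2)) := by
    intro p
    simp only [pdiff]
    ring
  have i5 : Integrable (fun p => 2 * (combo v ξ p.1 * (pdiff (combo v ξ) p - inner ℝ ξ p.2)) -
        (combo v ξ p.1 + combo v ξ (wrap (p.1 - p.2))) *
          (pdiff (combo v ξ) p - 2 * inner ℝ ξ p.2)) (pairMeasure a μ) := (i3.const_mul 2).sub i4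
  simp only [e3]
  have i6 : Integrable (fun p => (inner ℝ ξ p.2) ^ 2 - 2 * (combo v ξ p.1 * inner ℝ ξ p.2))
    (pairMeasure a μ) := i1.sub (i2.const_mul 2)
  rw [integral_add i6 i5, integral_sub (i3.const_mul 2) i4, integral_const_mul, hweak, hodd]
  ring

/-! ### The corrected constant function -/

/-- The function `1 - i ∑ ξⱼ vⱼ`. -/
noncomputable def corrected (v : Fin d → E d → ℝ) (ξ x : E d) : ℂ := 1 - Complex.I * combo v ξ x

omit H in
theorem memLp_corrected {v : Fin d → E d → ℝ} (hv : ∀ j, MemLp (v j) 2 (cellMeasure d)) (ξ : E d) :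
    MemLp (corrected v ξ) 2 (cellMeasure d) :=
  (memLp_const 1).sub ((memLp_combo hv ξ).ofReal.const_mul Complex.I)

omit H in
theorem twistedDiff_corrected (v : Fin d → E d → ℝ) (ξ : E d) (p : E d × E d) :
    twistedDiff ξ (corrected v ξ) p =
      (1 - Complex.I * combo v ξ p.1) - Complex.exp ((-inner ℝ ξ p.2 : ℝ) * Complex.I) *
        (1 - Complex.I * combo v ξ (wrap (p.1 - p.2))) := by
  rw [twistedDiff, phase_eq, corrected, corrected]

omit H in
theorem ae_abs_combo_le {v : Fin d → E d → ℝ} {N : ℝ}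
    (hN : ∀ j, ∀ᵐ x ∂(cellMeasure d), |v j x| ≤ N) (ξ : E d) :
    ∀ᵐ x ∂(cellMeasure d), |combo v ξ x| ≤ d * N * ‖ξ‖ := by
  filter_upwards [ae_all_iff.2 hN] with x hx
  calc |combo v ξ x| ≤ ∑ j, |ξ j * v j x| := Finset.abs_sum_le_sum_abs _ _
    _ ≤ ∑ _j : Fin d, ‖ξ‖ * N := by
        refine Finset.sum_le_sum fun j _ => ?_
        rw [abs_mul]
        exact mul_le_mul (PiLp.norm_apply_le ξ j) (hx j) (abs_nonneg _) (norm_nonneg _)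
    _ = _ := by simp; ring

omit H in
-- The cell has measure one, and a variance is nonnegative.
theorem integral_norm_le_norm (w : L2 d) : ∫ x in cell d, ‖w x‖ ≤ ‖w‖ := by
  have h1 := ProbabilityTheory.variance_nonneg (fun x => ‖w x‖) (cellMeasure d)
  rw [ProbabilityTheory.variance_eq_sub (Lp.memLp w).norm] at h1
  simp only [Pi.pow_apply, ← norm_sq_eq_integral] at h1
  exact le_of_sq_le_sq (by linarith) (norm_nonneg _)

section bounded

variable (h4 : Integrable fun x => ‖x‖ ^ 4 * a x) {v : Fin d → E d → ℝ} (hv : IsCellSolution a μ v)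
  {N : ℝ} (hN0 : 0 ≤ N) (hN : ∀ j, ∀ᵐ x ∂(cellMeasure d), |v j x| ≤ N)

include h4 hv hN0 hN

/-- The first order part of the twisted difference is `i(⟨ξ,z⟩ - Θ(x) + Θ(x-z))` with `Θ = ∑ξⱼvⱼ`.
By the auxiliary equation it integrates to zero against every function of `x` in `L₂(Ω)`, here
against the conjugate of `w = Au`, and the remainder is of second order in `ξ`. -/
theorem Coefficients.norm_fiberOp_corrected_le {A : L2 d →L[ℂ] L2 d} {ξ : E d}
    (hA : ∀ u w : L2 d, inner ℂ w (A u) =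
      ∫ p, (starRingEnd ℂ) (w p.1) * twistedDiff ξ u p ∂(pairMeasure a μ))
    {u : L2 d} (hu : u =ᵐ[cellMeasure d] corrected v ξ) :
    ‖A u‖ ≤ μp * (2 * moment a 2 + d * N * moment a 1) * ‖ξ‖ ^ 2 := by
  have hM1 := integrable_pow_mul H.integrable h4 (by norm_num : 1 ≤ 4)
  have hM2 := integrable_pow_mul H.integrable h4 (by norm_num : 2 ≤ 4)
  set K := d * N
  set w := A u
  have hw := Lp.memLp w
  have hwn : Integrable (fun x => ‖w x‖) (cellMeasure d) := (hw.integrable (by norm_num)).norm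
  have hwc : MemLp (fun x => (starRingEnd ℂ) (w x)) 2 (cellMeasure d) := hw.star
  have hΘ := memLp_combo hv.memLp ξ
  have hs : SolvesAux a μ ξ (combo v ξ) := H.solvesAux_of_isCellSolution hM1 hv ξ
  have hD := H.memLp_twistedDiff ξ (memLp_corrected hv.memLp ξ)
  have hq : MemLp (fun p => ((pdiff (combo v ξ) p - inner ℝ ξ p.2 : ℝ) : ℂ)) 2 (pairMeasure a μ) :=
    ((H.memLp_pdiff hΘ).sub (H.memLp_inner hM2 ξ)).ofReal
  have hweak : ∫ p, (starRingEnd ℂ) (w p.1) *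
      ((pdiff (combo v ξ) p - inner ℝ ξ p.2 : ℝ) : ℂ) ∂(pairMeasure a μ) = 0 :=
    H.integral_smul_eq_zero hM2 hΘ hs hwc
  have i1 : Integrable (fun p => (starRingEnd ℂ) (w p.1) * twistedDiff ξ (corrected v ξ) p)
    (pairMeasure a μ) := (H.memLp_fst hwc).integrable_mul hD
  have i2 : Integrable (fun p => (starRingEnd ℂ) (w p.1) *
      ((pdiff (combo v ξ) p - inner ℝ ξ p.2 : ℝ) : ℂ)) (pairMeasure a μ) :=
    (H.memLp_fst hwc).integrable_mul hq
  have h1 : inner ℂ w w = ∫ p, ((starRingEnd ℂ) (w p.1) * twistedDiff ξ (corrected v ξ) p +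
      Complex.I * ((starRingEnd ℂ) (w p.1) * ((pdiff (combo v ξ) p - inner ℝ ξ p.2 : ℝ) : ℂ)))
      ∂(pairMeasure a μ) := by
    rw [integral_add i1 (i2.const_mul _), integral_const_mul, hweak, mul_zero, add_zero, hA]
    refine integral_congr_ae ?_
    filter_upwards [H.twistedDiff_congr ξ hu] with p hp
    rw [hp]
  have j1 := H.integrable_mul hwn hM1 (by fun_prop)
  have j2 := H.integrable_mul hwn hM2 (by fun_prop)
  have h2 : ‖w‖ ^ 2 ≤ ∫ p, (2 * ‖ξ‖ ^ 2 * (‖w p.1‖ * ‖p.2‖ ^ 2) +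
      K * ‖ξ‖ ^ 2 * (‖w p.1‖ * ‖p.2‖ ^ 1)) ∂(pairMeasure a μ) := by
    have h3 : ‖w‖ ^ 2 = ‖(inner ℂ w w : ℂ)‖ := by
      rw [inner_self_eq_norm_sq_to_K]
      simp
    rw [h3, h1]
    refine norm_integral_le_of_norm_le ((j2.const_mul _).add (j1.const_mul _)) ?_
    filter_upwards [H.quasi_wrap_sub.ae (ae_abs_combo_le hN ξ)] with p hp
    have h4 := norm_corrected_diff_sub_le (inner ℝ ξ p.2) (combo v ξ p.1)
      (combo v ξ (wrap (p.1 - p.2)))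
    rw [← twistedDiff_corrected] at h4
    have h5 : (starRingEnd ℂ) (w p.1) * twistedDiff ξ (corrected v ξ) p +
        Complex.I * ((starRingEnd ℂ) (w p.1) * ((pdiff (combo v ξ) p - inner ℝ ξ p.2 : ℝ) : ℂ)) =
        (starRingEnd ℂ) (w p.1) * (twistedDiff ξ (corrected v ξ) p - Complex.I *
          ((inner ℝ ξ p.2 - (combo v ξ p.1 - combo v ξ (wrap (p.1 - p.2))) : ℝ) : ℂ)) := by
      simp only [pdiff]
      push_cast
      ring
    rw [h5, norm_mul, RCLike.norm_conj]
    have h6 := abs_real_inner_le_norm ξ p.2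
    have h7 : (inner ℝ ξ p.2) ^ 2 ≤ (‖ξ‖ * ‖p.2‖) ^ 2 := by
      rw [← sq_abs (inner ℝ ξ p.2 : ℝ)]
      exact pow_le_pow_left₀ (abs_nonneg _) h6 2
    calc ‖w p.1‖ * _ ≤ ‖w p.1‖ * (2 * (‖ξ‖ * ‖p.2‖) ^ 2 + ‖ξ‖ * ‖p.2‖ * (K * ‖ξ‖)) := by
          refine mul_le_mul_of_nonneg_left (h4.trans ?_) (norm_nonneg _)
          gcongr
      _ = _ := by ring
  rw [integral_add (j2.const_mul _) (j1.const_mul _), integral_const_mul, integral_const_mul] at h2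
  have k1 := H.integral_mul_le hwn (fun x => norm_nonneg _) hM1 (by fun_prop) fun z => by positivity
  have k2 := H.integral_mul_le hwn (fun x => norm_nonneg _) hM2 (by fun_prop) fun z => by positivity
  have k3 := integral_norm_le_norm w
  have hM10 := moment_nonneg H.nonneg 1
  have hM20 := moment_nonneg H.nonneg 2
  have hμ := H.upper_pos
  have hK : 0 ≤ K := by positivity
  change _ ≤ μp * moment a 1 * _ at k1
  change _ ≤ μp * moment a 2 * _ at k2
  have h3 : ‖w‖ * ‖w‖ ≤ μp * (2 * moment a 2 + K * moment a 1) * ‖ξ‖ ^ 2 * ‖w‖ := by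
    calc ‖w‖ * ‖w‖ = ‖w‖ ^ 2 := by ring
      _ ≤ _ := h2
      _ ≤ 2 * ‖ξ‖ ^ 2 * (μp * moment a 2 * ‖w‖) + K * ‖ξ‖ ^ 2 * (μp * moment a 1 * ‖w‖) := by
          refine add_le_add (mul_le_mul_of_nonneg_left (k2.trans ?_) (by positivity))
            (mul_le_mul_of_nonneg_left (k1.trans ?_) (by positivity)) <;>
          exact mul_le_mul_of_nonneg_left k3 (by positivity)
      _ = _ := by ring
  rcases (norm_nonneg w).eq_or_lt with h | h
  · rw [← h]
    positivity
  · exact le_of_mul_le_mul_right h3 h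

/-- The effective form is half the integral of the squared first order part. The fourth order
pointwise error is integrated, which is where `M₄(a)` is needed. -/
theorem Coefficients.abs_half_integral_sub_quadForm_le (ξ : E d) :
    |1 / 2 * ∫ p, ‖twistedDiff ξ (corrected v ξ) p‖ ^ 2 ∂(pairMeasure a μ) -
        quadForm (effMatrix a μ v) ξ| ≤
      1 / 2 * (μp * (moment a 4 + 5 / 2 * (d * N) * moment a 3 + 2 * (d * N) ^ 2 * moment a 2)) *
        ‖ξ‖ ^ 4 := by
  have hM1 := integrable_pow_mul H.integrable h4 (by norm_num : 1 ≤ 4)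
  have hM2 := integrable_pow_mul H.integrable h4 (by norm_num : 2 ≤ 4)
  have hM3 := integrable_pow_mul H.integrable h4 (by norm_num : 3 ≤ 4)
  set K := d * N
  have hK : 0 ≤ K := by positivity
  have hΘ := memLp_combo hv.memLp ξ
  have i1 := H.integrable_norm_twistedDiff_sq ξ (memLp_corrected hv.memLp ξ)
  have i2 : Integrable (fun p => (inner ℝ ξ p.2 - pdiff (combo v ξ) p) ^ 2) (pairMeasure a μ) :=
    ((H.memLp_inner hM2 ξ).sub (H.memLp_pdiff hΘ)).integrable_sq
  rw [H.quadForm_effMatrix hM1 hM2 hv, ← mul_sub, ← integral_sub i1 i2, abs_mul, mul_assoc,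
    abs_of_pos (by norm_num : (0 : ℝ) < 1 / 2)]
  refine mul_le_mul_of_nonneg_left ?_ (by norm_num)
  have hone : ∀ k : ℕ, (Integrable fun x => ‖x‖ ^ k * a x) →
      ∫ p, ‖p.2‖ ^ k ∂(pairMeasure a μ) ≤ μp * moment a k := by
    intro k hk
    simpa [moment] using H.integral_mul_le (w := fun _ => 1) (q := fun z => ‖z‖ ^ k)
      (integrable_const _) (fun _ => zero_le_one) hk (by fun_prop) (fun z => by positivity)
  have j2 := H.integrable_norm_pow hM2
  have j3 := H.integrable_norm_pow hM3
  have j4 := H.integrable_norm_pow h4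
  have j5 : Integrable (fun p : E d × E d => ‖p.2‖ ^ 4 + 5 / 2 * K * ‖p.2‖ ^ 3)
    (pairMeasure a μ) := j4.add (j3.const_mul _)
  have hb : ‖∫ p, (‖twistedDiff ξ (corrected v ξ) p‖ ^ 2 -
      (inner ℝ ξ p.2 - pdiff (combo v ξ) p) ^ 2) ∂(pairMeasure a μ)‖ ≤
      ∫ p : E d × E d, (‖p.2‖ ^ 4 + 5 / 2 * K * ‖p.2‖ ^ 3 + 2 * K ^ 2 * ‖p.2‖ ^ 2) * ‖ξ‖ ^ 4
        ∂(pairMeasure a μ) := by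
    refine norm_integral_le_of_norm_le ((j5.add (j2.const_mul _)).mul_const _) ?_
    filter_upwards [H.quasi_fst.ae (ae_abs_combo_le hN ξ),
      H.quasi_wrap_sub.ae (ae_abs_combo_le hN ξ)] with p h1 h2
    rw [twistedDiff_corrected]
    refine abs_corrected_diff_sq_sub_le ?_ h1 h2 (norm_nonneg _) (norm_nonneg _) hK
    rw [mul_comm]
    exact abs_real_inner_le_norm ξ p.2
  rw [Real.norm_eq_abs, integral_mul_const, integral_add j5 (j2.const_mul _),
    integral_add j4 (j3.const_mul _), integral_const_mul, integral_const_mul] at hb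
  refine hb.trans (mul_le_mul_of_nonneg_right ?_ (by positivity))
  have k2 := mul_le_mul_of_nonneg_left (hone 2 hM2) (by positivity : 0 ≤ 2 * K ^ 2)
  have k3 := mul_le_mul_of_nonneg_left (hone 3 hM3) (by positivity : 0 ≤ 5 / 2 * K)
  have k4 := hone 4 h4
  linarith

/-- The effective matrix is positive definite. -/
theorem Coefficients.le_quadForm_effMatrix (hd : 1 ≤ d) (η : E d) :
    μm * lowerConst a * ‖η‖ ^ 2 ≤ quadForm (effMatrix a μ v) η := by
  set q := quadForm (effMatrix a μ v)
  set C := 1 / 2 * (μp * (moment a 4 + 5 / 2 * (d * N) * moment a 3 + 2 * (d * N) ^ 2 * moment a 2))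
  have hc : 0 < μm * lowerConst a := mul_pos H.lower_pos (H.lowerConst_pos h4 hd)
  have hq : ∀ t : ℝ, q (t • η) = t ^ 2 * q η := fun t => by
    simp only [q, quadForm, Finset.mul_sum, PiLp.smul_apply, smul_eq_mul]
    exact Finset.sum_congr rfl fun k _ => Finset.sum_congr rfl fun l _ => by ring
  have hlow : ∀ ξ ∈ dualCell d, μm * lowerConst a * ‖ξ‖ ^ 2 ≤ q ξ + C * ‖ξ‖ ^ 4 := by
    intro ξ hξ
    have hψ := memLp_corrected hv.memLp ξ
    have h1 := H.coercive_norm_sq h4 hd hξ (hψ.toLp _)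
    have h2 : ∫ p, ‖twistedDiff ξ (hψ.toLp _) p‖ ^ 2 ∂(pairMeasure a μ) =
        ∫ p, ‖twistedDiff ξ (corrected v ξ) p‖ ^ 2 ∂(pairMeasure a μ) := by
      refine integral_congr_ae ?_
      filter_upwards [H.twistedDiff_congr ξ hψ.coeFn_toLp] with p hp
      rw [hp]
    -- The combination is real, so `|1 - iΘ|² = 1 + Θ²` is at least one.
    have h3 : 1 ≤ ‖hψ.toLp _‖ ^ 2 := by
      rw [norm_sq_eq_integral]
      have h5 : ∫ _x in cell d, (1 : ℝ) ≤ ∫ x in cell d, ‖hψ.toLp _ x‖ ^ 2 := by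
        refine integral_mono_ae (integrable_const _)
          ((memLp_two_iff_integrable_sq_norm (Lp.memLp _).1).1 (Lp.memLp _)) ?_
        filter_upwards [hψ.coeFn_toLp] with x hx
        rw [hx, ← Complex.normSq_eq_norm_sq, Complex.normSq_apply]
        simp [corrected, mul_self_nonneg]
      simpa using h5
    have h6 := H.abs_half_integral_sub_quadForm_le h4 hv hN0 hN ξ
    rw [h2] at h1
    have h7 := (abs_le.1 h6).2
    change _ - q ξ ≤ C * ‖ξ‖ ^ 4 at h7
    have h8 := mul_le_mul_of_nonneg_left h3 (by positivity : 0 ≤ μm * lowerConst a * ‖ξ‖ ^ 2)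
    linarith
  -- With `ξ = tη` and division by `t²`, the fourth order error disappears as `t → 0`.
  have hlim : Filter.Tendsto (fun t : ℝ => q η + C * ‖η‖ ^ 4 * t ^ 2) (nhdsWithin 0 (Set.Ioi 0))
      (nhds (q η)) := by
    have : Filter.Tendsto (fun t : ℝ => q η + C * ‖η‖ ^ 4 * t ^ 2) (nhds 0)
        (nhds (q η + C * ‖η‖ ^ 4 * 0 ^ 2)) := Continuous.tendsto (by fun_prop) 0
    simp only [ne_eq, OfNat.ofNat_ne_zero, not_false_eq_true, zero_pow, mul_zero, add_zero] at this
    exact this.mono_left nhdsWithin_le_nhds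
  refine ge_of_tendsto hlim ?_
  have hsmall : ∀ᶠ t : ℝ in nhds 0, ‖t • η‖ < Real.pi := by
    have : Filter.Tendsto (fun t : ℝ => ‖t • η‖) (nhds 0) (nhds ‖(0 : ℝ) • η‖) :=
      Continuous.tendsto (by fun_prop) 0
    rw [zero_smul, norm_zero] at this
    exact this.eventually (gt_mem_nhds Real.pi_pos)
  filter_upwards [nhdsWithin_le_nhds hsmall, self_mem_nhdsWithin] with t h1 h2
  have h2 : 0 < t := h2
  have hcell : t • η ∈ dualCell d := fun j => by
    have h3 := abs_lt.1 ((PiLp.norm_apply_le (t • η) j).trans_lt h1)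
    exact ⟨h3.1.le, h3.2⟩
  have h3 := hlow _ hcell
  rw [hq, norm_smul, Real.norm_of_nonneg h2.le] at h3
  have h4 : 0 < t ^ 2 := by positivity
  refine le_of_mul_le_mul_left ?_ h4
  nlinarith

end bounded

end NonlocalHom

/-! ### The explicit constant and the final estimate -/

namespace NonlocalHom

variable {d : ℕ}

/-- The bound for the solutions of the auxiliary equations. -/
noncomputable def supBound (μm μp M₁ S B : ℝ) : ℝ :=
  -- The first summand is the level `r` obtained from the `L₂` bound and `1/t₀ ≤ 2μ₋√ℭ`. The second
  -- is the distance `b - r` needed to dominate the right side, as `1/(μ₋‖ã₁‖) ≤ ℭ/2`.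
  (μp * M₁ / (μm * S) + 1) * Real.sqrt (2 * μm * Real.sqrt B) + μp * M₁ * B

/-- A constant of positive definiteness, for the effective matrix and for `𝔸(ξ)`. -/
noncomputable def ellipticity (d : ℕ) (μm m S S' : ℝ) : ℝ :=
  min (μm * min (m / 4) (min (S' / (d * Real.pi ^ 2)) (S / (d * Real.pi ^ 2)))) 1

/-- The constant in the estimate of the resolvent. -/
noncomputable def resolventBound (d : ℕ) (μm μp M₁ M₂ M₃ M₄ m S S' B : ℝ) : ℝ :=
  let N := supBound μm μp M₁ S B
  let c := ellipticity d μm m S S'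
  thresholdBound c (μm * S) (μp * (2 * M₂ + d * N * M₁))
      (1 / 2 * (μp * (M₄ + 5 / 2 * (d * N) * M₃ + 2 * (d * N) ^ 2 * M₂)))
      (1 + d * N * Real.sqrt (d * Real.pi ^ 2)) ((d * N) ^ 2) +
    ((c * Real.pi ^ 2)⁻¹ + 2 * d * (N * (c * Real.pi)⁻¹) + |(d * N) ^ 2| * c⁻¹)

/-- Multiplication by a bounded real function. -/
theorem exists_multiplication {v : E d → ℝ} (hv : AEStronglyMeasurable v (cellMeasure d)) {N : ℝ}
    (hN : ∀ᵐ x ∂(cellMeasure d), |v x| ≤ N) :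
    ∃ V : L2 d →L[ℂ] L2 d, (∀ u, (V u : E d → ℂ) =ᵐ[cellMeasure d] fun x => (v x : ℂ) * u x) ∧
      (∀ u, ‖V u‖ ≤ N * ‖u‖) ∧ ∀ u w, inner ℂ (V u) w = inner ℂ u (V w) := by
  have hle : ∀ u : L2 d, ∀ᵐ x ∂(cellMeasure d), ‖(v x : ℂ) * u x‖ ≤ N * ‖u x‖ := fun u => by
    filter_upwards [hN] with x hx
    rw [norm_mul, Complex.norm_real]
    exact mul_le_mul_of_nonneg_right hx (norm_nonneg _)
  have hm : ∀ u : L2 d, MemLp (fun x => (v x : ℂ) * u x) 2 (cellMeasure d) := fun u =>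
    (Lp.memLp u).of_le_mul ((Complex.continuous_ofReal.comp_aestronglyMeasurable hv).mul
      (Lp.memLp u).1) (hle u)
  let V₀ : L2 d →ₗ[ℂ] L2 d :=
    { toFun := fun u => (hm u).toLp _
      map_add' := fun u w => by
        refine Lp.ext ?_
        filter_upwards [(hm (u + w)).coeFn_toLp, (hm u).coeFn_toLp, (hm w).coeFn_toLp,
          Lp.coeFn_add u w, Lp.coeFn_add ((hm u).toLp _) ((hm w).toLp _)] with x h1 h2 h3 h4 h5
        rw [h1, h5, Pi.add_apply, h2, h3, h4, Pi.add_apply, mul_add]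
      map_smul' := fun c u => by
        refine Lp.ext ?_
        filter_upwards [(hm (c • u)).coeFn_toLp, (hm u).coeFn_toLp,
          Lp.coeFn_smul c u, Lp.coeFn_smul c ((hm u).toLp _)] with x h1 h2 h3 h4
        rw [h1, RingHom.id_apply, h4, Pi.smul_apply, h2, h3, Pi.smul_apply, smul_eq_mul, smul_eq_mul]
        ring }
  have hV₀ : ∀ u, (V₀ u : E d → ℂ) =ᵐ[cellMeasure d] fun x => (v x : ℂ) * u x :=
    fun u => (hm u).coeFn_toLp
  have hb : ∀ u, ‖V₀ u‖ ≤ N * ‖u‖ := fun u => by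
    refine Lp.norm_le_mul_norm_of_ae_le_mul ?_
    filter_upwards [hV₀ u, hle u] with x h1 h2
    rwa [h1]
  refine ⟨V₀.mkContinuous N hb, hV₀, hb, fun u w => ?_⟩
  rw [inner_eq_integral, inner_eq_integral]
  refine integral_congr_ae ?_
  filter_upwards [hV₀ u, hV₀ w] with x h1 h2
  simp only [LinearMap.mkContinuous_apply]
  rw [h1, h2, map_mul, Complex.conj_ofReal]
  ring

/-- The resolvent of a bounded operator with nonnegative form. -/
theorem exists_isResolvent {G : L2 d → L2 d → Prop} {A : L2 d →L[ℂ] L2 d}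
    (hG : ∀ u h, G u h ↔ h = A u) (hA : ∀ u, 0 ≤ (inner ℂ (A u) u : ℂ).re) {ε : ℝ} (hε : 0 < ε) :
    ∃ R : L2 d →L[ℂ] L2 d, IsResolvent G ε R := by
  have hunit : IsUnit (A + ((ε ^ 2 : ℝ) : ℂ) • (1 : L2 d →L[ℂ] L2 d)) := by
    have hc : (0 : ℝ) < ε ^ 2 := by positivity
    refine ContinuousLinearMap.isUnit_of_forall_le_norm_inner_map (c := ⟨ε ^ 2, hc.le⟩) _
      hc fun u => ?_
    refine le_trans ?_ (Complex.re_le_norm _)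
    have : (A + ((ε ^ 2 : ℝ) : ℂ) • (1 : L2 d →L[ℂ] L2 d)) u = A u + ((ε ^ 2 : ℝ) : ℂ) • u := rfl
    rw [this, inner_add_left, inner_smul_left, inner_self_eq_norm_sq_to_K, Complex.conj_ofReal,
      Complex.add_re]
    have h2 : (((ε ^ 2 : ℝ) : ℂ) * ((‖u‖ : ℂ)) ^ 2).re = ‖u‖ ^ 2 * ε ^ 2 := by
      rw [← Complex.ofReal_pow, ← Complex.ofReal_mul, Complex.ofReal_re, mul_comm]
    have h3 := hA u
    exact h2.ge.trans (le_add_of_nonneg_left h3)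
  obtain ⟨B, hB⟩ := hunit
  have h1 : ∀ f, (↑B : L2 d →L[ℂ] L2 d) ((↑B⁻¹ : L2 d →L[ℂ] L2 d) f) = f := fun f => by
    show ((↑B : L2 d →L[ℂ] L2 d) * (↑B⁻¹ : L2 d →L[ℂ] L2 d)) f = _
    rw [B.mul_inv]
    rfl
  have h2 : ∀ f, (↑B⁻¹ : L2 d →L[ℂ] L2 d) ((↑B : L2 d →L[ℂ] L2 d) f) = f := fun f => by
    show ((↑B⁻¹ : L2 d →L[ℂ] L2 d) * (↑B : L2 d →L[ℂ] L2 d)) f = _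
    rw [B.inv_mul]
    rfl
  have h3 : ∀ u, (↑B : L2 d →L[ℂ] L2 d) u = A u + ((ε ^ 2 : ℝ) : ℂ) • u := fun u => by
    rw [hB]
    rfl
  refine ⟨↑B⁻¹, fun f u => ?_⟩
  rw [hG, sub_eq_iff_eq_add, ← h3]
  constructor
  · rintro rfl
    exact (h1 f).symm
  · rintro rfl
    exact h2 u

section

variable {a : E d → ℝ} {μ : E d → E d → ℝ} {μm μp : ℝ} (H : Coefficients a μ μm μp)
  (hd : 1 ≤ d) (h4 : Integrable fun x => ‖x‖ ^ 4 * a x) {t₀ : ℝ} (ht : IsThreshold a μm μp t₀)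
  {v : Fin d → E d → ℝ} (hv : IsCellSolution a μ v)

include H hd h4 ht hv

theorem Coefficients.ae_abs_le_supBound (j : Fin d) :
    ∀ᵐ x ∂(cellMeasure d), |v j x| ≤
      supBound μm μp (moment a 1) (symbolInf a Real.pi) (boundConst a μm μp t₀) := by
  have hM1 := integrable_pow_mul H.integrable h4 (by norm_num : 1 ≤ 4)
  have hξ : ‖(EuclideanSpace.single j (1 : ℝ) : E d)‖ = 1 := by simp
  have hs : SolvesAux a μ (EuclideanSpace.single j (1 : ℝ)) (v j) := by
    have := H.solvesAux_of_isCellSolution hM1 hv (EuclideanSpace.single j (1 : ℝ))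
    simpa [PiLp.single_apply] using this
  have hsq := H.integral_sq_le hd h4 hξ (hv.memLp j) hs (hv.mean_zero j)
  have hκ : 0 < μm * symbolInf a Real.pi := mul_pos H.lower_pos
    (symbolInf_pos hd H.integrable H.nonneg H.integral_pos Real.pi_pos)
  have hB : 0 < μp * moment a 1 := mul_pos H.upper_pos (moment_pos hd H.nonneg H.integral_pos hM1)
  have hm := mul_pos H.lower_pos (truncMass_pos H.integrable H.nonneg H.integral_pos)
  have h1 := inv_threshold_le hd H.integrable H.nonneg H.integral_pos (μp := μp) H.lower_pos ht.1
  have h2 := inv_truncMass_le (t₀ := t₀) H.integrable H.nonneg H.integral_pos H.lower_pos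
    H.upper_pos.le
  set Q := μp * moment a 1 / (μm * symbolInf a Real.pi)
  set T := 2 * μm * Real.sqrt (boundConst a μm μp t₀)
  have hQ : 0 < Q := by positivity
  have hT : 0 < T := (inv_pos.2 ht.1).trans_le h1
  refine H.ae_abs_le_of_solvesAux hd h4 ht hξ (hv.memLp j) hs (r := (Q + 1) * Real.sqrt T)
    (by positivity) ?_ ?_
  · rw [mul_pow, Real.sq_sqrt hT.le]
    have h3 : 1 ≤ T * t₀ := by
      rw [inv_eq_one_div, div_le_iff₀ ht.1] at h1
      exact h1
    calc ∫ x in cell d, v j x ^ 2 ≤ Q ^ 2 * 1 := by rw [mul_one]; exact hsq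
      _ ≤ (Q + 1) ^ 2 * (T * t₀) := by
          gcongr
          linarith
      _ = _ := by ring
  · rw [supBound, add_sub_cancel_left]
    have h3 : 1 ≤ boundConst a μm μp t₀ / 2 * (μm * truncMass a) := by
      rw [inv_eq_one_div, div_le_iff₀ hm] at h2
      exact h2
    nlinarith

theorem Coefficients.exists_resolvent_estimate {ξ : E d} (hξ : ξ ∈ dualCell d) {ε : ℝ} (hε : 0 < ε) :
    ∃ R R₀ K : L2 d →L[ℂ] L2 d,
      IsResolvent (FiberGraph a μ ξ) ε R ∧
      IsResolvent (EffGraph (effMatrix a μ v) ξ) ε R₀ ∧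
      IsCorrector v ξ R₀ K ∧
      ‖R - R₀ - K‖ ≤ resolventBound d μm μp (moment a 1) (moment a 2) (moment a 3) (moment a 4)
        (secondMin a) (symbolInf a Real.pi) (symbolInf a (radius a)) (boundConst a μm μp t₀) := by
  have hM1 := integrable_pow_mul H.integrable h4 (by norm_num : 1 ≤ 4)
  have hM10 := moment_nonneg H.nonneg 1
  have hM20 := moment_nonneg H.nonneg 2
  have hM30 := moment_nonneg H.nonneg 3
  have hM40 := moment_nonneg H.nonneg 4
  have hμp := H.upper_pos
  have hμm := H.lower_pos
  have hS := symbolInf_pos hd H.integrable H.nonneg H.integral_pos Real.pi_pos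
  have hN := H.ae_abs_le_supBound hd h4 ht hv
  have hBC : 0 ≤ boundConst a μm μp t₀ := le_max_of_le_left (by positivity)
  set N := supBound μm μp (moment a 1) (symbolInf a Real.pi) (boundConst a μm μp t₀) with hNdef
  have hN0 : 0 ≤ N := by
    rw [hNdef, supBound]
    positivity
  set c := ellipticity d μm (secondMin a) (symbolInf a Real.pi) (symbolInf a (radius a)) with hcdef
  have hc_le : c ≤ μm * lowerConst a := min_le_left _ _
  have hc1 : c ≤ 1 := min_le_right _ _
  have hc : 0 < c := lt_min (mul_pos hμm (H.lowerConst_pos h4 hd)) one_pos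
  have hg : ∀ η, c * ‖η‖ ^ 2 ≤ quadForm (effMatrix a μ v) η := fun η =>
    (mul_le_mul_of_nonneg_right hc_le (sq_nonneg _)).trans
      (H.le_quadForm_effMatrix h4 hv hN0 hN hd η)
  obtain ⟨A, hA, hG⟩ := H.exists_fiberOp ξ
  have hAself : ∀ u : L2 d, inner ℂ (A u) u =
      ((1 / 2 * ∫ p, ‖twistedDiff ξ u p‖ ^ 2 ∂(pairMeasure a μ) : ℝ) : ℂ) := fun u => by
    rw [← inner_conj_symm, hA, H.integral_conj_mul_self ξ (Lp.memLp u), Complex.conj_ofReal]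
  have hAsymm : ∀ u w : L2 d, inner ℂ (A u) w = inner ℂ u (A w) := by
    intro u w
    rw [← inner_conj_symm, hA, hA, ← H.half_integral_conj_mul ξ (Lp.memLp _) (Lp.memLp _),
      ← H.half_integral_conj_mul ξ (Lp.memLp _) (Lp.memLp _), map_mul, ← integral_conj]
    congr 1
    · rw [map_div₀, map_one, map_ofNat]
    · congr 1 with p
      rw [map_mul, Complex.conj_conj, mul_comm]
  have hcoer : ∀ u : L2 d, c * ‖ξ‖ ^ 2 * ‖u‖ ^ 2 ≤ (inner ℂ (A u) u : ℂ).re := fun u => by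
    rw [hAself, Complex.ofReal_re]
    refine le_trans ?_ (H.coercive_norm_sq h4 hd hξ u)
    gcongr
  have hgap : ∀ u : L2 d, inner ℂ (expoLp 0) u = 0 →
      μm * symbolInf a Real.pi * ‖u‖ ^ 2 ≤ (inner ℂ (A u) u : ℂ).re := fun u hu => by
    rw [hAself, Complex.ofReal_re]
    exact H.coercive_gap hξ hu
  obtain ⟨R, hR⟩ := exists_isResolvent hG
    (fun u => (by positivity : 0 ≤ c * ‖ξ‖ ^ 2 * ‖u‖ ^ 2).trans (hcoer u)) hε
  obtain ⟨R₀, T, hR₀, hT, hres₀, hTD, hDT⟩ := exists_effective_resolvent hc hg hε ξ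
  choose V hV hVN hVs using fun j => exists_multiplication (hv.memLp j).1 (hN j)
  set θ : L2 d := (-Complex.I) • ∑ j, (ξ j : ℂ) • V j (expoLp 0) with hθ
  have hψ : (expoLp 0 + θ : L2 d) =ᵐ[cellMeasure d] corrected v ξ := by
    have h1 : ∀ j, ((ξ j : ℂ) • V j (expoLp 0) : L2 d) =ᵐ[cellMeasure d]
        fun x => (ξ j : ℂ) * v j x := fun j => by
      filter_upwards [Lp.coeFn_smul (ξ j : ℂ) (V j (expoLp 0)), hV j (expoLp 0),
        coeFn_expoLp (d := d) 0] with x e1 e2 e3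
      rw [e1, Pi.smul_apply, e2, e3, expo_zero_index, mul_one, smul_eq_mul]
    filter_upwards [Lp.coeFn_add (expoLp 0) θ, coeFn_expoLp (d := d) 0,
      Lp.coeFn_smul (-Complex.I) (∑ j, (ξ j : ℂ) • V j (expoLp 0)),
      Lp.coeFn_finsetSum Finset.univ (fun j => (ξ j : ℂ) • V j (expoLp 0)),
      ae_all_iff.2 h1] with x e1 e2 e3 e4 e5
    rw [e1, Pi.add_apply, e2, hθ, e3, Pi.smul_apply, e4, Finset.sum_apply, expo_zero_index,
      corrected, combo]
    simp only [e5, smul_eq_mul]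
    push_cast
    ring
  have hθn : ‖θ‖ ≤ d * N * ‖ξ‖ := by
    rw [hθ, norm_smul, norm_neg, Complex.norm_I, one_mul]
    calc ‖∑ j, (ξ j : ℂ) • V j (expoLp 0)‖ ≤ ∑ _j : Fin d, ‖ξ‖ * N := by
          refine (norm_sum_le _ _).trans (Finset.sum_le_sum fun j _ => ?_)
          rw [norm_smul, Complex.norm_real]
          refine mul_le_mul (PiLp.norm_apply_le ξ j) ?_ (norm_nonneg _) (norm_nonneg _)
          simpa [norm_expoLp] using hVN j (expoLp 0)
      _ = _ := by simp; ring
  have hθ2 : ‖θ‖ ^ 2 ≤ (d * N) ^ 2 * ‖ξ‖ ^ 2 := by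
    rw [← mul_pow]
    exact pow_le_pow_left₀ (norm_nonneg _) hθn 2
  have hoθ : inner ℂ (expoLp 0) θ = 0 := by
    have h1 : ∀ j, inner ℂ (expoLp 0) (V j (expoLp 0)) = 0 := fun j => by
      have h2 : inner ℂ (expoLp 0) (V j (expoLp 0)) = ((∫ x in cell d, v j x : ℝ) : ℂ) := by
        rw [inner_eq_integral]
        refine Eq.trans (integral_congr_ae ?_) (integral_ofReal (𝕜 := ℂ))
        filter_upwards [hV j (expoLp 0), coeFn_expoLp (d := d) 0] with x e1 e2
        rw [e1, e2]
        simp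
      rw [h2, hv.mean_zero, Complex.ofReal_zero]
    rw [hθ, inner_smul_right, inner_sum,
      Finset.sum_eq_zero fun j _ => by rw [inner_smul_right, h1, mul_zero], mul_zero]
  have hψn : ‖(expoLp 0 + θ : L2 d)‖ ≤ 1 + d * N * Real.sqrt (d * Real.pi ^ 2) := by
    refine (norm_add_le _ _).trans ?_
    rw [norm_expoLp]
    have := Real.le_sqrt_of_sq_le (norm_sq_le_of_mem_dualCell hξ)
    have := mul_le_mul_of_nonneg_left this (by positivity : 0 ≤ d * N)
    linarith
  have hAψ := H.norm_fiberOp_corrected_le h4 hv hN0 hN hA hψ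
  have hs : ‖inner ℂ (A (expoLp 0 + θ)) (expoLp 0 + θ) - (quadForm (effMatrix a μ v) ξ : ℂ)‖ ≤
      1 / 2 * (μp * (moment a 4 + 5 / 2 * (d * N) * moment a 3 + 2 * (d * N) ^ 2 * moment a 2)) *
        (‖ξ‖ ^ 2) ^ 2 := by
    have h1 : ∫ p, ‖twistedDiff ξ (expoLp 0 + θ : L2 d) p‖ ^ 2 ∂(pairMeasure a μ) =
        ∫ p, ‖twistedDiff ξ (corrected v ξ) p‖ ^ 2 ∂(pairMeasure a μ) := by
      refine integral_congr_ae ?_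
      filter_upwards [H.twistedDiff_congr ξ hψ] with p hp
      rw [hp]
    rw [hAself, h1, ← Complex.ofReal_sub, Complex.norm_real, ← pow_mul]
    exact H.abs_half_integral_sub_quadForm_le h4 hv hN0 hN ξ
  set K : L2 d →L[ℂ] L2 d :=
    (-Complex.I) • ∑ j, (V j).comp (T j) + Complex.I • ∑ j, (T j).comp (V j) with hK
  have hKf : ∀ f, K f = (-Complex.I) • ∑ j, V j (T j f) + Complex.I • ∑ j, T j (V j f) := fun f => by
    simp [hK]
  -- The second `T` is the continuous extension of the resolvent times the derivative, the same
  -- multiplier as the derivative of the resolvent.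
  refine ⟨R, R₀, K, hR, hres₀, ⟨V, T, T, hV, hTD, hDT, hK⟩, ?_⟩
  have hbound : ∀ f, ‖(R - R₀ - K) f‖ ≤ resolventBound d μm μp (moment a 1) (moment a 2)
      (moment a 3) (moment a 4) (secondMin a) (symbolInf a Real.pi) (symbolInf a (radius a))
      (boundConst a μm μp t₀) * ‖f‖ := by
    intro f
    have hRf : A (R f) + ((ε ^ 2 : ℝ) : ℂ) • R f = f := by
      have h1 := (hG _ _).1 ((hR f (R f)).1 rfl)
      rw [← h1, sub_add_cancel]
    -- The small parameters are `lam = |ξ|²`, `δ = ε²` and `s = ⟨g⁰ξ,ξ⟩`. With this `s` both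
    -- approximations contain the same rank one operator, which cancels in the difference.
    have b1 := norm_resolvent_sub_rankOne_le hAsymm (norm_expoLp 0) hoθ hc hc1 (mul_pos hμm hS)
      (by positivity) (by positivity) (sq_nonneg ‖ξ‖) (by positivity : 0 < ε ^ 2) hψn hθ2
      (sq_nonneg _) hcoer hgap hAψ hs (hg ξ) hRf
    have b2 := norm_effective_add_corrector_sub_le hc hg hε hξ hR₀ hT hN0 hVN hVs hθ hθ2 f
    rw [← hKf] at b2
    set ρ := (((quadForm (effMatrix a μ v) ξ + ε ^ 2)⁻¹ : ℝ) : ℂ) •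
      inner ℂ (expoLp 0 + θ) f • (expoLp 0 + θ)
    have h1 : (R - R₀ - K) f = (R f - ρ) - (R₀ f + K f - ρ) := by
      simp only [sub_apply]
      abel
    rw [h1]
    refine (norm_sub_le _ _).trans ((add_le_add b1 b2).trans_eq ?_)
    rw [← add_mul]
    rfl
  refine ContinuousLinearMap.opNorm_le_bound' _ ?_ fun f _ => hbound f
  have h1 := (norm_nonneg _).trans (hbound (expoLp 0))
  rwa [norm_expoLp, mul_one] at h1

end

end NonlocalHom

theorem theorem3p5 (d : ℕ) (hd : 1 ≤ d) :
    ∃ C₂ : (Fin 10 → ℝ) → ℝ,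
      ∀ (a : E d → ℝ) (μ : E d → E d → ℝ) (μm μp : ℝ),
        Coefficients a μ μm μp →
        Integrable (fun x => ‖x‖ ^ 4 * a x) →
        (∃ t₀, IsThreshold a μm μp t₀) ∧
        (∃ v, IsCellSolution a μ v) ∧
        ∀ t₀, IsThreshold a μm μp t₀ →
        ∀ v, IsCellSolution a μ v →
        ∀ ξ ∈ dualCell d, ∀ ε : ℝ, 0 < ε →
          ∃ R R₀ K : L2 d →L[ℂ] L2 d,
            IsResolvent (FiberGraph a μ ξ) ε R ∧
            IsResolvent (EffGraph (effMatrix a μ v) ξ) ε R₀ ∧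
            IsCorrector v ξ R₀ K ∧
            ‖R - R₀ - K‖ ≤
              C₂ ![μm, μp, moment a 1, moment a 2, moment a 3, moment a 4,
                secondMin a, symbolInf a Real.pi, symbolInf a (radius a),
                boundConst a μm μp t₀] := by
  refine ⟨fun p => resolventBound d (p 0) (p 1) (p 2) (p 3) (p 4) (p 5) (p 6) (p 7) (p 8) (p 9),
    fun a μ μm μp H h4 => ⟨?_, H.exists_isCellSolution h4 hd, ?_⟩⟩
  · exact exists_isThreshold H.integrable H.nonneg H.integral_pos H.lower_pos H.upper_pos
  · intro t₀ ht v hv ξ hξ ε hε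
    exact H.exists_resolvent_estimate hd h4 ht hv hξ hε
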